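/- Let $N\in\mathbb N$, let $\Omega\subset\mathbb{R}^N$ be a bounded domain (open, connected, non-empty; no regularity of $\partial\Omega$ is assumed), and let $\mathcal{O}\subset\mathbb{R}^N$ be an open set with $\overline\Omega\subset\mathcal{O}$. Let $\mathcal{S}_N$ be the space of real symmetric $N\times N$ matrices with its usual partial order, and let $F:\mathcal{O}\times\mathbb{R}\times\mathbb{R}^N\times\mathcal{S}_N\to\mathbb{R}$ be a continuous function such that: (H1) $F(x,r,p,X+Y)-F(x,r,p,X)\le 0$ for all $(x,r,p)\in\mathcal{O}\times\mathbb{R}\times\mathbb{R}^N$ and $X,Y\in\mathcal{S}_N$ with $Y\ge 0$; (H2) for some $\alpha>0$, $F(x,\tau r,\tau p,\tau X)=\tau^\alpha F(x,r,p,X)$ for all $(x,r,p,X)\in\mathcal{O}\times\mathbb{R}\times\mathbb{R}^N\times\mathcal{S}_N$ and $\tau\ge 0$; (H3) $r\mapsto F(x,r,p,X)$ is continuous, uniformly with respect to $(x,p,X)$, i.e. for every $r\in\mathbb{R}$ and $\varepsilon>0$ there is $\delta>0$ such that $|F(x,s,p,X)-F(x,r,p,X)|<\varepsilon$ whenever $|s-r|<\delta$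 and $(x,p,X)\in\mathcal{O}\times\mathbb{R}^N\times\mathcal{S}_N$; (H4) for every $R>0$ there is $\omega\in C([0,+\infty))$ with $\omega(0)=0$ such that, whenever $X,Y\in\mathcal{S}_N$ and $\sigma>0$ satisfy $$-3\sigma\begin{pmatrix} I&0\\0&I\end{pmatrix}\le\begin{pmatrix} X&0\\0&-Y\end{pmatrix}\le 3\sigma\begin{pmatrix} I&-I\\-I&I\end{pmatrix},$$ one has $F(y,r,\sigma(x-y),Y)-F(x,r,\sigma(x-y),X)\le\omega(\sigma|x-y|^2+|x-y|)$ for all $x,y\in\mathcal{O}$ and $|r|\le R$. An upper semicontinuous function $u:\overline\Omega\to\mathbb{R}$ is a viscosity subsolution of the Dirichlet problem $F(x,u,Du,D^2u)=0$ in $\Omega$, $u=0$ on $\partial\Omega$, if for every $\varphi\in C^2(\mathbb{R}^N)$ and every $\xi\in\overline\Omega$ with $(u-\varphi)(\xi)=\max_{\overline\Omega}(u-\varphi)$ one has $$F(\xi,u(\xi),D\varphi(\xi),D^2\varphi(\xi))\le 0\quad\text{if }\xi\in\Omega,$$ $$\min\big[u(\xi),\,F(\xi,u(\xi),D\varphi(\xi),D^2\varphi(\xi))\big]\le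 0\quad\text{if }\xi\in\partial\Omega.$$ One says that $F$ satisfies the Maximum Principle (MP) in $\Omega$ if every such subsolution satisfies $u\le 0$ in $\overline\Omega$. Let $\mu_1(F,\Omega)\in[-\infty,+\infty]$ be the supremum of all $\lambda\in\mathbb{R}$ for which there exist an open set $\Omega'$ with $\overline\Omega\subset\Omega'\subset\mathcal{O}$ and a lower semicontinuous function $\phi:\Omega'\to(0,+\infty)$ satisfying $F(x,\phi,D\phi,D^2\phi)-\lambda\phi^\alpha\ge 0$ in $\Omega'$ in the viscosity sense, that is, $F(\xi,\phi(\xi),D\psi(\xi),D^2\psi(\xi))-\lambda\phi(\xi)^\alpha\ge 0$ whenever $\psi\in C^2(\mathbb{R}^N)$ and $\phi-\psi$ has a local minimum at $\xi\in\Omega'$. Then $F$ satisfies MP in $\Omega$ if and only if $\mu_1(F,\Omega)>0$. -/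

import Mathlib

namespace DegenerateMP

/-- `ℝᴺ` with its Euclidean norm. -/
abbrev Space (N : ℕ) : Type := EuclideanSpace ℝ (Fin N)

/-- Real `N × N` matrices; the symmetric ones are singled out by `Matrix.IsSymm`. -/
abbrev Mat (N : ℕ) : Type := Matrix (Fin N) (Fin N) ℝ

/-- The nonlinearity `(x, r, p, X) ↦ F(x, r, p, X)` of a second order operator. Only its values at
`x` in the open set where the operator lives and at symmetric `X` are ever constrained or used. -/
abbrev Operator (N : ℕ) : Type := Space N → ℝ → Space N → Mat N → ℝ

/-- The Hessian matrix `D²φ(x)` in the standard basis. -/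
noncomputable def hessian {N : ℕ} (φ : Space N → ℝ) (x : Space N) : Mat N :=
  Matrix.of fun i j =>
    fderiv ℝ (fderiv ℝ φ) x (EuclideanSpace.single i 1) (EuclideanSpace.single j 1)

/-- `F` is (jointly) continuous on `O × ℝ × ℝᴺ × S_N`. -/
def IsContinuousOperator {N : ℕ} (O : Set (Space N)) (F : Operator N) : Prop :=
  ContinuousOn (fun q : Space N × ℝ × Space N × Mat N => F q.1 q.2.1 q.2.2.1 q.2.2.2)
    {q | q.1 ∈ O ∧ q.2.2.2.IsSymm}

/-- Degenerate ellipticity: `F(x,r,p,X+Y) - F(x,r,p,X) ≤ 0` for symmetric `X` and `Y ≥ 0`. -/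
def IsDegenerateElliptic {N : ℕ} (O : Set (Space N)) (F : Operator N) : Prop :=
  ∀ x ∈ O, ∀ (r : ℝ) (p : Space N) (X Y : Mat N), X.IsSymm → Y.PosSemidef →
    F x r p (X + Y) - F x r p X ≤ 0

/-- Positive homogeneity of degree `α` in `(r, p, X)`. -/
def IsPosHomogeneous {N : ℕ} (O : Set (Space N)) (F : Operator N) (α : ℝ) : Prop :=
  ∀ x ∈ O, ∀ (r : ℝ) (p : Space N) (X : Mat N), X.IsSymm → ∀ τ : ℝ, 0 ≤ τ →
    F x (τ * r) (τ • p) (τ • X) = τ ^ α * F x r p X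

/-- `r ↦ F(x,r,p,X)` is continuous (at every `r`), uniformly with respect to `(x,p,X)`. -/
def IsContinuousInValueUniformly {N : ℕ} (O : Set (Space N)) (F : Operator N) : Prop :=
  ∀ r : ℝ, ∀ ε > 0, ∃ δ > 0, ∀ s : ℝ, |s - r| < δ →
    ∀ x ∈ O, ∀ (p : Space N) (X : Mat N), X.IsSymm → |F x s p X - F x r p X| < ε

/-- The two-sided matrix inequality
`-3σ (I 0; 0 I) ≤ (X 0; 0 -Y) ≤ 3σ (I -I; -I I)` in the Loewner order. -/
def DoublingIneq {N : ℕ} (σ : ℝ) (X Y : Mat N) : Prop :=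
  (Matrix.fromBlocks X 0 0 (-Y) - (-(3 * σ)) • Matrix.fromBlocks 1 0 0 1).PosSemidef ∧
  ((3 * σ) • Matrix.fromBlocks 1 (-1) (-1) 1 - Matrix.fromBlocks X 0 0 (-Y)).PosSemidef

/-- The Crandall–Ishii–Lions structure condition. -/
def StructureCondition {N : ℕ} (O : Set (Space N)) (F : Operator N) : Prop :=
  ∀ R > 0, ∃ ω : ℝ → ℝ, ContinuousOn ω (Set.Ici 0) ∧ ω 0 = 0 ∧
    ∀ X Y : Mat N, X.IsSymm → Y.IsSymm → ∀ σ > 0, DoublingIneq σ X Y →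
      ∀ x ∈ O, ∀ y ∈ O, ∀ r : ℝ, |r| ≤ R →
        F y r (σ • (x - y)) Y - F x r (σ • (x - y)) X ≤ ω (σ * ‖x - y‖ ^ 2 + ‖x - y‖)

/-- `u` is a viscosity subsolution of `F[u] = 0` in `Ω`, `u = 0` on `∂Ω`, the boundary condition
being understood in the relaxed viscosity sense: at a boundary point either `u ≤ 0` or the
differential inequality holds. As `closure Ω` is compact in the theorem, `C²` functions on a
neighbourhood of it and restrictions of `C²` functions on `ℝᴺ` are the same test functions. -/
def IsDirichletSubsolution {N : ℕ} (F : Operator N) (Ω : Set (Space N)) (u : Space N → ℝ) : Prop :=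
  ∀ φ : Space N → ℝ, ContDiff ℝ 2 φ → ∀ ξ ∈ closure Ω,
    IsMaxOn (fun x => u x - φ x) (closure Ω) ξ →
      (ξ ∈ Ω → F ξ (u ξ) (gradient φ ξ) (hessian φ ξ) ≤ 0) ∧
      (ξ ∈ frontier Ω → min (u ξ) (F ξ (u ξ) (gradient φ ξ) (hessian φ ξ)) ≤ 0)

/-- The Maximum Principle: every upper semicontinuous viscosity subsolution of the Dirichlet problem
is nonpositive on `closure Ω`. -/
def MaximumPrinciple {N : ℕ} (F : Operator N) (Ω : Set (Space N)) : Prop :=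
  ∀ u : Space N → ℝ, UpperSemicontinuousOn u (closure Ω) → IsDirichletSubsolution F Ω u →
    ∀ x ∈ closure Ω, u x ≤ 0

/-- `φ` is a viscosity supersolution of `G[φ] ≥ 0` in the open set `U`. -/
def IsSupersolution {N : ℕ} (G : Operator N) (U : Set (Space N)) (φ : Space N → ℝ) : Prop :=
  ∀ ψ : Space N → ℝ, ContDiff ℝ 2 ψ → ∀ ξ ∈ U, IsLocalMin (fun x => φ x - ψ x) ξ →
    0 ≤ G ξ (φ ξ) (gradient ψ ξ) (hessian ψ ξ)

/-- The generalized principal eigenvalue `μ₁(F, Ω)`, an extended real number: the supremum of the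
`l` for which there are an open `Ω'` with `closure Ω ⊆ Ω' ⊆ O` and a positive lower semicontinuous
viscosity supersolution of `F[φ] - l φ^α ≥ 0` in `Ω'`. -/
noncomputable def mu1 {N : ℕ} (O : Set (Space N)) (F : Operator N) (α : ℝ) (Ω : Set (Space N)) :
    EReal :=
  sSup {m : EReal | ∃ l : ℝ, m = (l : EReal) ∧
    ∃ Ω' : Set (Space N), IsOpen Ω' ∧ closure Ω ⊆ Ω' ∧ Ω' ⊆ O ∧
      ∃ φ : Space N → ℝ, LowerSemicontinuousOn φ Ω' ∧ (∀ x ∈ Ω', 0 < φ x) ∧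
        IsSupersolution (fun x r p X => F x r p X - l * r ^ α) Ω' φ}

end DegenerateMP

namespace DegenerateMP

open Filter Topology Set
open scoped RealInnerProductSpace Matrix

/-! ### Second order calculus at a point -/

section Calculus

variable {E : Type*} [NormedAddCommGroup E] [NormedSpace ℝ E]

/-! If `0 < mu1`, some `l > 0` has a positive supersolution `φ` on a neighbourhood of `closure Ω`.
Suppose a subsolution `u` is positive somewhere. By homogeneity `φ` can be scaled so that `t φ`
touches `u` from above, and at the contact point one expects both `F ≤ 0` and `F ≥ l (t φ)^α > 0`.
Since neither function is smooth, variables are doubled: `u x - t φ y - σ/2 |x - y|²` is maximized,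
the theorem on sums `exists_closureJets` supplies ordered second order jets, and the structure
condition gives the contradiction as `σ → ∞`. Here `x` stays in `closure Ω` while `y` ranges over a
compact neighbourhood of it. The boundary therefore needs no regularity: where `u > 0` the relaxed
boundary condition is the differential inequality itself. This is
`maximumPrinciple_of_supersolution`.

Conversely, Perron's method with an obstacle (`exists_greatest_obstacleSubsolution`) is run on
neighbourhoods `K n` shrinking to `closure Ω`. It gives the greatest `v n` with values in `[l n, 1]`
that is a subsolution of `F[v] ≤ l n v^α` wherever it exceeds `l n`, with `l n → 0⁺`. If some `v n`
stays below `1`, its lower envelope is a supersolution (`isSupersolution_lscEnvelope`) bounded below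
by `l n`, and `mu1 ≥ l n > 0`. Otherwise every `v n` reaches `1`. The half-relaxed upper limit is
then a Dirichlet subsolution (`isDirichletSubsolution_relLimsup`) with value at least `1` somewhere
in `closure Ω`, against the maximum principle.

The theorem on sums is proved without Alexandrov's theorem. A sup-convolution followed by a sharper
inf-convolution produces differentiable functions with Lipschitz gradient. Rademacher's theorem
applies to these gradients, and a small linear tilt moves the maximum to a point where they are
differentiable. There the regularization touches a paraboloid centred at a single point of the
original set, which transfers the jet. -/

lemma hasDerivAt_comp_line {f : E → ℝ} {f' : E → E →L[ℝ] ℝ} (hf : ∀ y, HasFDerivAt f (f' y) y)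
    (x h : E) (t : ℝ) : HasDerivAt (fun t : ℝ => f (x + t • h)) (f' (x + t • h) h) t := by
  have h1 : HasDerivAt (fun t : ℝ => x + t • h) h t := by
    simpa using ((hasDerivAt_id t).smul_const h).const_add x
  exact (hf (x + t • h)).comp_hasDerivAt t h1

/-- Second order necessary condition for a local minimum. -/
lemma second_deriv_nonneg_of_isLocalMin {f : E → ℝ} {f' : E → E →L[ℝ] ℝ}
    {f'' : E →L[ℝ] E →L[ℝ] ℝ} {x : E} (hf : ∀ y, HasFDerivAt f (f' y) y)
    (hf' : HasFDerivAt f' f'' x) (hmin : IsLocalMin f x) (h : E) : 0 ≤ f'' h h := by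
  by_contra! hneg
  set g : ℝ → ℝ := fun t => f (x + t • h) with hg
  have hline : HasDerivAt (fun t : ℝ => x + t • h) h 0 := by
    simpa using ((hasDerivAt_id (0 : ℝ)).smul_const h).const_add x
  have hd : deriv g = fun t => f' (x + t • h) h :=
    funext fun t => (hasDerivAt_comp_line hf x h t).deriv
  have hdd : HasDerivAt (deriv g) (f'' h h) 0 := by
    rw [hd]
    have h1 : HasFDerivAt f' f'' (x + (0 : ℝ) • h) := by simpa using hf'
    have h2 := h1.comp_hasDerivAt (0 : ℝ) hline
    have h3 := h2.clm_apply (hasDerivAt_const (0 : ℝ) h)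
    simpa using h3
  have hgmin : IsLocalMin g 0 := by
    have hc : Tendsto (fun t : ℝ => x + t • h) (𝓝 0) (𝓝 x) := by
      simpa using hline.continuousAt.tendsto
    have := hc.eventually hmin
    simpa [IsLocalMin, IsMinFilter, hg] using this
  have hg0 : deriv g 0 = 0 := hgmin.deriv_eq_zero
  -- A negative second derivative makes `0` a local maximum too, so `g` is locally constant and its
  -- second derivative vanishes after all.
  have hgmax : IsLocalMax g 0 := isLocalMax_of_deriv_deriv_neg (by rw [hdd.deriv]; exact hneg) hg0
    (hasDerivAt_comp_line hf x h 0).continuousAt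
  have hconst : g =ᶠ[𝓝 0] fun _ => g 0 := by
    filter_upwards [hgmin, hgmax] with t h1 h2 using le_antisymm h2 h1
  have h0 : deriv g =ᶠ[𝓝 0] fun _ => 0 := by
    have := hconst.deriv
    simpa using this
  have : deriv (deriv g) 0 = 0 := by rw [h0.deriv_eq]; simp
  rw [hdd.deriv] at this
  linarith

/-- Second order Taylor expansion at a point where the derivative is differentiable. -/
lemma second_order_expansion {f : E → ℝ} {f' : E → E →L[ℝ] ℝ}
    {f'' : E →L[ℝ] E →L[ℝ] ℝ} {x : E} (hf : ∀ y, HasFDerivAt f (f' y) y)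
    (hf' : HasFDerivAt f' f'' x) {ε : ℝ} (hε : 0 < ε) :
    ∀ᶠ h in 𝓝 (0 : E), |f (x + h) - f x - f' x h - (1 / 2) * f'' h h| ≤ ε * ‖h‖ ^ 2 := by
  have h1 := hasFDerivAt_iff_isLittleO_nhds_zero.1 hf'
  have h2 := h1.bound hε
  obtain ⟨r, hr, hball⟩ := Metric.eventually_nhds_iff_ball.1 h2
  filter_upwards [Metric.ball_mem_nhds (0 : E) hr] with h hh
  -- The mean value inequality is applied to the Taylor remainder along the segment. Its derivative
  -- is the first order remainder of `f'` at `x`, so differentiability of `f'` at the single point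
  -- `x` suffices.
  set g : ℝ → ℝ := fun t => f (x + t • h) - t * f' x h - (1 / 2) * t ^ 2 * f'' h h with hg
  have hder : ∀ t ∈ Icc (0 : ℝ) 1,
      HasDerivWithinAt g (f' (x + t • h) h - f' x h - t * f'' h h) (Icc 0 1) t := by
    intro t _
    have a1 := hasDerivAt_comp_line hf x h t
    have a2 := (hasDerivAt_id t).mul_const (f' x h)
    have a3 := (((hasDerivAt_id t).pow 2).const_mul (1 / 2 : ℝ)).mul_const (f'' h h)
    exact (((a1.sub a2).sub a3).congr_deriv (by simp)).hasDerivWithinAt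
  have hbound : ∀ t ∈ Icc (0 : ℝ) 1,
      ‖f' (x + t • h) h - f' x h - t * f'' h h‖ ≤ ε * ‖h‖ ^ 2 := by
    intro t ht
    have hth : t • h ∈ Metric.ball (0 : E) r := by
      rw [mem_ball_zero_iff] at hh ⊢
      rw [norm_smul, Real.norm_of_nonneg ht.1]
      nlinarith [norm_nonneg h, ht.2]
    have := hball _ hth
    have h3 : f' (x + t • h) h - f' x h - t * f'' h h =
        (f' (x + t • h) - f' x - f'' (t • h)) h := by simp
    rw [h3]
    refine (ContinuousLinearMap.le_opNorm _ _).trans ?_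
    have h4 : ‖t • h‖ ≤ ‖h‖ := by
      rw [norm_smul, Real.norm_of_nonneg ht.1]
      nlinarith [norm_nonneg h, ht.2]
    calc _ ≤ (ε * ‖t • h‖) * ‖h‖ := by gcongr
      _ ≤ (ε * ‖h‖) * ‖h‖ := by gcongr
      _ = _ := by ring
  have := (convex_Icc (0 : ℝ) 1).norm_image_sub_le_of_norm_hasDerivWithin_le hder hbound
    (left_mem_Icc.2 zero_le_one) (right_mem_Icc.2 zero_le_one)
  simp only [hg, Real.norm_eq_abs] at this
  convert this using 1
  · congr 1; simp; ring
  · simp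

end Calculus

variable {N : ℕ}

/-! ### Gradients and Hessians -/

lemma gradient_eq_of_hasFDerivAt {φ : Space N → ℝ} {p x : Space N}
    (h : HasFDerivAt φ (innerSL ℝ p) x) : gradient φ x = p :=
  HasGradientAt.gradient (hasGradientAt_iff_hasFDerivAt.2 h)

lemma hessian_eq_of_hasFDerivAt {φ : Space N → ℝ} {φ' : Space N → Space N →L[ℝ] ℝ}
    {φ'' : Space N →L[ℝ] Space N →L[ℝ] ℝ} {x : Space N} (h : ∀ y, HasFDerivAt φ (φ' y) y)
    (h' : HasFDerivAt φ' φ'' x) :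
    hessian φ x = Matrix.of fun i j =>
      φ'' (EuclideanSpace.single i 1) (EuclideanSpace.single j 1) := by
  have h1 : fderiv ℝ φ = φ' := funext fun y => (h y).fderiv
  simp only [hessian, h1, h'.fderiv]

section ContDiffTwo

variable {φ ψ : Space N → ℝ}

lemma hasFDerivAt_of_contDiff (hφ : ContDiff ℝ 2 φ) (x : Space N) :
    HasFDerivAt φ (fderiv ℝ φ x) x :=
  (hφ.differentiable (by norm_num) x).hasFDerivAt

lemma contDiff_fderiv_of_contDiff (hφ : ContDiff ℝ 2 φ) : ContDiff ℝ 1 (fderiv ℝ φ) :=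
  hφ.fderiv_right (by norm_num)

lemma hasFDerivAt_fderiv_of_contDiff (hφ : ContDiff ℝ 2 φ) (x : Space N) :
    HasFDerivAt (fderiv ℝ φ) (fderiv ℝ (fderiv ℝ φ) x) x :=
  ((contDiff_fderiv_of_contDiff hφ).differentiable (by norm_num) x).hasFDerivAt

lemma hessian_isSymm (hφ : ContDiff ℝ 2 φ) (x : Space N) : (hessian φ x).IsSymm := by
  ext i j
  have := (hφ.contDiffAt (x := x)).isSymmSndFDerivAt (by simp)
  exact this _ _

lemma continuous_gradient (hφ : ContDiff ℝ 2 φ) : Continuous (gradient φ) :=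
  (InnerProductSpace.toDual ℝ (Space N)).symm.continuous.comp
    (hφ.continuous_fderiv (by norm_num))

lemma continuous_hessian (hφ : ContDiff ℝ 2 φ) : Continuous (hessian φ) := by
  have h : Continuous (fderiv ℝ (fderiv ℝ φ)) :=
    (contDiff_fderiv_of_contDiff hφ).continuous_fderiv (by norm_num)
  refine continuous_matrix fun i j => ?_
  simp only [hessian, Matrix.of_apply]
  fun_prop

lemma gradient_add (hφ : ContDiff ℝ 2 φ) (hψ : ContDiff ℝ 2 ψ) (x : Space N) :
    gradient (fun y => φ y + ψ y) x = gradient φ x + gradient ψ x := by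
  simp only [gradient]
  rw [((hasFDerivAt_of_contDiff hφ x).fun_add (hasFDerivAt_of_contDiff hψ x)).fderiv, map_add]

lemma hessian_add (hφ : ContDiff ℝ 2 φ) (hψ : ContDiff ℝ 2 ψ) (x : Space N) :
    hessian (fun y => φ y + ψ y) x = hessian φ x + hessian ψ x := by
  rw [hessian_eq_of_hasFDerivAt
    (fun y => (hasFDerivAt_of_contDiff hφ y).fun_add (hasFDerivAt_of_contDiff hψ y))
    ((hasFDerivAt_fderiv_of_contDiff hφ x).add (hasFDerivAt_fderiv_of_contDiff hψ x))]
  rfl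

lemma gradient_const_mul (hφ : ContDiff ℝ 2 φ) (c : ℝ) (x : Space N) :
    gradient (fun y => c * φ y) x = c • gradient φ x := by
  simp only [gradient]
  rw [((hasFDerivAt_of_contDiff hφ x).const_mul c).fderiv, map_smul]

lemma hessian_const_mul (hφ : ContDiff ℝ 2 φ) (c : ℝ) (x : Space N) :
    hessian (fun y => c * φ y) x = c • hessian φ x := by
  rw [hessian_eq_of_hasFDerivAt
    (fun y => (hasFDerivAt_of_contDiff hφ y).const_mul c)
    ((hasFDerivAt_fderiv_of_contDiff hφ x).const_smul c)]
  rfl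

lemma gradient_const (c : ℝ) (x : Space N) : gradient (fun _ : Space N => c) x = 0 := by
  simp [gradient]

lemma hessian_const (c : ℝ) (x : Space N) : hessian (fun _ : Space N => c) x = 0 := by
  ext i j; simp [hessian]

end ContDiffTwo

/-- The matrix of the symmetric part of a bilinear form. -/
noncomputable def symmMatrix (B : Space N →L[ℝ] Space N →L[ℝ] ℝ) : Mat N :=
  Matrix.of fun i j => (1 / 2) * (B (EuclideanSpace.single i 1) (EuclideanSpace.single j 1) +
    B (EuclideanSpace.single j 1) (EuclideanSpace.single i 1))

lemma symmMatrix_isSymm (B : Space N →L[ℝ] Space N →L[ℝ] ℝ) : (symmMatrix B).IsSymm := by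
  ext i j; simp [symmMatrix, add_comm]

/-- The quadratic form of a matrix. -/
noncomputable def quad (X : Mat N) (h : Space N) : ℝ := h.ofLp ⬝ᵥ X *ᵥ h.ofLp

lemma bilin_apply_eq_sum (B : Space N →L[ℝ] Space N →L[ℝ] ℝ) (h k : Space N) :
    B h k = ∑ i, ∑ j, h i * k j * B (EuclideanSpace.single i 1) (EuclideanSpace.single j 1) := by
  have hh : ∀ h : Space N, h = ∑ i, h i • EuclideanSpace.single i (1 : ℝ) := by
    intro h
    ext j
    simp [Finset.sum_apply, Pi.single_apply]
  conv_lhs => rw [hh h, hh k]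
  simp only [map_sum, map_smul, _root_.sum_apply, _root_.smul_apply,
    smul_eq_mul, Finset.mul_sum]
  rw [Finset.sum_comm]
  exact Finset.sum_congr rfl fun i _ => Finset.sum_congr rfl fun j _ => by ring

lemma quad_eq_sum (X : Mat N) (h : Space N) : quad X h = ∑ i, ∑ j, h i * h j * X i j := by
  simp only [quad, dotProduct, Matrix.mulVec, Finset.mul_sum]
  exact Finset.sum_congr rfl fun i _ => Finset.sum_congr rfl fun j _ => by ring

/-- Second derivatives of the regularizations are known only as derivatives of a gradient at one
point. Symmetrizing avoids proving them symmetric and loses nothing, since only the quadratic form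
enters a Taylor expansion. -/
lemma quad_symmMatrix (B : Space N →L[ℝ] Space N →L[ℝ] ℝ) (h : Space N) :
    quad (symmMatrix B) h = B h h := by
  rw [quad_eq_sum, bilin_apply_eq_sum]
  have : ∑ i, ∑ j, h i * h j * B (EuclideanSpace.single i 1) (EuclideanSpace.single j 1) =
      ∑ i, ∑ j, h i * h j * B (EuclideanSpace.single j 1) (EuclideanSpace.single i 1) := by
    rw [Finset.sum_comm]
    exact Finset.sum_congr rfl fun i _ => Finset.sum_congr rfl fun j _ => by ring
  have h2 : ∀ a b : ℝ, a = b → (1 / 2) * (a + b) = a := by intro a b h; linarith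
  rw [← h2 _ _ this, ← Finset.sum_add_distrib, Finset.mul_sum]
  refine Finset.sum_congr rfl fun i _ => ?_
  rw [← Finset.sum_add_distrib, Finset.mul_sum]
  refine Finset.sum_congr rfl fun j _ => ?_
  simp only [symmMatrix, Matrix.of_apply]; ring

lemma quad_hessian (φ : Space N → ℝ) (x h : Space N) :
    quad (hessian φ x) h = fderiv ℝ (fderiv ℝ φ) x h h := by
  rw [quad_eq_sum, bilin_apply_eq_sum]; rfl

lemma quad_add (X Y : Mat N) (h : Space N) : quad (X + Y) h = quad X h + quad Y h := by
  simp [quad, Matrix.add_mulVec, dotProduct_add]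

lemma quad_smul (c : ℝ) (X : Mat N) (h : Space N) : quad (c • X) h = c * quad X h := by
  simp [quad, Matrix.smul_mulVec, dotProduct_smul]

lemma quad_neg (X : Mat N) (h : Space N) : quad (-X) h = -quad X h := by
  simp [quad, Matrix.neg_mulVec]

lemma quad_one (h : Space N) : quad (1 : Mat N) h = ‖h‖ ^ 2 := by
  rw [EuclideanSpace.norm_sq_eq]; simp [quad, dotProduct, sq]

lemma posSemidef_of_quad_nonneg {X : Mat N} (hX : X.IsSymm) (h : ∀ k, 0 ≤ quad X k) :
    X.PosSemidef :=
  .of_dotProduct_mulVec_nonneg (by simpa [Matrix.IsHermitian] using hX.eq)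
    fun x => by simpa [quad] using h (WithLp.toLp 2 x)

/-- At a local minimum of `χ - ψ` the gradients agree and the Hessians are ordered. -/
lemma gradient_eq_and_posSemidef_of_isLocalMin {χ ψ : Space N → ℝ} (hχ : ContDiff ℝ 2 χ)
    (hψ : ContDiff ℝ 2 ψ) {x : Space N} (hmin : IsLocalMin (fun y => χ y - ψ y) x) :
    gradient χ x = gradient ψ x ∧ (hessian χ x - hessian ψ x).PosSemidef := by
  have h1 : fderiv ℝ χ x - fderiv ℝ ψ x = 0 :=
    hmin.hasFDerivAt_eq_zero
      ((hasFDerivAt_of_contDiff hχ x).fun_sub (hasFDerivAt_of_contDiff hψ x))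
  refine ⟨by simp only [gradient, sub_eq_zero.1 h1], ?_⟩
  refine posSemidef_of_quad_nonneg ((hessian_isSymm hχ x).sub (hessian_isSymm hψ x)) fun k => ?_
  have := second_deriv_nonneg_of_isLocalMin
    (fun y => (hasFDerivAt_of_contDiff hχ y).fun_sub (hasFDerivAt_of_contDiff hψ y))
    ((hasFDerivAt_fderiv_of_contDiff hχ x).sub (hasFDerivAt_fderiv_of_contDiff hψ x)) hmin k
  rw [sub_eq_add_neg, quad_add, quad_neg, quad_hessian, quad_hessian]
  simpa using this

/-! ### Polynomial test functions -/

/-- The quartic has zero gradient and Hessian at `ξ`. Adding it makes an extremum strict, or covers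
a gap far from `ξ`, without changing the second order data there. -/
lemma contDiff_norm_sub_pow_four (ξ : Space N) : ContDiff ℝ 2 fun x : Space N => ‖x - ξ‖ ^ 4 := by
  have : ContDiff ℝ 2 fun x : Space N => (‖x - ξ‖ ^ 2) ^ 2 :=
    ((contDiff_id.sub contDiff_const).norm_sq ℝ).pow 2
  convert this using 2
  ring

lemma hasFDerivAt_norm_sub_pow_four (ξ x : Space N) : HasFDerivAt (fun x : Space N => ‖x - ξ‖ ^ 4)
    ((4 * ‖x - ξ‖ ^ 2) • innerSL ℝ (x - ξ)) x := by
  have h := (((hasFDerivAt_id x).sub_const ξ).norm_sq).pow 2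
  have e : (fun x : Space N => ‖x - ξ‖ ^ 4) = fun x => (‖id x - ξ‖ ^ 2) ^ 2 := by
    ext y; simp only [id]; ring
  rw [e]
  refine h.congr_fderiv ?_
  ext y
  simp [innerSL_apply_apply]
  ring

lemma hasFDerivAt_fderiv_norm_sub_pow_four (ξ : Space N) :
    HasFDerivAt (fun x : Space N => (4 * ‖x - ξ‖ ^ 2) • (innerSL ℝ (x - ξ) : Space N →L[ℝ] ℝ))
      (0 : Space N →L[ℝ] Space N →L[ℝ] ℝ) ξ := by
  have h1 := (((hasFDerivAt_id ξ).sub_const ξ).norm_sq).const_mul 4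
  have h2 : HasFDerivAt (fun x : Space N => (innerSL ℝ (x - ξ) : Space N →L[ℝ] ℝ))
      (innerSL ℝ) ξ := by
    exact (innerSL ℝ (E := Space N)).hasFDerivAt.comp ξ ((hasFDerivAt_id ξ).sub_const ξ)
  refine (h1.smul h2).congr_fderiv ?_
  ext y
  simp

lemma gradient_norm_sub_pow_four (ξ : Space N) :
    gradient (fun x : Space N => ‖x - ξ‖ ^ 4) ξ = 0 :=
  gradient_eq_of_hasFDerivAt (by simpa using hasFDerivAt_norm_sub_pow_four ξ ξ)

lemma hessian_norm_sub_pow_four (ξ : Space N) :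
    hessian (fun x : Space N => ‖x - ξ‖ ^ 4) ξ = 0 := by
  rw [hessian_eq_of_hasFDerivAt (hasFDerivAt_norm_sub_pow_four ξ)
    (hasFDerivAt_fderiv_norm_sub_pow_four ξ)]
  rfl

/-- The quadratic polynomial with prescribed gradient and Hessian at `ξ`. -/
noncomputable def quadPoly (ξ p : Space N) (X : Mat N) (x : Space N) : ℝ :=
  ⟪p, x - ξ⟫ + (1 / 2) * quad X (x - ξ)

lemma quad_eq_inner (X : Mat N) (h : Space N) :
    quad X h = ⟪h, Matrix.toEuclideanCLM (𝕜 := ℝ) X h⟫ :=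
  (Matrix.inner_toEuclideanCLM X h h).symm

lemma inner_toEuclideanCLM_comm {X : Mat N} (hX : X.IsSymm) (h k : Space N) :
    ⟪h, Matrix.toEuclideanCLM (𝕜 := ℝ) X k⟫ = ⟪Matrix.toEuclideanCLM (𝕜 := ℝ) X h, k⟫ := by
  rw [real_inner_comm k, Matrix.inner_toEuclideanCLM, Matrix.inner_toEuclideanCLM,
    Matrix.dotProduct_mulVec, ← Matrix.mulVec_transpose, hX.eq, dotProduct_comm]

lemma contDiff_quadPoly (ξ p : Space N) (X : Mat N) : ContDiff ℝ 2 (quadPoly ξ p X) := by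
  unfold quadPoly
  simp only [quad_eq_inner]
  have h : ContDiff ℝ 2 fun x : Space N => x - ξ := contDiff_id.sub contDiff_const
  exact (contDiff_const.inner ℝ h).add (contDiff_const.mul (h.inner ℝ
    ((Matrix.toEuclideanCLM (𝕜 := ℝ) X).contDiff.comp h)))

lemma hasFDerivAt_quadPoly (ξ p : Space N) {X : Mat N} (hX : X.IsSymm) (x : Space N) :
    HasFDerivAt (quadPoly ξ p X)
      (innerSL ℝ p + innerSL ℝ (Matrix.toEuclideanCLM (𝕜 := ℝ) X (x - ξ))) x := by
  unfold quadPoly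
  simp only [quad_eq_inner]
  have h : HasFDerivAt (fun x : Space N => x - ξ) (ContinuousLinearMap.id ℝ _) x :=
    (hasFDerivAt_id x).sub_const ξ
  have h2 := (Matrix.toEuclideanCLM (𝕜 := ℝ) X).hasFDerivAt.comp x h
  have h3 := ((hasFDerivAt_const p x).inner ℝ h).add ((h.inner ℝ h2).const_mul (1 / 2 : ℝ))
  refine h3.congr_fderiv (ContinuousLinearMap.ext fun y => ?_)
  have e := inner_toEuclideanCLM_comm hX (x - ξ) y
  have e2 := real_inner_comm (Matrix.toEuclideanCLM (𝕜 := ℝ) X (x - ξ)) y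
  simp only [_root_.add_apply, innerSL_apply_apply, _root_.smul_apply,
    ContinuousLinearMap.comp_apply, ContinuousLinearMap.prod_apply, fderivInnerCLM_apply,
    ContinuousLinearMap.id_apply, smul_eq_mul, _root_.zero_apply, inner_zero_left,
    Function.comp_apply]
  linarith

lemma gradient_quadPoly (ξ p : Space N) {X : Mat N} (hX : X.IsSymm) :
    gradient (quadPoly ξ p X) ξ = p :=
  gradient_eq_of_hasFDerivAt (by simpa using hasFDerivAt_quadPoly ξ p hX ξ)

lemma hessian_quadPoly (ξ p : Space N) {X : Mat N} (hX : X.IsSymm) :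
    hessian (quadPoly ξ p X) ξ = X := by
  have h : HasFDerivAt (fun x : Space N => (innerSL ℝ p : Space N →L[ℝ] ℝ) +
      innerSL ℝ (Matrix.toEuclideanCLM (𝕜 := ℝ) X (x - ξ)))
      ((innerSL ℝ (E := Space N)) ∘L (Matrix.toEuclideanCLM (𝕜 := ℝ) X)) ξ := by
    have h1 := ((innerSL ℝ (E := Space N)) ∘L (Matrix.toEuclideanCLM (𝕜 := ℝ) X)).hasFDerivAt.comp
      ξ ((hasFDerivAt_id ξ).sub_const ξ)
    exact (h1.const_add _)
  rw [hessian_eq_of_hasFDerivAt (hasFDerivAt_quadPoly ξ p hX) h]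
  ext i j
  change ⟪Matrix.toEuclideanCLM (𝕜 := ℝ) X (EuclideanSpace.single i 1),
    EuclideanSpace.single j 1⟫ = X i j
  rw [EuclideanSpace.inner_single_right, Matrix.ofLp_toEuclideanCLM]
  simpa using congrFun (congrFun hX i) j

/-! ### Lasry–Lions regularization -/

section LasryLions

set_option linter.unusedSectionVars false

variable {E : Type*} [NormedAddCommGroup E] [InnerProductSpace ℝ E]

lemma norm_sub_convexComb_sq (x a b : E) (t : ℝ) :
    ‖(a + t • (b - a)) - x‖ ^ 2 =
      (1 - t) * ‖a - x‖ ^ 2 + t * ‖b - x‖ ^ 2 - t * (1 - t) * ‖b - a‖ ^ 2 := by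
  have h1 : (a + t • (b - a)) - x = (a - x) + t • ((b - x) - (a - x)) := by
    rw [sub_sub_sub_cancel_right]; abel
  have h2 : b - a = (b - x) - (a - x) := by abel
  rw [h1, h2]
  generalize a - x = p
  generalize b - x = q
  rw [norm_add_sq_real, norm_smul, inner_smul_right, inner_sub_right, mul_pow, norm_sub_sq_real,
    Real.norm_eq_abs, sq_abs, real_inner_self_eq_norm_sq, real_inner_comm p q]
  ring

lemma norm_sub_sq_expand (x x' z : E) :
    ‖x' - z‖ ^ 2 = ‖x - z‖ ^ 2 + 2 * ⟪x - z, x' - x⟫ + ‖x' - x‖ ^ 2 := by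
  rw [← norm_add_sq_real]; congr 2; abel

/-- The real inner product as a bilinear form. -/
noncomputable def innerBilin (E : Type*) [NormedAddCommGroup E] [InnerProductSpace ℝ E] :
    E →L[ℝ] E →L[ℝ] ℝ := innerSL ℝ

lemma innerBilin_apply (x y : E) : innerBilin E x y = ⟪x, y⟫ := rfl

/-- The sup-convolution of `u` over `K`. -/
noncomputable def supConv (K : Set E) (u : E → ℝ) (g : ℝ) (z : E) : ℝ :=
  sSup ((fun ξ => u ξ - g / 2 * ‖z - ξ‖ ^ 2) '' K)

variable {K : Set E} {u : E → ℝ} {g k : ℝ}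

lemma exists_isMaxOn_sub_sq (hK : IsCompact K) (hne : K.Nonempty) (hu : UpperSemicontinuousOn u K)
    (g : ℝ) (z : E) : ∃ ξ ∈ K, IsMaxOn (fun ξ => u ξ - g / 2 * ‖z - ξ‖ ^ 2) K ξ := by
  refine UpperSemicontinuousOn.exists_isMaxOn hne hK ?_
  have h2 : UpperSemicontinuousOn (fun ξ => - (g / 2 * ‖z - ξ‖ ^ 2)) K :=
    (by fun_prop : Continuous fun ξ => - (g / 2 * ‖z - ξ‖ ^ 2)).continuousOn.upperSemicontinuousOn
  simpa [sub_eq_add_neg] using hu.add h2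

lemma exists_supConv_eq (hK : IsCompact K) (hne : K.Nonempty) (hu : UpperSemicontinuousOn u K)
    (g : ℝ) (z : E) : ∃ ξ ∈ K, supConv K u g z = u ξ - g / 2 * ‖z - ξ‖ ^ 2 := by
  obtain ⟨ξ, hξ, hmax⟩ := exists_isMaxOn_sub_sq hK hne hu g z
  refine ⟨ξ, hξ, IsGreatest.csSup_eq ⟨mem_image_of_mem _ hξ, ?_⟩⟩
  rintro _ ⟨η, hη, rfl⟩
  exact hmax hη

lemma le_supConv (hK : IsCompact K) (hu : UpperSemicontinuousOn u K)
    (g : ℝ) (z : E) {ξ : E} (hξ : ξ ∈ K) : u ξ - g / 2 * ‖z - ξ‖ ^ 2 ≤ supConv K u g z := by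
  obtain ⟨η, hη, hmax⟩ := exists_isMaxOn_sub_sq hK ⟨ξ, hξ⟩ hu g z
  refine le_csSup ⟨u η - g / 2 * ‖z - η‖ ^ 2, ?_⟩ (mem_image_of_mem _ hξ)
  rintro _ ⟨ζ, hζ, rfl⟩
  exact hmax hζ

/-- Semiconvexity: the maximizer chosen at the midpoint is a competitor at both endpoints, and the
defect of the parallelogram identity is the only loss. -/
lemma supConv_midpoint_le (hK : IsCompact K) (hne : K.Nonempty) (hu : UpperSemicontinuousOn u K)
    (g : ℝ) (a b : E) : supConv K u g (a + (1 / 2 : ℝ) • (b - a)) ≤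
      (supConv K u g a + supConv K u g b) / 2 + g / 8 * ‖b - a‖ ^ 2 := by
  obtain ⟨ξ, hξ, h⟩ := exists_supConv_eq hK hne hu g (a + (1 / 2 : ℝ) • (b - a))
  have ha := le_supConv hK hu g a hξ
  have hb := le_supConv hK hu g b hξ
  rw [h, norm_sub_convexComb_sq]
  linarith

lemma lowerSemicontinuous_supConv (hK : IsCompact K) (hne : K.Nonempty)
    (hu : UpperSemicontinuousOn u K) (g : ℝ) : LowerSemicontinuous (supConv K u g) := by
  intro x y hy
  obtain ⟨ξ, hξ, h⟩ := exists_supConv_eq hK hne hu g x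
  have hc : Continuous fun z => u ξ - g / 2 * ‖z - ξ‖ ^ 2 := by fun_prop
  have : ∀ᶠ z in 𝓝 x, y < u ξ - g / 2 * ‖z - ξ‖ ^ 2 :=
    hc.continuousAt.eventually_const_lt (by simpa only [← h] using hy)
  filter_upwards [this] with z hz using hz.trans_le (le_supConv hK hu g z hξ)

/-- `U` is the inf-convolution of the sup-convolution of `u`, with minimizers `z`. -/
structure IsLasryLions (K : Set E) (u : E → ℝ) (g k : ℝ) (U : E → ℝ) (z : E → E) : Prop where
  eq : ∀ x, U x = supConv K u g (z x) + k / 2 * ‖x - z x‖ ^ 2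
  le : ∀ x y, U x ≤ supConv K u g y + k / 2 * ‖x - y‖ ^ 2

/-- One competitor `ξ ∈ K` bounds the sup-convolution below by a paraboloid of opening `g`. As `g <
k`, the added paraboloid wins at infinity, so minimizing over a ball suffices. -/
lemma exists_isLasryLions [ProperSpace E] (hK : IsCompact K) (hne : K.Nonempty)
    (hu : UpperSemicontinuousOn u K) (hg : 0 < g) (hgk : g < k) :
    ∃ U z, IsLasryLions K u g k U z := by
  have key : ∀ x, ∃ z, ∀ y, supConv K u g z + k / 2 * ‖x - z‖ ^ 2 ≤
      supConv K u g y + k / 2 * ‖x - y‖ ^ 2 := by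
    intro x
    obtain ⟨ξ, hξ⟩ := hne
    set d := ‖x - ξ‖
    set c := supConv K u g x with hc
    set M := g * d + g / 2 * d ^ 2 + |c - u ξ| with hM
    have hM0 : 0 ≤ M := by positivity
    -- `M` collects the lower order terms left after the quadratic comparison; beyond distance `R`
    -- the gain `(k - g) / 2 * t ^ 2` outweighs them and the value exceeds the one at `x`.
    set R := 1 + M / ((k - g) / 2) with hR
    have hkg : 0 < (k - g) / 2 := by linarith
    have hR1 : 1 ≤ R := by
      have : 0 ≤ M / ((k - g) / 2) := by positivity
      linarith
    have hRM : (k - g) / 2 * R = (k - g) / 2 + M := by rw [hR, mul_add, mul_div_cancel₀ _ hkg.ne', mul_one]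
    have hlsc : LowerSemicontinuousOn (fun z => supConv K u g z + k / 2 * ‖x - z‖ ^ 2)
        (Metric.closedBall x R) :=
      ((lowerSemicontinuous_supConv hK ⟨ξ, hξ⟩ hu g).lowerSemicontinuousOn _).add
        (by fun_prop : Continuous fun z =>
          k / 2 * ‖x - z‖ ^ 2).continuousOn.lowerSemicontinuousOn
    have hx : x ∈ Metric.closedBall x R := Metric.mem_closedBall_self (by linarith)
    obtain ⟨z, hz, hmin⟩ := hlsc.exists_isMinOn ⟨x, hx⟩ (isCompact_closedBall x R)
    refine ⟨z, fun y => ?_⟩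
    by_cases hy : y ∈ Metric.closedBall x R
    · exact hmin hy
    have h1 : supConv K u g z + k / 2 * ‖x - z‖ ^ 2 ≤ c := by
      have := hmin hx
      simpa using this
    refine h1.trans ?_
    have h2 := le_supConv hK hu g y hξ
    have hy' : R < ‖x - y‖ := by
      rw [Metric.mem_closedBall, dist_comm, dist_eq_norm] at hy
      exact not_le.1 hy
    set t := ‖x - y‖
    have h3 : ‖y - ξ‖ ≤ t + d := by
      calc ‖y - ξ‖ = ‖(y - x) + (x - ξ)‖ := by congr 1; abel
        _ ≤ ‖y - x‖ + ‖x - ξ‖ := norm_add_le _ _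
        _ = t + d := by rw [norm_sub_rev]
    have h4 : ‖y - ξ‖ ^ 2 ≤ (t + d) ^ 2 := by gcongr
    have h5 : g / 2 * ‖y - ξ‖ ^ 2 ≤ g / 2 * (t + d) ^ 2 := by gcongr
    have h6 : M + (k - g) / 2 ≤ (k - g) / 2 * t := by nlinarith
    have h7 : M * t ≤ (k - g) / 2 * t * t - (k - g) / 2 * t := by nlinarith
    have h8 : c - u ξ ≤ |c - u ξ| := le_abs_self _
    have h9 : g * d * t + (g / 2 * d ^ 2 + |c - u ξ|) ≤ M * t := by
      have : 0 ≤ (g / 2 * d ^ 2 + |c - u ξ|) * (t - 1) :=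
        mul_nonneg (by positivity) (by linarith)
      rw [hM]; nlinarith
    nlinarith
  choose z hz using key
  exact ⟨_, z, ⟨fun x => rfl, hz⟩⟩

namespace IsLasryLions

variable {U : E → ℝ} {z : E → E}

lemma le_supConv (h : IsLasryLions K u g k U z) (x : E) : U x ≤ supConv K u g x := by
  simpa using h.le x x

/-- The function minimized at `x` is strongly convex of modulus `k - g`: the paraboloid contributes
`k` and semiconvexity costs at most `g`. Testing both minimizations at the midpoint of the two
minimizers yields the Lipschitz bound. -/
lemma norm_sub_le (h : IsLasryLions K u g k U z) (hK : IsCompact K) (hne : K.Nonempty)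
    (hu : UpperSemicontinuousOn u K) (hg : 0 < g) (hgk : g < k) (x x' : E) :
    ‖z x - z x'‖ ≤ 2 * k / (k - g) * ‖x - x'‖ := by
  have hm := supConv_midpoint_le hK hne hu g (z x) (z x')
  have h1 := h.le x (z x + (1 / 2 : ℝ) • (z x' - z x))
  have h2 := h.le x' (z x + (1 / 2 : ℝ) • (z x' - z x))
  rw [norm_sub_rev, norm_sub_convexComb_sq, h.eq, norm_sub_rev _ x, norm_sub_rev _ x] at h1
  rw [norm_sub_rev, norm_sub_convexComb_sq, h.eq, norm_sub_rev _ x', norm_sub_rev _ x'] at h2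
  have e1 := norm_sub_sq_expand x x' (z x)
  have e2 := norm_sub_sq_expand x x' (z x')
  have e3 : ⟪x - z x', x' - x⟫ = ⟪x - z x, x' - x⟫ + ⟪z x - z x', x' - x⟫ := by
    rw [← inner_add_left]; congr 1; abel
  have e4 : -⟪z x - z x', x' - x⟫ ≤ ‖z x - z x'‖ * ‖x - x'‖ := by
    rw [← inner_neg_right, neg_sub]; exact real_inner_le_norm _ _
  rw [norm_sub_rev (z x') (z x)] at *
  have h3 : (k - g) * ‖z x - z x'‖ ^ 2 ≤ 2 * k * (‖z x - z x'‖ * ‖x - x'‖) := by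
    have : (k - g) * ‖z x - z x'‖ ^ 2 ≤ 2 * k * (-⟪z x - z x', x' - x⟫) := by
      rw [e1, e2, e3] at h2
      linarith
    refine this.trans ?_
    have : 0 ≤ 2 * k := by linarith
    gcongr
  rw [div_mul_eq_mul_div, le_div_iff₀ (by linarith)]
  rcases eq_or_lt_of_le (norm_nonneg (z x - z x')) with h0 | h0
  · rw [← h0]; have := norm_nonneg (x - x'); nlinarith
  · nlinarith

/-- The minimizer at `x` is a competitor at nearby points, which gives a quadratic upper bound with
slope `k • (x - z x)`. Exchanging the two points gives the matching lower bound, because the slope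
is Lipschitz. -/
lemma hasFDerivAt (h : IsLasryLions K u g k U z) (hK : IsCompact K) (hne : K.Nonempty)
    (hu : UpperSemicontinuousOn u K) (hg : 0 < g) (hgk : g < k) (x : E) :
    HasFDerivAt U (innerSL ℝ (k • (x - z x))) x := by
  set L := 2 * k / (k - g) with hL
  have hL0 : 0 ≤ L := by
    have : 0 < k - g := by linarith
    have : 0 < k := by linarith
    positivity
  have upper : ∀ x x', U x' ≤ U x + k * ⟪x - z x, x' - x⟫ + k / 2 * ‖x' - x‖ ^ 2 := by
    intro x x'
    have h1 := h.le x' (z x)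
    rw [norm_sub_sq_expand x x' (z x)] at h1
    rw [h.eq x]
    linarith
  have bound : ∀ y, ‖U (x + y) - U x - innerSL ℝ (k • (x - z x)) y‖ ≤ (k * (L + 1)) * ‖‖y‖ ^ 2‖ := by
    intro y
    have h1 := upper x (x + y)
    have h2 := upper (x + y) x
    have h3 : ⟪x + y - z (x + y), x - (x + y)⟫ =
        - ⟪x - z x, y⟫ - ‖y‖ ^ 2 + ⟪z (x + y) - z x, y⟫ := by
      rw [show x - (x + y) = -y by abel, inner_neg_right, ← real_inner_self_eq_norm_sq,
        ← inner_neg_left, ← sub_eq_zero]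
      simp only [inner_sub_left, inner_add_left, inner_neg_left]
      ring
    have h4 : ⟪z (x + y) - z x, y⟫ ≤ L * ‖y‖ ^ 2 := by
      refine (real_inner_le_norm _ _).trans ?_
      have := h.norm_sub_le hK hne hu hg hgk (x + y) x
      rw [add_sub_cancel_left] at this
      nlinarith [norm_nonneg y]
    rw [add_sub_cancel_left] at h1
    rw [h3, norm_sub_rev, add_sub_cancel_left] at h2
    have hk : 0 < k := by linarith
    have h5 : k * ⟪z (x + y) - z x, y⟫ ≤ k * (L * ‖y‖ ^ 2) := by gcongr
    have h6 : 0 ≤ k * ‖y‖ ^ 2 := by positivity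
    have h7 : 0 ≤ k * (L * ‖y‖ ^ 2) := by positivity
    rw [innerSL_apply_apply, inner_smul_left, Real.norm_eq_abs, Real.norm_eq_abs,
      abs_of_nonneg (sq_nonneg ‖y‖), abs_le]
    simp only [conj_trivial]
    constructor <;> nlinarith
  rw [hasFDerivAt_iff_isLittleO_nhds_zero]
  refine (Asymptotics.IsBigO.of_bound _ (Eventually.of_forall bound)).trans_isLittleO ?_
  exact Asymptotics.isLittleO_norm_pow_id one_lt_two

/-- Inf-convolving a paraboloid of opening `g` with one of opening `k` produces opening `g * k / (k
- g)`; the discarded term is a perfect square. -/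
lemma sub_le (h : IsLasryLions K u g k U z) (hK : IsCompact K)
    (hu : UpperSemicontinuousOn u K) (hg : 0 < g) (hgk : g < k) (y : E) {ξ : E} (hξ : ξ ∈ K) :
    u ξ - g * k / (k - g) / 2 * ‖y - ξ‖ ^ 2 ≤ U y := by
  rw [h.eq y]
  have h1 := DegenerateMP.le_supConv hK hu g (z y) hξ
  have h2 : ‖z y - ξ‖ ^ 2 = ‖y - ξ‖ ^ 2 - 2 * ⟪y - ξ, y - z y⟫ + ‖y - z y‖ ^ 2 := by
    rw [← norm_sub_sq_real]; congr 2; abel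
  have h3 : -⟪y - ξ, y - z y⟫ ≤ ‖y - ξ‖ * ‖y - z y‖ := by
    rw [← inner_neg_left, ← norm_neg (y - ξ)]; exact real_inner_le_norm _ _
  have hkg : 0 < k - g := by linarith
  have h4 : g * (‖y - ξ‖ ^ 2 + 2 * (‖y - ξ‖ * ‖y - z y‖) + ‖y - z y‖ ^ 2) ≤
      g * k / (k - g) * ‖y - ξ‖ ^ 2 + k * ‖y - z y‖ ^ 2 := by
    set a := ‖y - ξ‖
    set b := ‖y - z y‖
    have e : g * k / (k - g) * a ^ 2 + k * b ^ 2 - g * (a ^ 2 + 2 * (a * b) + b ^ 2) =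
        (g * a - (k - g) * b) ^ 2 / (k - g) := by
      field_simp; ring
    have : 0 ≤ (g * a - (k - g) * b) ^ 2 / (k - g) := by positivity
    linarith
  have h5 : g * ‖z y - ξ‖ ^ 2 ≤
      g * (‖y - ξ‖ ^ 2 + 2 * (‖y - ξ‖ * ‖y - z y‖) + ‖y - z y‖ ^ 2) := by
    rw [h2]; gcongr; linarith
  have h6 : g * k / (k - g) / 2 * ‖y - ξ‖ ^ 2 = (g * k / (k - g) * ‖y - ξ‖ ^ 2) / 2 := by ring
  rw [h6]
  linarith

/-- Where the second derivative of the regularization is below the curvature `k` of the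
inf-convolution, the regularization is touched by a paraboloid coming from a single point. -/
lemma exists_contact (h : IsLasryLions K u g k U z) (hK : IsCompact K) (hne : K.Nonempty)
    (hu : UpperSemicontinuousOn u K) (hg : 0 < g) (hgk : g < k) {x : E}
    {B : E →L[ℝ] E →L[ℝ] ℝ}
    (hB : HasFDerivAt (fun x => (innerSL ℝ (k • (x - z x)) : E →L[ℝ] ℝ)) B x)
    (hlt : ∀ d, d ≠ 0 → B d d < k * ‖d‖ ^ 2) :
    ∃ ξ ∈ K, U x = u ξ - g * k / (k - g) / 2 * ‖x - ξ‖ ^ 2 := by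
  obtain ⟨ξ, hξ, hsup⟩ := exists_supConv_eq hK hne hu g (z x)
  refine ⟨ξ, hξ, ?_⟩
  have hk : 0 < k := by linarith
  have hkg : 0 < k - g := by linarith
  -- This is the point for which `z x` is the critical point in the inf-convolution of the
  -- paraboloid centred at `ξ`. Hence equality holds there in the bound `sub_le`, and `z x` is
  -- optimal for `y` as well as for `x`.
  set y := z x + (g / k) • (ξ - z x) with hy
  have hUy : supConv K u g (z x) + k / 2 * ‖y - z x‖ ^ 2 ≤ U y := by
    have h1 := h.sub_le hK hu hg hgk y hξ
    have e1 : y - z x = (g / k) • (ξ - z x) := by rw [hy]; abel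
    have e2 : y - ξ = (1 - g / k) • (z x - ξ) := by
      rw [hy, sub_smul, one_smul, smul_sub, smul_sub]; abel
    rw [e2, norm_smul, mul_pow, Real.norm_eq_abs, sq_abs] at h1
    rw [e1, norm_smul, mul_pow, Real.norm_eq_abs, sq_abs, norm_sub_rev, hsup]
    refine le_trans (le_of_eq ?_) h1
    field_simp
    ring
  set d := y - x with hd
  -- `U - k/2 |·|²` is an infimum of affine functions, hence concave. It lies above its chord on
  -- `[x, y]`, so `U` has curvature at least `k` in direction `d`. This contradicts `hlt` unless `y
  -- = x`.
  have hseg : ∀ t ∈ Icc (0 : ℝ) 1,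
      U x + t * (k * ⟪x - z x, d⟫) + k / 2 * t ^ 2 * ‖d‖ ^ 2 ≤ U (x + t • d) := by
    intro t ht
    have h1 := h.eq (x + t • d)
    set w := z (x + t • d)
    have h2 := h.le x w
    have h3 := h.le y w
    rw [hd, norm_sub_convexComb_sq] at h1
    have h4 : ‖y - z x‖ ^ 2 = ‖x - z x‖ ^ 2 + 2 * ⟪x - z x, d⟫ + ‖d‖ ^ 2 :=
      norm_sub_sq_expand x y (z x)
    rw [h4] at hUy
    have h5 := h.eq x
    rw [← hd] at h1
    have h6 : (1 - t) * U x + t * U y ≤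
        (1 - t) * (supConv K u g w + k / 2 * ‖x - w‖ ^ 2) +
        t * (supConv K u g w + k / 2 * ‖y - w‖ ^ 2) := by
      have := ht.1; have := ht.2
      gcongr
    have h7 : t * (supConv K u g (z x) +
        k / 2 * (‖x - z x‖ ^ 2 + 2 * ⟪x - z x, d⟫ + ‖d‖ ^ 2)) ≤ t * U y := by
      have := ht.1
      gcongr
    rw [h1]
    linear_combination h6 + h7 + t * h5
  have hd0 : d = 0 := by
    by_contra hne0
    have hlt' := hlt d hne0
    have hdn : 0 < ‖d‖ ^ 2 := by positivity
    set ε := (k * ‖d‖ ^ 2 - B d d) / (4 * ‖d‖ ^ 2) with hε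
    have hε0 : 0 < ε := div_pos (by linarith) (by positivity)
    have hexp := second_order_expansion (fun y => h.hasFDerivAt hK hne hu hg hgk y) hB hε0
    have htend : Tendsto (fun t : ℝ => t • d) (𝓝[>] 0) (𝓝 0) := by
      have : Tendsto (fun t : ℝ => t • d) (𝓝 0) (𝓝 ((0 : ℝ) • d)) :=
        (continuous_id.smul continuous_const).tendsto 0
      rw [zero_smul] at this
      exact this.mono_left nhdsWithin_le_nhds
    have hev := (htend.eventually hexp).and (Ioc_mem_nhdsGT (zero_lt_one (α := ℝ)))
    obtain ⟨t, ht1, ht2⟩ := hev.exists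
    have h1 := hseg t ⟨ht2.1.le, ht2.2⟩
    have h2 := (abs_le.1 ht1).2
    simp only [innerSL_apply_apply, map_smul,
      _root_.smul_apply, smul_eq_mul, norm_smul, mul_pow, Real.norm_eq_abs, sq_abs] at h2
    have h3 : ε * (t ^ 2 * ‖d‖ ^ 2) = t ^ 2 * ((k * ‖d‖ ^ 2 - B d d) / 4) := by
      rw [hε]; field_simp
    rw [h3] at h2
    have ht0 : 0 < t ^ 2 := by have := ht2.1; positivity
    have : 0 < t ^ 2 * (k * ‖d‖ ^ 2 - B d d) := mul_pos ht0 (by linarith)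
    nlinarith
  have hxy : y = x := sub_eq_zero.1 hd0
  refine le_antisymm ?_ (h.sub_le hK hu hg hgk x hξ)
  rw [h.eq x, hsup, ← hxy]
  have e1 : y - z x = (g / k) • (ξ - z x) := by rw [hy]; abel
  have e2 : y - ξ = (1 - g / k) • (z x - ξ) := by
    rw [hy, sub_smul, one_smul, smul_sub, smul_sub]; abel
  rw [hxy] at e1 e2 ⊢
  rw [e1, e2, norm_smul, norm_smul, mul_pow, mul_pow, Real.norm_eq_abs, sq_abs, Real.norm_eq_abs,
    sq_abs, norm_sub_rev ξ]
  apply le_of_eq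
  field_simp
  ring

/-- At a contact point, `U` plus the paraboloid centred at `ξ` has a minimum, which yields the
gradient and the lower Hessian bound. Applying `sub_le` at the translate `x + (η - ξ)` with
competitor `η` keeps the penalty constant, so the expansion of `U` at `x` becomes an upper expansion
of `u` at `ξ`. -/
lemma of_contact (h : IsLasryLions K u g k U z) (hK : IsCompact K) (hne : K.Nonempty)
    (hu : UpperSemicontinuousOn u K) (hg : 0 < g) (hgk : g < k) {x ξ : E}
    (hξ : ξ ∈ K) (hc : U x = u ξ - g * k / (k - g) / 2 * ‖x - ξ‖ ^ 2) :
    k • (x - z x) = (g * k / (k - g)) • (ξ - x) ∧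
      ∀ {B : E →L[ℝ] E →L[ℝ] ℝ},
        HasFDerivAt (fun x => (innerSL ℝ (k • (x - z x)) : E →L[ℝ] ℝ)) B x →
        (∀ d, -(g * k / (k - g)) * ‖d‖ ^ 2 ≤ B d d) ∧
        ∀ ε > 0, ∀ᶠ η in 𝓝[K] ξ, u η ≤
          u ξ + ⟪k • (x - z x), η - ξ⟫ + (1 / 2) * B (η - ξ) (η - ξ) + ε * ‖η - ξ‖ ^ 2 := by
  set G := g * k / (k - g) with hG
  have hder : ∀ y, HasFDerivAt (fun y => U y + G / 2 * ‖y - ξ‖ ^ 2)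
      ((innerSL ℝ (k • (y - z y)) : E →L[ℝ] ℝ) + G • innerSL ℝ (y - ξ)) y := by
    intro y
    have h1 := ((((hasFDerivAt_id y).sub_const ξ).norm_sq).const_mul (G / 2))
    refine ((h.hasFDerivAt hK hne hu hg hgk y).add h1).congr_fderiv ?_
    ext w
    simp [innerSL_apply_apply]
    ring
  have hmin : IsLocalMin (fun y => U y + G / 2 * ‖y - ξ‖ ^ 2) x := by
    refine Eventually.of_forall fun y => ?_
    have := h.sub_le hK hu hg hgk y hξ
    simp only [hc]
    linarith
  have hzero := hmin.hasFDerivAt_eq_zero (hder x)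
  refine ⟨?_, fun {B} hB => ⟨fun d => ?_, fun ε hε => ?_⟩⟩
  · rw [← map_smul, ← map_add] at hzero
    have : k • (x - z x) + G • (x - ξ) = 0 := by
      have h0 := congrArg (fun L : E →L[ℝ] ℝ => L (k • (x - z x) + G • (x - ξ))) hzero
      rw [innerSL_apply_apply] at h0
      exact inner_self_eq_zero.1 h0
    rw [eq_neg_of_add_eq_zero_left this, ← smul_neg, neg_sub]
  · have h2 : HasFDerivAt (fun y => (innerSL ℝ (k • (y - z y)) : E →L[ℝ] ℝ) + G • innerSL ℝ (y - ξ))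
        (B + G • innerBilin E) x := by
      have h3 := ((innerBilin E).hasFDerivAt.comp x
        ((hasFDerivAt_id x).sub_const ξ)).const_smul G
      exact hB.add h3
    have := second_deriv_nonneg_of_isLocalMin hder h2 hmin d
    simp [innerBilin_apply] at this
    linarith
  · have hexp := second_order_expansion (fun y => h.hasFDerivAt hK hne hu hg hgk y) hB hε
    have ht : Tendsto (fun η => η - ξ) (𝓝[K] ξ) (𝓝 0) := by
      have : Tendsto (fun η => η - ξ) (𝓝 ξ) (𝓝 (ξ - ξ)) :=
        (continuous_id.sub continuous_const).tendsto ξ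
      rw [sub_self] at this
      exact this.mono_left nhdsWithin_le_nhds
    filter_upwards [ht.eventually hexp, self_mem_nhdsWithin] with η h1 hη
    have h2 := h.sub_le hK hu hg hgk (x + (η - ξ)) hη
    rw [show x + (η - ξ) - η = x - ξ by abel] at h2
    have h3 := (abs_le.1 h1).2
    rw [innerSL_apply_apply] at h3
    linarith

end IsLasryLions

end LasryLions

/-! ### The theorem on sums -/

section Perturbation

set_option linter.unusedSectionVars false

/-- Some small value of a Lipschitz self-map of a finite dimensional space is attained only at
points of differentiability of a given Lipschitz function. -/
lemma exists_forall_preimage_differentiableAt {V W : Type*} [NormedAddCommGroup V]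
    [NormedSpace ℝ V] [FiniteDimensional ℝ V] [NormedAddCommGroup W] [NormedSpace ℝ W]
    [FiniteDimensional ℝ W] {Γ : V → V} {f : V → W} {C C' : NNReal} (hΓ : LipschitzWith C Γ)
    (hf : LipschitzWith C' f) {r : ℝ} (hr : 0 < r) :
    ∃ q ∈ Metric.ball (0 : V) r, ∀ w, Γ w = q → DifferentiableAt ℝ f w := by
  let _ : MeasurableSpace V := borel V
  have : BorelSpace V := ⟨rfl⟩
  -- Rademacher makes the bad set null. Lipschitz maps preserve null sets of top dimensional
  -- Hausdorff measure, so its image cannot cover a ball.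
  set μ : MeasureTheory.Measure V :=
    MeasureTheory.Measure.hausdorffMeasure (Module.finrank ℝ V : ℝ) with hμ
  have : μ.IsAddHaarMeasure := MeasureTheory.isAddHaarMeasure_hausdorffMeasure
  have hae : μ {w | ¬ DifferentiableAt ℝ f w} = 0 := hf.ae_differentiableAt (μ := μ)
  have him : μ (Γ '' {w | ¬ DifferentiableAt ℝ f w}) = 0 := by
    have := hΓ.hausdorffMeasure_image_le (d := (Module.finrank ℝ V : ℝ)) (Nat.cast_nonneg _)
      {w | ¬ DifferentiableAt ℝ f w}
    rw [← hμ, hae, mul_zero] at this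
    exact le_antisymm this bot_le
  have hpos : 0 < μ (Metric.ball (0 : V) r) := Metric.measure_ball_pos μ 0 hr
  have : ¬ Metric.ball (0 : V) r ⊆ Γ '' {w | ¬ DifferentiableAt ℝ f w} := fun hsub =>
    hpos.ne' (MeasureTheory.measure_mono_null hsub him)
  obtain ⟨q, hq, hq'⟩ := not_subset.1 this
  refine ⟨q, hq, fun w hw => ?_⟩
  by_contra hnd
  exact hq' ⟨w, hnd, hw⟩

variable {E : Type*} [NormedAddCommGroup E] [InnerProductSpace ℝ E] [FiniteDimensional ℝ E]

lemma IsLasryLions.lipschitzWith {K : Set E} {u : E → ℝ} {g k : ℝ} {U : E → ℝ} {z : E → E}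
    (h : IsLasryLions K u g k U z) (hK : IsCompact K) (hne : K.Nonempty)
    (hu : UpperSemicontinuousOn u K) (hg : 0 < g) (hgk : g < k) :
    ∃ C, LipschitzWith C fun x => k • (x - z x) := by
  have h1 : LipschitzWith (Real.toNNReal (2 * k / (k - g))) z :=
    LipschitzWith.of_dist_le' fun x y => by
      simpa only [dist_eq_norm] using h.norm_sub_le hK hne hu hg hgk x y
  exact ⟨_, (lipschitzWith_smul k).comp (LipschitzWith.id.sub h1)⟩

/-- Second order condition at a maximum of `U₁ x + U₂ y` minus a quadratic polynomial. -/
lemma second_order_at_max {U₁ U₂ : E → ℝ} {P₁ P₂ : E → E}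
    (h₁ : ∀ x, HasFDerivAt U₁ (innerSL ℝ (P₁ x)) x) (h₂ : ∀ x, HasFDerivAt U₂ (innerSL ℝ (P₂ x)) x)
    {x y p q : E} {B₁ B₂ : E →L[ℝ] E →L[ℝ] ℝ}
    (hB1 : HasFDerivAt (fun x => (innerSL ℝ (P₁ x) : E →L[ℝ] ℝ)) B₁ x)
    (hB2 : HasFDerivAt (fun y => (innerSL ℝ (P₂ y) : E →L[ℝ] ℝ)) B₂ y) {c δ : ℝ}
    (hloc : IsLocalMax (fun w : E × E => U₁ w.1 + U₂ w.2 - c / 2 * ‖w.1 - w.2‖ ^ 2 -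
      δ / 2 * (‖w.1‖ ^ 2 + ‖w.2‖ ^ 2) - ⟪p, w.1⟫ - ⟪q, w.2⟫) (x, y))
    (hx : P₁ x - c • (x - y) - δ • x = p) (hy : P₂ y + c • (x - y) - δ • y = q) :
    ∀ h l, B₁ h h + B₂ l l ≤ c * ‖h - l‖ ^ 2 + δ * (‖h‖ ^ 2 + ‖l‖ ^ 2) := by
  intro h l
  refine le_of_forall_pos_le_add fun ε hε => ?_
  set ε' := ε / (2 * (‖h‖ ^ 2 + ‖l‖ ^ 2 + 1)) with hε'
  have hε'0 : 0 < ε' := by positivity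
  have e1 := second_order_expansion h₁ hB1 hε'0
  have e2 := second_order_expansion h₂ hB2 hε'0
  have ht : ∀ v : E, Tendsto (fun t : ℝ => t • v) (𝓝[>] 0) (𝓝 0) := by
    intro v
    have : Tendsto (fun t : ℝ => t • v) (𝓝 0) (𝓝 ((0 : ℝ) • v)) :=
      (continuous_id.smul continuous_const).tendsto 0
    rw [zero_smul] at this
    exact this.mono_left nhdsWithin_le_nhds
  have htw : Tendsto (fun t : ℝ => (x + t • h, y + t • l)) (𝓝[>] 0) (𝓝 (x, y)) := by
    have : Tendsto (fun t : ℝ => (x + t • h, y + t • l)) (𝓝 0)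
        (𝓝 (x + (0 : ℝ) • h, y + (0 : ℝ) • l)) :=
      (by fun_prop : Continuous fun t : ℝ => (x + t • h, y + t • l)).tendsto 0
    simp only [zero_smul, add_zero] at this
    exact this.mono_left nhdsWithin_le_nhds
  obtain ⟨t, ⟨⟨t1, t2⟩, t3⟩, t0⟩ := ((((ht h).eventually e1).and ((ht l).eventually e2)).and
    (htw.eventually hloc)).and self_mem_nhdsWithin |>.exists
  have t0' : 0 < t := t0
  have b1 := (abs_le.1 t1).1
  have b2 := (abs_le.1 t2).1
  simp only [map_smul, _root_.smul_apply, smul_eq_mul, norm_smul, mul_pow,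
    Real.norm_eq_abs, sq_abs, innerSL_apply_apply] at b1 b2
  simp only at t3
  have n1 : ‖x + t • h - (y + t • l)‖ ^ 2 =
      ‖x - y‖ ^ 2 + 2 * t * ⟪x - y, h - l⟫ + t ^ 2 * ‖h - l‖ ^ 2 := by
    rw [show x + t • h - (y + t • l) = (x - y) + t • (h - l) by rw [smul_sub]; abel,
      norm_add_sq_real, norm_smul, mul_pow, Real.norm_eq_abs, sq_abs, inner_smul_right]
    ring
  have n2 : ∀ a v : E, ‖a + t • v‖ ^ 2 = ‖a‖ ^ 2 + 2 * t * ⟪a, v⟫ + t ^ 2 * ‖v‖ ^ 2 := by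
    intro a v
    rw [norm_add_sq_real, norm_smul, mul_pow, Real.norm_eq_abs, sq_abs, inner_smul_right]
    ring
  rw [n1, n2, n2, inner_add_right, inner_add_right, inner_smul_right, inner_smul_right] at t3
  have g1 : ⟪P₁ x, h⟫ = ⟪p, h⟫ + c * ⟪x - y, h⟫ + δ * ⟪x, h⟫ := by
    rw [← hx]; simp only [inner_sub_left, inner_smul_left, conj_trivial]; ring
  have g2 : ⟪P₂ y, l⟫ = ⟪q, l⟫ - c * ⟪x - y, l⟫ + δ * ⟪y, l⟫ := by
    rw [← hy]; simp only [inner_sub_left, inner_add_left, inner_smul_left, conj_trivial]; ring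
  have g3 : ⟪x - y, h - l⟫ = ⟪x - y, h⟫ - ⟪x - y, l⟫ := inner_sub_right _ _ _
  rw [g1] at b1
  rw [g2] at b2
  rw [g3] at t3
  set b11 := B₁ h h
  set b22 := B₂ l l
  have fin : t ^ 2 * (b11 + b22) ≤ t ^ 2 * (c * ‖h - l‖ ^ 2 + δ * (‖h‖ ^ 2 + ‖l‖ ^ 2) +
      2 * ε' * (‖h‖ ^ 2 + ‖l‖ ^ 2)) := by
    linarith
  have fin2 := le_of_mul_le_mul_left fin (by positivity)
  have fin3 : 2 * ε' * (‖h‖ ^ 2 + ‖l‖ ^ 2) ≤ ε := by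
    have : 2 * ε' * (‖h‖ ^ 2 + ‖l‖ ^ 2 + 1) = ε := by rw [hε']; field_simp
    linarith
  linarith

/-- Near a maximum of `U₁ x + U₂ y - c/2 |x - y|²`, where the `U i` are differentiable with
Lipschitz gradients `P i`, there are points of twice differentiability with almost optimal first
and second derivatives. -/
lemma exists_twice_differentiable_near_max {U₁ U₂ : E → ℝ} {P₁ P₂ : E → E} {C₁ C₂ : NNReal}
    (h₁ : ∀ x, HasFDerivAt U₁ (innerSL ℝ (P₁ x)) x) (h₂ : ∀ x, HasFDerivAt U₂ (innerSL ℝ (P₂ x)) x)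
    (hP₁ : LipschitzWith C₁ P₁) (hP₂ : LipschitzWith C₂ P₂) {c : ℝ} (hc : 0 ≤ c)
    (hle : ∀ x y, U₁ x + U₂ y ≤ c / 2 * ‖x - y‖ ^ 2) (h0 : 0 ≤ U₁ 0 + U₂ 0)
    {δ : ℝ} (hδ : 0 < δ) :
    ∃ (x y : E) (B₁ B₂ : E →L[ℝ] E →L[ℝ] ℝ), ‖x‖ ≤ δ ∧ ‖y‖ ≤ δ ∧ ‖P₁ x‖ ≤ δ ∧ ‖P₂ y‖ ≤ δ ∧
      HasFDerivAt (fun x => (innerSL ℝ (P₁ x) : E →L[ℝ] ℝ)) B₁ x ∧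
      HasFDerivAt (fun y => (innerSL ℝ (P₂ y) : E →L[ℝ] ℝ)) B₂ y ∧
      ∀ h l, B₁ h h + B₂ l l ≤ c * ‖h - l‖ ^ 2 + δ * (‖h‖ ^ 2 + ‖l‖ ^ 2) := by
  set f : E × E → E × E := fun w => (P₁ w.1, P₂ w.2) with hf
  have hfL : ∃ C, LipschitzWith C f :=
    ⟨_, (hP₁.comp LipschitzWith.prod_fst).prodMk (hP₂.comp LipschitzWith.prod_snd)⟩
  obtain ⟨Cf, hfL⟩ := hfL
  -- `A` is the gradient map of the quadratic penalty, so that `f w - A w = q` is exactly the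
  -- criticality condition for the tilted function `G`.
  set A : E × E →L[ℝ] E × E :=
    ((c • (ContinuousLinearMap.fst ℝ E E - ContinuousLinearMap.snd ℝ E E) +
      δ • ContinuousLinearMap.fst ℝ E E)).prod
    (-(c • (ContinuousLinearMap.fst ℝ E E - ContinuousLinearMap.snd ℝ E E)) +
      δ • ContinuousLinearMap.snd ℝ E E) with hA
  have hΓ : LipschitzWith (Cf + ‖A‖₊) fun w => f w - A w := hfL.sub A.lipschitz
  set M := 2 * c + δ + 1 with hM
  have hM1 : 1 ≤ M := by linarith
  -- Chosen so that the localization radius `4 * η / δ` is at most `δ / (2 * M)` and `η ≤ δ / 4`.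
  -- Both gradients, computed from the criticality equations, then stay below `δ`.
  set η := δ * min δ 1 / (8 * M) with hη
  have hη0 : 0 < η := by positivity
  obtain ⟨q, hq, hqd⟩ := exists_forall_preimage_differentiableAt hΓ hfL hη0
  rw [mem_ball_zero_iff] at hq
  have hq1 : ‖q.1‖ < η := (norm_fst_le q).trans_lt hq
  have hq2 : ‖q.2‖ < η := (norm_snd_le q).trans_lt hq
  -- The `δ` term confines the maximum to a ball of radius `R` about the origin, and the tilt by `q`
  -- makes every critical point a point of differentiability of both gradients.
  set G : E × E → ℝ := fun w => U₁ w.1 + U₂ w.2 - c / 2 * ‖w.1 - w.2‖ ^ 2 -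
    δ / 2 * (‖w.1‖ ^ 2 + ‖w.2‖ ^ 2) - ⟪q.1, w.1⟫ - ⟪q.2, w.2⟫ with hG
  have hU₁ : Continuous U₁ := continuous_iff_continuousAt.2 fun x => (h₁ x).continuousAt
  have hU₂ : Continuous U₂ := continuous_iff_continuousAt.2 fun x => (h₂ x).continuousAt
  have hGc : Continuous G := by fun_prop
  set R := 4 * η / δ with hR
  have hR0 : 0 < R := by positivity
  obtain ⟨w, hw, hmax⟩ := (isCompact_closedBall (0 : E × E) (R + 1)).exists_isMaxOn
    ⟨0, Metric.mem_closedBall_self (by linarith)⟩ hGc.continuousOn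
  have hG0 : 0 ≤ G w := by
    have : G 0 ≤ G w := hmax (Metric.mem_closedBall_self (by linarith))
    refine le_trans ?_ this
    simpa [hG] using h0
  have hwR : ‖w‖ ≤ R := by
    have h3 := hle w.1 w.2
    have h4 : -⟪q.1, w.1⟫ ≤ η * ‖w‖ := by
      rw [← inner_neg_left]
      refine (real_inner_le_norm _ _).trans ?_
      rw [norm_neg]
      exact mul_le_mul hq1.le (norm_fst_le w) (norm_nonneg _) hη0.le
    have h5 : -⟪q.2, w.2⟫ ≤ η * ‖w‖ := by
      rw [← inner_neg_left]
      refine (real_inner_le_norm _ _).trans ?_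
      rw [norm_neg]
      exact mul_le_mul hq2.le (norm_snd_le w) (norm_nonneg _) hη0.le
    have h6 : ‖w‖ ^ 2 ≤ ‖w.1‖ ^ 2 + ‖w.2‖ ^ 2 := by
      rcases max_choice ‖w.1‖ ‖w.2‖ with h | h <;> rw [Prod.norm_def, h] <;> nlinarith [sq_nonneg ‖w.1‖, sq_nonneg ‖w.2‖]
    have h7 : δ / 2 * ‖w‖ ^ 2 ≤ 2 * η * ‖w‖ := by
      have : δ / 2 * ‖w‖ ^ 2 ≤ δ / 2 * (‖w.1‖ ^ 2 + ‖w.2‖ ^ 2) := by gcongr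
      simp only [hG] at hG0
      linarith
    rcases eq_or_lt_of_le (norm_nonneg w) with h8 | h8
    · rw [← h8]; exact hR0.le
    · rw [hR, le_div_iff₀ hδ]
      have : δ / 2 * ‖w‖ ≤ 2 * η := by
        by_contra! hcon
        have := mul_lt_mul_of_pos_right hcon h8
        nlinarith
      linarith
  have hloc : IsLocalMax G w :=
    hmax.isLocalMax (Metric.closedBall_mem_nhds_of_mem (by rw [mem_ball_zero_iff]; linarith))
  have hx : P₁ w.1 - c • (w.1 - w.2) - δ • w.1 = q.1 := by
    have hl : IsLocalMax (fun x => G (x, w.2)) w.1 := by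
      have ht : Tendsto (fun x => (x, w.2)) (𝓝 w.1) (𝓝 w) :=
        (Continuous.prodMk continuous_id continuous_const).tendsto w.1
      exact ht.eventually hloc
    have hd : HasFDerivAt (fun x => G (x, w.2))
        (innerSL ℝ (P₁ w.1 - c • (w.1 - w.2) - δ • w.1 - q.1)) w.1 := by
      have a1 := (((hasFDerivAt_id w.1).sub_const w.2).norm_sq).const_mul (c / 2)
      have a2 := (((hasFDerivAt_id w.1).norm_sq).add_const (‖w.2‖ ^ 2)).const_mul (δ / 2)
      have a3 := (innerSL ℝ q.1).hasFDerivAt (x := w.1)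
      have := (((((h₁ w.1).add_const (U₂ w.2)).sub a1).sub a2).sub a3).sub_const ⟪q.2, w.2⟫
      refine HasFDerivAt.congr_fderiv this (ContinuousLinearMap.ext fun y => ?_)
      simp [innerSL_apply_apply]
      ring
    have := hl.hasFDerivAt_eq_zero hd
    have h0 := congrArg (fun L : E →L[ℝ] ℝ => L (P₁ w.1 - c • (w.1 - w.2) - δ • w.1 - q.1)) this
    rw [innerSL_apply_apply] at h0
    exact sub_eq_zero.1 (inner_self_eq_zero.1 h0)
  have hy : P₂ w.2 + c • (w.1 - w.2) - δ • w.2 = q.2 := by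
    have hl : IsLocalMax (fun y => G (w.1, y)) w.2 := by
      have ht : Tendsto (fun y => (w.1, y)) (𝓝 w.2) (𝓝 w) :=
        (Continuous.prodMk continuous_const continuous_id).tendsto w.2
      exact ht.eventually hloc
    have hd : HasFDerivAt (fun y => G (w.1, y))
        (innerSL ℝ (P₂ w.2 + c • (w.1 - w.2) - δ • w.2 - q.2)) w.2 := by
      have a1 := (((hasFDerivAt_id w.2).const_sub w.1).norm_sq).const_mul (c / 2)
      have a2 := (((hasFDerivAt_id w.2).norm_sq).const_add (‖w.1‖ ^ 2)).const_mul (δ / 2)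
      have a3 := (innerSL ℝ q.2).hasFDerivAt (x := w.2)
      have := (((((h₂ w.2).const_add (U₁ w.1)).sub a1).sub a2).sub_const ⟪q.1, w.1⟫).sub a3
      refine HasFDerivAt.congr_fderiv this (ContinuousLinearMap.ext fun y => ?_)
      simp [innerSL_apply_apply]
      ring
    have := hl.hasFDerivAt_eq_zero hd
    have h0 := congrArg (fun L : E →L[ℝ] ℝ => L (P₂ w.2 + c • (w.1 - w.2) - δ • w.2 - q.2)) this
    rw [innerSL_apply_apply] at h0
    exact sub_eq_zero.1 (inner_self_eq_zero.1 h0)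
  have hdiff : DifferentiableAt ℝ f w := by
    refine hqd w ?_
    refine Prod.ext ?_ ?_
    · rw [← hx]; simp [hf, hA]; abel
    · rw [← hy]; simp [hf, hA]; abel
  have hd1 : DifferentiableAt ℝ P₁ w.1 := by
    have h3 : DifferentiableAt ℝ (fun x : E => (x, w.2)) w.1 := by fun_prop
    exact (DifferentiableAt.comp (f := fun x : E => (x, w.2)) w.1 hdiff h3).fst
  have hd2 : DifferentiableAt ℝ P₂ w.2 := by
    have h3 : DifferentiableAt ℝ (fun y : E => (w.1, y)) w.2 := by fun_prop
    exact (DifferentiableAt.comp (f := fun y : E => (w.1, y)) w.2 hdiff h3).snd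
  have hB1 := (innerBilin E).hasFDerivAt.comp w.1 hd1.hasFDerivAt
  have hB2 := (innerBilin E).hasFDerivAt.comp w.2 hd2.hasFDerivAt
  have hRδ : R ≤ δ / (2 * M) := by
    have : min δ 1 ≤ δ := min_le_left _ _
    rw [hR, hη, div_le_div_iff₀ hδ (by positivity)]
    field_simp
    nlinarith
  have hηδ : η ≤ δ / 4 := by
    have : min δ 1 ≤ 1 := min_le_right _ _
    rw [hη, div_le_div_iff₀ (by positivity) (by norm_num)]
    nlinarith
  have hMR : M * R ≤ δ / 2 := by
    calc M * R ≤ M * (δ / (2 * M)) := by gcongr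
      _ = δ / 2 := by field_simp
  have hRδ' : R ≤ δ := by nlinarith
  have hw1 : ‖w.1‖ ≤ R := (norm_fst_le w).trans hwR
  have hw2 : ‖w.2‖ ≤ R := (norm_snd_le w).trans hwR
  have hc12 : ‖c • (w.1 - w.2)‖ ≤ c * (2 * R) := by
    rw [norm_smul, Real.norm_of_nonneg hc]
    gcongr
    exact (norm_sub_le _ _).trans (by linarith)
  have hδw : ∀ v : E, ‖v‖ ≤ R → ‖δ • v‖ ≤ δ * R := by
    intro v hv
    rw [norm_smul, Real.norm_of_nonneg hδ.le]
    gcongr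
  refine ⟨w.1, w.2, _, _, hw1.trans hRδ', hw2.trans hRδ', ?_, ?_, hB1, hB2, ?_⟩
  · have e : P₁ w.1 = q.1 + c • (w.1 - w.2) + δ • w.1 := by rw [← hx]; abel
    rw [e]
    refine (norm_add₃_le).trans ?_
    have := hδw _ hw1
    nlinarith
  · have e : P₂ w.2 = q.2 + -(c • (w.1 - w.2)) + δ • w.2 := by rw [← hy]; abel
    rw [e]
    refine (norm_add₃_le).trans ?_
    rw [norm_neg]
    have := hδw _ hw2
    nlinarith
  · exact second_order_at_max h₁ h₂ hB1 hB2 hloc hx hy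

end Perturbation

/-! ### Second order jets -/

/-- `(p, X)` belongs to the second order superjet of `u` at `ξ` relative to `K`. -/
def UpperJet (u : Space N → ℝ) (K : Set (Space N)) (ξ p : Space N) (X : Mat N) : Prop :=
  ξ ∈ K ∧ ∀ ε > 0, ∀ᶠ η in 𝓝[K] ξ, u η ≤ u ξ + quadPoly ξ p X η + ε * ‖η - ξ‖ ^ 2

/-- `(p, X)` belongs to the closure of the superjets of `u` at `x` relative to `K`. -/
def ClosureJet (u : Space N → ℝ) (K : Set (Space N)) (x p : Space N) (X : Mat N) : Prop :=
  ∃ (ξ q : ℕ → Space N) (Z : ℕ → Mat N), (∀ n, UpperJet u K (ξ n) (q n) (Z n)) ∧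
    (∀ n, (Z n).IsSymm) ∧ Tendsto ξ atTop (𝓝 x) ∧ Tendsto (fun n => u (ξ n)) atTop (𝓝 (u x)) ∧
    Tendsto q atTop (𝓝 p) ∧ Tendsto Z atTop (𝓝 X)

/-- A superjet is realized, up to a small multiple of the identity, by a test function touching
from above on the whole of a compact set. -/
lemma UpperJet.exists_testFunction {u : Space N → ℝ} {K : Set (Space N)} (hK : IsCompact K)
    (hu : UpperSemicontinuousOn u K) {ξ p : Space N} {X : Mat N} (h : UpperJet u K ξ p X)
    (hX : X.IsSymm) {ε : ℝ} (hε : 0 < ε) :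
    ∃ φ : Space N → ℝ, ContDiff ℝ 2 φ ∧ IsMaxOn (fun x => u x - φ x) K ξ ∧
      gradient φ ξ = p ∧ hessian φ ξ = X + ε • (1 : Mat N) := by
  have hXs : (X + ε • (1 : Mat N)).IsSymm := hX.add (Matrix.isSymm_one.smul ε)
  obtain ⟨hξ, hj⟩ := h
  obtain ⟨r, hr, hball⟩ := Metric.mem_nhdsWithin_iff.1 (hj (ε / 2) (by positivity))
  set P := quadPoly ξ p (X + ε • (1 : Mat N)) with hP
  have hPe : ∀ η, P η = quadPoly ξ p X η + ε / 2 * ‖η - ξ‖ ^ 2 := by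
    intro η
    simp only [hP, quadPoly, quad_add, quad_smul, quad_one]
    ring
  have hPc : Continuous P := (contDiff_quadPoly _ _ _).continuous
  have husc : UpperSemicontinuousOn (fun x => u x - P x) K := by
    have h2 : UpperSemicontinuousOn (fun x => - P x) K :=
      hPc.neg.continuousOn.upperSemicontinuousOn
    simpa [sub_eq_add_neg] using hu.add h2
  obtain ⟨M, hM⟩ := husc.bddAbove_of_isCompact hK
  -- Outside the ball of radius `r`, where the jet says nothing, the quartic then dominates the
  -- largest possible excess of `u - P`.
  set C := |M - u ξ| / r ^ 4 with hC
  have hCc : ContDiff ℝ 2 fun x : Space N => C * ‖x - ξ‖ ^ 4 :=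
    contDiff_const.mul (contDiff_norm_sub_pow_four ξ)
  refine ⟨fun x => P x + C * ‖x - ξ‖ ^ 4, (contDiff_quadPoly _ _ _).add hCc, ?_, ?_, ?_⟩
  · intro x hx
    have hPξ : P ξ = 0 := by simp [hPe, quadPoly, quad]
    simp only [mem_ofPred_eq, hPξ, sub_self, norm_zero]
    have hC0 : 0 ≤ C := by positivity
    by_cases hxr : x ∈ Metric.ball ξ r
    · have h1 : u x ≤ u ξ + quadPoly ξ p X x + ε / 2 * ‖x - ξ‖ ^ 2 := hball ⟨hxr, hx⟩
      have h2 := hPe x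
      have h3 : 0 ≤ C * ‖x - ξ‖ ^ 4 := by positivity
      norm_num
      linarith
    · have h1 : u x - P x ≤ M := hM (mem_image_of_mem _ hx)
      rw [Metric.mem_ball, dist_eq_norm, not_lt] at hxr
      have h2 : |M - u ξ| ≤ C * ‖x - ξ‖ ^ 4 := by
        calc |M - u ξ| = C * r ^ 4 := by rw [hC]; field_simp
          _ ≤ _ := by gcongr
      have h3 := le_abs_self (M - u ξ)
      norm_num
      linarith
  · rw [gradient_add (contDiff_quadPoly _ _ _) hCc, gradient_quadPoly _ _ hXs,
      gradient_const_mul (contDiff_norm_sub_pow_four ξ), gradient_norm_sub_pow_four]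
    simp
  · rw [hessian_add (contDiff_quadPoly _ _ _) hCc, hessian_quadPoly _ _ hXs,
      hessian_const_mul (contDiff_norm_sub_pow_four ξ), hessian_norm_sub_pow_four]
    simp

lemma norm_add_three_sq_le {E : Type*} [NormedAddCommGroup E] (a b c : E) :
    ‖a + b + c‖ ^ 2 ≤ 3 * (‖a‖ ^ 2 + ‖b‖ ^ 2 + ‖c‖ ^ 2) := by
  have h := norm_add₃_le (a := a) (b := b) (c := c)
  have h2 : ‖a + b + c‖ ^ 2 ≤ (‖a‖ + ‖b‖ + ‖c‖) ^ 2 := by gcongr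
  nlinarith [sq_nonneg (‖a‖ - ‖b‖), sq_nonneg (‖a‖ - ‖c‖), sq_nonneg (‖b‖ - ‖c‖)]

/-- A point produced by the regularization carries a superjet of the original function. -/
lemma IsLasryLions.exists_upperJet {K : Set (Space N)} {u U : Space N → ℝ} {z : Space N → Space N}
    {g k δ η : ℝ} (h : IsLasryLions K u g k U z) (hK : IsCompact K) (hne : K.Nonempty)
    (hu : UpperSemicontinuousOn u K) (hg : 0 < g) (hgk : g < k)
    (hG : g * k / (k - g) ≤ g + δ) (hη : η ≤ 1) (hη' : η * (g + 1) ≤ δ * g)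
    {x : Space N} {B : Space N →L[ℝ] Space N →L[ℝ] ℝ}
    (hB : HasFDerivAt (fun x => (innerSL ℝ (k • (x - z x)) : Space N →L[ℝ] ℝ)) B x)
    (hlt : ∀ d, d ≠ 0 → B d d < k * ‖d‖ ^ 2) (hx : ‖x‖ ≤ η) (hp : ‖k • (x - z x)‖ ≤ η)
    (hUx : |U x| ≤ δ / 2) :
    ∃ ξ p, UpperJet u K ξ p (symmMatrix B) ∧ ‖ξ‖ ≤ δ ∧ ‖p‖ ≤ δ ∧ |u ξ| ≤ δ ∧
      ∀ d, -(g + δ) * ‖d‖ ^ 2 ≤ quad (symmMatrix B) d := by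
  obtain ⟨ξ, hξ, hc⟩ := h.exists_contact hK hne hu hg hgk hB hlt
  obtain ⟨hP, hrest⟩ := h.of_contact hK hne hu hg hgk hξ hc
  obtain ⟨hlow, hjet⟩ := hrest hB
  set G := g * k / (k - g) with hGdef
  have hkg : 0 < k - g := by linarith
  have hgG : g ≤ G := by rw [hGdef, le_div_iff₀ hkg]; nlinarith
  have hG0 : 0 < G := by linarith
  have hη0 : 0 ≤ η := (norm_nonneg _).trans hx
  -- The gradient at a contact point is `G • (ξ - x)`, so a small gradient forces the base point `ξ`
  -- to be close to `x`.
  have hdist : G * ‖ξ - x‖ ≤ η := by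
    have : ‖G • (ξ - x)‖ ≤ η := hP ▸ hp
    rwa [norm_smul, Real.norm_of_nonneg hG0.le] at this
  have hdist' : g * ‖ξ - x‖ ≤ η :=
    (mul_le_mul_of_nonneg_right hgG (norm_nonneg _)).trans hdist
  have hηδ : η ≤ δ := by nlinarith
  refine ⟨ξ, k • (x - z x), ⟨hξ, fun ε hε => ?_⟩, ?_, hp.trans hηδ, ?_, fun d => ?_⟩
  · filter_upwards [hjet ε hε] with ζ hζ
    rw [quadPoly, quad_symmMatrix]
    linarith
  · have h1 : ‖ξ‖ ≤ ‖ξ - x‖ + ‖x‖ := by simpa using norm_add_le (ξ - x) x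
    have : g * ‖ξ‖ ≤ g * δ := by nlinarith
    exact le_of_mul_le_mul_left this hg
  · have e : u ξ = U x + G / 2 * ‖ξ - x‖ ^ 2 := by rw [hc, norm_sub_rev]; ring
    have h1 : 0 ≤ G / 2 * ‖ξ - x‖ ^ 2 := by positivity
    have h2 : G / 2 * ‖ξ - x‖ ^ 2 ≤ δ / 2 := by
      have h3 : ‖ξ - x‖ ≤ δ := by
        have : g * ‖ξ - x‖ ≤ g * δ := by nlinarith
        exact le_of_mul_le_mul_left this hg
      have : G * ‖ξ - x‖ * ‖ξ - x‖ ≤ 1 * δ :=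
        mul_le_mul (hdist.trans hη) h3 (norm_nonneg _) zero_le_one
      nlinarith
    rw [e]
    refine (abs_add_le _ _).trans ?_
    rw [abs_of_nonneg h1]
    linarith
  · rw [quad_symmMatrix]
    refine le_trans ?_ (hlow d)
    have := sq_nonneg ‖d‖
    nlinarith

/-- Approximate theorem on sums at the origin. -/
lemma exists_upperJets_near_zero {K₁ K₂ : Set (Space N)} {u₁ u₂ : Space N → ℝ}
    (hK₁ : IsCompact K₁) (hK₂ : IsCompact K₂) (hu₁ : UpperSemicontinuousOn u₁ K₁)
    (hu₂ : UpperSemicontinuousOn u₂ K₂) (h₁ : (0 : Space N) ∈ K₁) (h₂ : (0 : Space N) ∈ K₂)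
    (hz₁ : u₁ 0 = 0) (hz₂ : u₂ 0 = 0) {σ : ℝ} (hσ : 0 < σ)
    (hle : ∀ x ∈ K₁, ∀ y ∈ K₂, u₁ x + u₂ y ≤ σ / 2 * ‖x - y‖ ^ 2) {δ : ℝ} (hδ : 0 < δ) :
    ∃ (ξ₁ ξ₂ p₁ p₂ : Space N) (X₁ X₂ : Mat N), UpperJet u₁ K₁ ξ₁ p₁ X₁ ∧ UpperJet u₂ K₂ ξ₂ p₂ X₂ ∧
      X₁.IsSymm ∧ X₂.IsSymm ∧ (‖ξ₁‖ ≤ δ ∧ ‖ξ₂‖ ≤ δ) ∧ (‖p₁‖ ≤ δ ∧ ‖p₂‖ ≤ δ) ∧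
      (|u₁ ξ₁| ≤ δ ∧ |u₂ ξ₂| ≤ δ) ∧ (∀ d, -(3 * σ + δ) * ‖d‖ ^ 2 ≤ quad X₁ d) ∧
      (∀ d, -(3 * σ + δ) * ‖d‖ ^ 2 ≤ quad X₂ d) ∧
      ∀ h l, quad X₁ h + quad X₂ l ≤ 3 * σ * ‖h - l‖ ^ 2 + δ * (‖h‖ ^ 2 + ‖l‖ ^ 2) := by
  -- The factor `3` comes from `norm_add_three_sq_le`: splitting `ξ - ζ` through `x` and `y` costs
  -- exactly the penalties of two sup-convolutions of opening `3 * σ`, and it survives in the final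
  -- matrix inequality.
  set g := 3 * σ with hg
  have hg0 : 0 < g := by positivity
  -- The term `g ^ 2 / δ` brings the combined opening `g + g ^ 2 / (k - g)` below `g + δ`; the extra
  -- `2` puts `k` strictly above the Hessian bound `g + 1`, as the contact lemma requires.
  set k := g + (g ^ 2 / δ + 2) with hk
  have hpos : 0 < g ^ 2 / δ := by positivity
  have hgk : g < k := by linarith
  have hG : g * k / (k - g) ≤ g + δ := by
    have : k - g = g ^ 2 / δ + 2 := by rw [hk]; ring
    rw [this, div_le_iff₀ (by positivity), hk]
    have : g ^ 2 / δ * δ = g ^ 2 := by field_simp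
    nlinarith
  obtain ⟨U₁, z₁, hU₁⟩ := exists_isLasryLions hK₁ ⟨0, h₁⟩ hu₁ hg0 hgk
  obtain ⟨U₂, z₂, hU₂⟩ := exists_isLasryLions hK₂ ⟨0, h₂⟩ hu₂ hg0 hgk
  have hd₁ := hU₁.hasFDerivAt hK₁ ⟨0, h₁⟩ hu₁ hg0 hgk
  have hd₂ := hU₂.hasFDerivAt hK₂ ⟨0, h₂⟩ hu₂ hg0 hgk
  obtain ⟨C₁, hL₁⟩ := hU₁.lipschitzWith hK₁ ⟨0, h₁⟩ hu₁ hg0 hgk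
  obtain ⟨C₂, hL₂⟩ := hU₂.lipschitzWith hK₂ ⟨0, h₂⟩ hu₂ hg0 hgk
  have hsum : ∀ x y, U₁ x + U₂ y ≤ g / 2 * ‖x - y‖ ^ 2 := by
    intro x y
    have e1 := hU₁.le_supConv x
    have e2 := hU₂.le_supConv y
    obtain ⟨ξ, hξ, e3⟩ := exists_supConv_eq hK₁ ⟨0, h₁⟩ hu₁ g x
    obtain ⟨ζ, hζ, e4⟩ := exists_supConv_eq hK₂ ⟨0, h₂⟩ hu₂ g y
    have e5 := hle ξ hξ ζ hζ
    have e6 := norm_add_three_sq_le (x - y) (ξ - x) (y - ζ)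
    rw [show x - y + (ξ - x) + (y - ζ) = ξ - ζ by abel, norm_sub_rev ξ x] at e6
    rw [e3] at e1
    rw [e4] at e2
    rw [hg] at *
    nlinarith
  have hp₁ : 0 ≤ U₁ 0 := by simpa [hz₁] using hU₁.sub_le hK₁ hu₁ hg0 hgk 0 h₁
  have hp₂ : 0 ≤ U₂ 0 := by simpa [hz₂] using hU₂.sub_le hK₂ hu₂ hg0 hgk 0 h₂
  -- Together with `hp₁` and `hp₂` this makes both regularizations vanish at the origin, so their
  -- values are small near it.
  have hs0 : U₁ 0 + U₂ 0 ≤ 0 := by simpa using hsum 0 0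
  have hsmall : ∀ U : Space N → ℝ, ContinuousAt U 0 → U 0 = 0 →
      ∃ ρ > 0, ∀ x, ‖x‖ ≤ ρ → |U x| ≤ δ / 2 := by
    intro U hU hU0
    have := Metric.continuousAt_iff.1 hU (δ / 2) (by positivity)
    obtain ⟨ρ, hρ, hh⟩ := this
    refine ⟨ρ / 2, by positivity, fun x hx => ?_⟩
    have := hh (x := x) (by rw [dist_zero_right]; linarith)
    rw [hU0, dist_zero_right, Real.norm_eq_abs] at this
    exact this.le
  obtain ⟨ρ₁, hρ₁, hr₁⟩ := hsmall U₁ (hd₁ 0).continuousAt (by linarith)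
  obtain ⟨ρ₂, hρ₂, hr₂⟩ := hsmall U₂ (hd₂ 0).continuousAt (by linarith)
  set η := min (min ρ₁ ρ₂) (min (min 1 δ) (δ * g / (g + 1))) with hη
  have hη0 : 0 < η := by positivity
  have hηρ₁ : η ≤ ρ₁ := (min_le_left _ _).trans (min_le_left _ _)
  have hηρ₂ : η ≤ ρ₂ := (min_le_left _ _).trans (min_le_right _ _)
  have hη1 : η ≤ 1 := (min_le_right _ _).trans ((min_le_left _ _).trans (min_le_left _ _))
  have hηδ : η ≤ δ := (min_le_right _ _).trans ((min_le_left _ _).trans (min_le_right _ _))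
  have hηg : η * (g + 1) ≤ δ * g := by
    rw [← le_div_iff₀ (by positivity)]
    exact (min_le_right _ _).trans (min_le_right _ _)
  obtain ⟨x, y, B₁, B₂, hx, hy, hPx, hPy, hB₁, hB₂, hBB⟩ :=
    exists_twice_differentiable_near_max hd₁ hd₂ hL₁ hL₂ hg0.le hsum (by linarith) hη0
  have hlt₁ : ∀ d, d ≠ 0 → B₁ d d < k * ‖d‖ ^ 2 := by
    intro d hd
    have := hBB d 0
    simp only [map_zero, sub_zero, norm_zero] at this
    have hdn : 0 < ‖d‖ ^ 2 := by positivity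
    nlinarith
  have hlt₂ : ∀ d, d ≠ 0 → B₂ d d < k * ‖d‖ ^ 2 := by
    intro d hd
    have := hBB 0 d
    simp only [map_zero, zero_sub, norm_zero, norm_neg] at this
    have hdn : 0 < ‖d‖ ^ 2 := by positivity
    nlinarith
  obtain ⟨ξ₁, p₁, a1, a2, a3, a4, a5⟩ := hU₁.exists_upperJet hK₁ ⟨0, h₁⟩ hu₁ hg0 hgk hG hη1 hηg hB₁
    hlt₁ hx hPx (hr₁ x (hx.trans hηρ₁))
  obtain ⟨ξ₂, p₂, b1, b2, b3, b4, b5⟩ := hU₂.exists_upperJet hK₂ ⟨0, h₂⟩ hu₂ hg0 hgk hG hη1 hηg hB₂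
    hlt₂ hy hPy (hr₂ y (hy.trans hηρ₂))
  refine ⟨ξ₁, ξ₂, p₁, p₂, _, _, a1, b1, symmMatrix_isSymm _, symmMatrix_isSymm _, ⟨a2, b2⟩,
    ⟨a3, b3⟩, ⟨a4, b4⟩, a5, b5, fun h l => ?_⟩
  rw [quad_symmMatrix, quad_symmMatrix]
  refine (hBB h l).trans ?_
  gcongr

/-! ### Passage to the limit -/

lemma UpperJet.of_translate {u : Space N → ℝ} {K : Set (Space N)} {a p₀ ξ p : Space N} {X : Mat N}
    (h : UpperJet (fun x => u (a + x) - u a - ⟪p₀, x⟫) ((fun x => a + x) ⁻¹' K) ξ p X) :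
    UpperJet u K (a + ξ) (p₀ + p) X := by
  refine ⟨h.1, fun ε hε => ?_⟩
  have ht : Tendsto (fun x => -a + x) (𝓝[K] (a + ξ)) (𝓝[(fun x => a + x) ⁻¹' K] ξ) := by
    refine tendsto_nhdsWithin_iff.2 ⟨?_, ?_⟩
    · have : Tendsto (fun x => -a + x) (𝓝 (a + ξ)) (𝓝 (-a + (a + ξ))) :=
        (continuous_const.add continuous_id).tendsto _
      rw [neg_add_cancel_left] at this
      exact this.mono_left nhdsWithin_le_nhds
    · filter_upwards [self_mem_nhdsWithin] with x hx
      simpa using hx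
  filter_upwards [ht.eventually (h.2 ε hε)] with x hx
  simp only [add_neg_cancel_left, quadPoly] at hx ⊢
  rw [show -a + x - ξ = x - (a + ξ) by abel] at hx
  have e : ⟪p₀, -a + x⟫ = ⟪p₀, ξ⟫ + ⟪p₀, x - (a + ξ)⟫ := by
    rw [← inner_add_right]; congr 1; abel
  rw [e] at hx
  rw [inner_add_left]
  linarith

/-- By polarization the quadratic form bounds the entries, which gives compactness of the
approximating Hessians. -/
lemma abs_apply_le_of_abs_quad_le {X : Mat N} (hX : X.IsSymm) {C : ℝ}
    (h : ∀ d, |quad X d| ≤ C * ‖d‖ ^ 2) (i j : Fin N) : |X i j| ≤ 3 * C := by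
  have hi := h (EuclideanSpace.single i 1)
  have hj := h (EuclideanSpace.single j 1)
  have hij := h (EuclideanSpace.single i 1 + EuclideanSpace.single j 1)
  have e1 : ∀ i, quad X (EuclideanSpace.single i 1) = X i i := by
    intro i; simp [quad]
  have e2 : quad X (EuclideanSpace.single i 1 + EuclideanSpace.single j 1) =
      X i i + 2 * X i j + X j j := by
    have := hX.apply i j
    simp [quad, Matrix.mulVec_add, this]
    ring
  have hC : 0 ≤ C := by
    have := (abs_nonneg _).trans hi
    simpa using this
  have hn : ‖EuclideanSpace.single i (1 : ℝ) + EuclideanSpace.single j (1 : ℝ)‖ ^ 2 ≤ 4 := by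
    have h1 := norm_add_le (EuclideanSpace.single i (1 : ℝ)) (EuclideanSpace.single j (1 : ℝ))
    simp only [PiLp.norm_single, norm_one] at h1
    nlinarith [norm_nonneg (EuclideanSpace.single i (1 : ℝ) + EuclideanSpace.single j (1 : ℝ))]
  rw [e1] at hi hj
  rw [e2] at hij
  simp only [PiLp.norm_single, norm_one, one_pow, mul_one] at hi hj
  have hij' := hij.trans (mul_le_mul_of_nonneg_left hn hC)
  rw [abs_le] at *
  constructor <;> linarith [hi.1, hi.2, hj.1, hj.2, hij'.1, hij'.2]

lemma continuous_quad (h : Space N) : Continuous fun X : Mat N => quad X h := by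
  simp only [quad_eq_sum]
  fun_prop

lemma isSymm_of_tendsto {Z : ℕ → Mat N} {X : Mat N} (h : Tendsto Z atTop (𝓝 X))
    (hZ : ∀ n, (Z n).IsSymm) : X.IsSymm := by
  have h1 : Tendsto (fun n => (Z n)ᵀ) atTop (𝓝 Xᵀ) :=
    (continuous_id.matrix_transpose.tendsto X).comp h
  have h2 : (fun n => (Z n)ᵀ) = Z := funext fun n => (hZ n).eq
  rw [h2] at h1
  exact tendsto_nhds_unique h1 h

lemma dotProduct_fromBlocks_mulVec (A B C D : Mat N) (x : Fin N ⊕ Fin N → ℝ) :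
    x ⬝ᵥ Matrix.fromBlocks A B C D *ᵥ x =
      (x ∘ Sum.inl) ⬝ᵥ A *ᵥ (x ∘ Sum.inl) + (x ∘ Sum.inl) ⬝ᵥ B *ᵥ (x ∘ Sum.inr) +
      (x ∘ Sum.inr) ⬝ᵥ C *ᵥ (x ∘ Sum.inl) + (x ∘ Sum.inr) ⬝ᵥ D *ᵥ (x ∘ Sum.inr) := by
  conv_lhs => rw [Matrix.fromBlocks_mulVec, ← Sum.elim_comp_inl_inr x]
  rw [sumElim_dotProduct_sumElim, dotProduct_add, dotProduct_add]
  simp only [Sum.elim_comp_inl, Sum.elim_comp_inr]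
  ring

lemma doublingIneq_of_quad {σ : ℝ} {X Y : Mat N} (hX : X.IsSymm) (hY : Y.IsSymm)
    (hX' : ∀ d, -(3 * σ) * ‖d‖ ^ 2 ≤ quad X d) (hY' : ∀ d, -(3 * σ) * ‖d‖ ^ 2 ≤ -quad Y d)
    (hXY : ∀ h l, quad X h - quad Y l ≤ 3 * σ * ‖h - l‖ ^ 2) : DoublingIneq σ X Y := by
  have hn : ∀ v : Fin N → ℝ, ‖WithLp.toLp 2 v‖ ^ 2 = v ⬝ᵥ v := by
    intro v
    rw [EuclideanSpace.norm_sq_eq]; simp [dotProduct, sq]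
  constructor
  · refine .of_dotProduct_mulVec_nonneg ?_ fun x => ?_
    · simp [Matrix.IsHermitian, Matrix.fromBlocks_transpose, hX.eq, hY.eq]
    · rw [star_trivial, Matrix.sub_mulVec, Matrix.smul_mulVec, dotProduct_sub, dotProduct_smul,
        dotProduct_fromBlocks_mulVec, dotProduct_fromBlocks_mulVec]
      have h1 := hX' (WithLp.toLp 2 (x ∘ Sum.inl))
      have h2 := hY' (WithLp.toLp 2 (x ∘ Sum.inr))
      rw [hn] at h1 h2
      simp only [quad] at h1 h2
      simp only [Matrix.zero_mulVec, dotProduct_zero, Matrix.one_mulVec, Matrix.neg_mulVec,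
        dotProduct_neg, smul_eq_mul]
      linarith
  · refine .of_dotProduct_mulVec_nonneg ?_ fun x => ?_
    · simp [Matrix.IsHermitian, Matrix.fromBlocks_transpose, hX.eq, hY.eq]
    · rw [star_trivial, Matrix.sub_mulVec, Matrix.smul_mulVec, dotProduct_sub, dotProduct_smul,
        dotProduct_fromBlocks_mulVec, dotProduct_fromBlocks_mulVec]
      have h1 := hXY (WithLp.toLp 2 (x ∘ Sum.inl)) (WithLp.toLp 2 (x ∘ Sum.inr))
      rw [← WithLp.toLp_sub, hn] at h1
      simp only [quad, sub_dotProduct, dotProduct_sub] at h1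
      simp only [Matrix.zero_mulVec, dotProduct_zero, Matrix.one_mulVec, Matrix.neg_mulVec,
        dotProduct_neg, smul_eq_mul]
      have h2 := dotProduct_comm (x ∘ Sum.inl) (x ∘ Sum.inr)
      linarith

/-- **Theorem on sums** (Crandall–Ishii) for the penalization `σ/2 |x - y|²`. -/
theorem exists_closureJets {K₁ K₂ : Set (Space N)} {u v : Space N → ℝ}
    (hK₁ : IsCompact K₁) (hK₂ : IsCompact K₂) (hu : UpperSemicontinuousOn u K₁)
    (hv : UpperSemicontinuousOn v K₂) {a b : Space N} (ha : a ∈ K₁) (hb : b ∈ K₂) {σ : ℝ}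
    (hσ : 0 < σ) (hmax : ∀ x ∈ K₁, ∀ y ∈ K₂,
      u x + v y - σ / 2 * ‖x - y‖ ^ 2 ≤ u a + v b - σ / 2 * ‖a - b‖ ^ 2) :
    ∃ X Y : Mat N, X.IsSymm ∧ Y.IsSymm ∧ DoublingIneq σ X Y ∧
      ClosureJet u K₁ a (σ • (a - b)) X ∧ ClosureJet v K₂ b (-(σ • (a - b))) (-Y) := by
  -- The gradient of the penalty at the maximum. Subtracting the linear parts `⟪p, ·⟫` and `⟪-p, ·⟫`
  -- after translation leaves precisely the pure penalty `σ/2 |x - y|²` in `hle`.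
  set p := σ • (a - b) with hp
  have husc : ∀ (w : Space N → ℝ) (K : Set (Space N)) (c q : Space N),
      UpperSemicontinuousOn w K → UpperSemicontinuousOn (fun x => w (c + x) - w c - ⟪q, x⟫)
        ((fun x => c + x) ⁻¹' K) := by
    intro w K c q hw
    have h1 : UpperSemicontinuousOn (fun x => w (c + x)) ((fun x => c + x) ⁻¹' K) := by
      intro x hx y hy
      have ht : Tendsto (fun x => c + x) (𝓝[(fun x => c + x) ⁻¹' K] x) (𝓝[K] (c + x)) :=
        ((continuous_const.add continuous_id).continuousWithinAt).tendsto_nhdsWithin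
          (fun _ h => h)
      exact ht.eventually (hw (c + x) hx y hy)
    have h2 : UpperSemicontinuousOn (fun x => -w c - ⟪q, x⟫) ((fun x => c + x) ⁻¹' K) :=
      (by fun_prop : Continuous fun x => -w c - ⟪q, x⟫).continuousOn.upperSemicontinuousOn
    have e : (fun x => w (c + x) - w c - ⟪q, x⟫) = fun x => w (c + x) + (-w c - ⟪q, x⟫) := by
      funext x; ring
    rw [e]
    exact h1.add h2
  have hcomp : ∀ (K : Set (Space N)) (c : Space N), IsCompact K →
      IsCompact ((fun x => c + x) ⁻¹' K) := fun K c hK =>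
    (Homeomorph.addLeft c).isCompact_preimage.2 hK
  have hle : ∀ x ∈ (fun x => a + x) ⁻¹' K₁, ∀ y ∈ (fun x => b + x) ⁻¹' K₂,
      (u (a + x) - u a - ⟪p, x⟫) + (v (b + y) - v b - ⟪-p, y⟫) ≤ σ / 2 * ‖x - y‖ ^ 2 := by
    intro x hx y hy
    have h1 := hmax (a + x) hx (b + y) hy
    have h2 : ‖a + x - (b + y)‖ ^ 2 = ‖a - b‖ ^ 2 + 2 * ⟪a - b, x - y⟫ + ‖x - y‖ ^ 2 := by
      rw [← norm_add_sq_real]; congr 2; abel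
    have h3 : ⟪p, x⟫ - ⟪p, y⟫ = σ * ⟪a - b, x - y⟫ := by
      rw [← inner_sub_right, hp, inner_smul_left]; simp
    rw [h2] at h1
    rw [inner_neg_left]
    linarith
  have key : ∀ n : ℕ, _ := fun n => exists_upperJets_near_zero (hcomp K₁ a hK₁) (hcomp K₂ b hK₂)
    (husc u K₁ a p hu) (husc v K₂ b (-p) hv) (by simpa using ha) (by simpa using hb) (by simp)
    (by simp) hσ hle (Nat.one_div_pos_of_nat (α := ℝ) (n := n))
  choose ξ₁ ξ₂ p₁ p₂ X₁ X₂ hj₁ hj₂ hs₁ hs₂ hξ hpn hun hl₁ hl₂ hup using key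
  have hδ1 : ∀ n : ℕ, 1 / ((n : ℝ) + 1) ≤ 1 := fun n => by
    rw [div_le_one (by positivity)]; linarith [Nat.cast_nonneg (α := ℝ) n]
  have hquad₁ : ∀ n d, |quad (X₁ n) d| ≤ (3 * σ + 1) * ‖d‖ ^ 2 := by
    intro n d
    have h1 := hl₁ n d
    have h2 := hup n d 0
    simp only [sub_zero, norm_zero] at h2
    have h3 : quad (X₂ n) 0 = 0 := by simp [quad]
    rw [abs_le]
    have h4 := hδ1 n
    have h5 := sq_nonneg ‖d‖
    constructor <;> nlinarith
  have hquad₂ : ∀ n d, |quad (X₂ n) d| ≤ (3 * σ + 1) * ‖d‖ ^ 2 := by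
    intro n d
    have h1 := hl₂ n d
    have h2 := hup n 0 d
    simp only [zero_sub, norm_neg, norm_zero] at h2
    have h3 : quad (X₁ n) 0 = 0 := by simp [quad]
    rw [abs_le]
    have h4 := hδ1 n
    have h5 := sq_nonneg ‖d‖
    constructor <;> nlinarith
  set C := 3 * (3 * σ + 1) with hC
  have hcpt : IsCompact (X := Mat N)
      (Set.pi univ fun _ : Fin N => Set.pi univ fun _ : Fin N => Icc (-C) C) :=
    isCompact_univ_pi fun _ => isCompact_univ_pi fun _ => isCompact_Icc
  have : FirstCountableTopology (Mat N) :=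
    inferInstanceAs (FirstCountableTopology (Fin N → Fin N → ℝ))
  obtain ⟨⟨X, Z⟩, -, s, hs, hlim⟩ := (hcpt.prod hcpt).tendsto_subseq
    (x := fun n => (X₁ n, X₂ n)) fun n =>
      ⟨fun i _ j _ => abs_le.1 (abs_apply_le_of_abs_quad_le (hs₁ n) (hquad₁ n) i j),
       fun i _ j _ => abs_le.1 (abs_apply_le_of_abs_quad_le (hs₂ n) (hquad₂ n) i j)⟩
  have hlim₁ : Tendsto (X₁ ∘ s) atTop (𝓝 X) := (continuous_fst.tendsto _).comp hlim
  have hlim₂ : Tendsto (X₂ ∘ s) atTop (𝓝 Z) := (continuous_snd.tendsto _).comp hlim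
  have hδ : Tendsto (fun n : ℕ => 1 / ((s n : ℝ) + 1)) atTop (𝓝 0) :=
    tendsto_one_div_add_atTop_nhds_zero_nat.comp hs.tendsto_atTop
  have hXs : X.IsSymm := isSymm_of_tendsto hlim₁ fun n => hs₁ _
  have hZs : Z.IsSymm := isSymm_of_tendsto hlim₂ fun n => hs₂ _
  have hzero : ∀ f : ℕ → Space N, (∀ n, ‖f n‖ ≤ 1 / ((n : ℝ) + 1)) →
      Tendsto (fun n => f (s n)) atTop (𝓝 0) := fun f hf =>
    squeeze_zero_norm (fun n => hf (s n)) hδ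
  have hzero' : ∀ f : ℕ → ℝ, (∀ n, |f n| ≤ 1 / ((n : ℝ) + 1)) →
      Tendsto (fun n => f (s n)) atTop (𝓝 0) := fun f hf =>
    squeeze_zero_norm (fun n => hf (s n)) hδ
  have hlow : ∀ (W : ℕ → Mat N) (V : Mat N), Tendsto (W ∘ s) atTop (𝓝 V) →
      (∀ (n : ℕ) d, -(3 * σ + 1 / ((n : ℝ) + 1)) * ‖d‖ ^ 2 ≤ quad (W n) d) →
      ∀ d, -(3 * σ) * ‖d‖ ^ 2 ≤ quad V d := by
    intro W V hW hq d
    have t1 : Tendsto (fun n => quad ((W ∘ s) n) d) atTop (𝓝 (quad V d)) :=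
      ((continuous_quad d).tendsto V).comp hW
    have t2 : Tendsto (fun n => -(3 * σ + 1 / ((s n : ℝ) + 1)) * ‖d‖ ^ 2) atTop
        (𝓝 (-(3 * σ + 0) * ‖d‖ ^ 2)) := ((hδ.const_add _).neg).mul_const _
    rw [add_zero] at t2
    exact le_of_tendsto_of_tendsto' t2 t1 fun n => hq _ d
  have hjets : ∀ (w : Space N → ℝ) (K : Set (Space N)) (c q : Space N) (ζ r : ℕ → Space N)
      (W : ℕ → Mat N) (V : Mat N),
      (∀ n, UpperJet (fun x => w (c + x) - w c - ⟪q, x⟫) ((fun x => c + x) ⁻¹' K) (ζ n) (r n) (W n)) →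
      (∀ n, (W n).IsSymm) → (∀ n, ‖ζ n‖ ≤ 1 / ((n : ℝ) + 1)) → (∀ n, ‖r n‖ ≤ 1 / ((n : ℝ) + 1)) →
      (∀ n, |w (c + ζ n) - w c - ⟪q, ζ n⟫| ≤ 1 / ((n : ℝ) + 1)) → Tendsto (W ∘ s) atTop (𝓝 V) →
      ClosureJet w K c q V := by
    intro w K c q ζ r W V hj hW hζ hr hw hV
    refine ⟨fun n => c + ζ (s n), fun n => q + r (s n), fun n => W (s n),
      fun n => (hj _).of_translate, fun n => hW _, ?_, ?_, ?_, hV⟩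
    · simpa using (hzero ζ hζ).const_add c
    · have t1 := hzero' _ hw
      have t2 : Tendsto (fun n => ⟪q, ζ (s n)⟫) atTop (𝓝 0) := by
        have h0 : Continuous fun x => ⟪q, x⟫ := by fun_prop
        simpa [Function.comp_def] using (h0.tendsto 0).comp (hzero ζ hζ)
      have t3 := (t1.add t2).add_const (w c)
      simpa using t3
    · simpa using (hzero r hr).const_add q
  refine ⟨X, -Z, hXs, hZs.neg, doublingIneq_of_quad hXs hZs.neg (hlow X₁ X hlim₁ hl₁) ?_ ?_,
    hjets u K₁ a p ξ₁ p₁ X₁ X hj₁ hs₁ (fun n => (hξ n).1) (fun n => (hpn n).1)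
      (fun n => (hun n).1) hlim₁, ?_⟩
  · intro d
    rw [quad_neg, neg_neg]
    exact hlow X₂ Z hlim₂ hl₂ d
  · intro h l
    rw [quad_neg, sub_neg_eq_add]
    have t1 : Tendsto (fun n => quad ((X₁ ∘ s) n) h + quad ((X₂ ∘ s) n) l) atTop
        (𝓝 (quad X h + quad Z l)) :=
      (((continuous_quad h).tendsto X).comp hlim₁).add (((continuous_quad l).tendsto Z).comp hlim₂)
    have t2 : Tendsto (fun n => 3 * σ * ‖h - l‖ ^ 2 +
        1 / ((s n : ℝ) + 1) * (‖h‖ ^ 2 + ‖l‖ ^ 2)) atTop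
        (𝓝 (3 * σ * ‖h - l‖ ^ 2 + 0 * (‖h‖ ^ 2 + ‖l‖ ^ 2))) := (hδ.mul_const _).const_add _
    rw [zero_mul, add_zero] at t2
    exact le_of_tendsto_of_tendsto' t1 t2 fun n => hup _ h l
  · rw [neg_neg]
    exact hjets v K₂ b (-p) ξ₂ p₂ X₂ Z hj₂ hs₂ (fun n => (hξ n).2) (fun n => (hpn n).2)
      (fun n => (hun n).2) hlim₂

/-! ### Positivity of the principal eigenvalue implies the maximum principle -/

lemma IsContinuousOperator.tendsto {O : Set (Space N)} {F : Operator N}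
    (hF : IsContinuousOperator O F) {ι : Type*} {f : Filter ι} {x p : Space N} {r : ℝ} {X : Mat N}
    {xs ps : ι → Space N} {rs : ι → ℝ} {Xs : ι → Mat N} (hxO : x ∈ O) (hX : X.IsSymm)
    (hx : Tendsto xs f (𝓝 x)) (hr : Tendsto rs f (𝓝 r)) (hp : Tendsto ps f (𝓝 p))
    (hXs : Tendsto Xs f (𝓝 X)) (hO : ∀ᶠ i in f, xs i ∈ O) (hsymm : ∀ᶠ i in f, (Xs i).IsSymm) :
    Tendsto (fun i => F (xs i) (rs i) (ps i) (Xs i)) f (𝓝 (F x r p X)) := by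
  have h1 : Tendsto (fun q : Space N × ℝ × Space N × Mat N => F q.1 q.2.1 q.2.2.1 q.2.2.2)
      (𝓝[{q | q.1 ∈ O ∧ q.2.2.2.IsSymm}] (x, r, p, X)) (𝓝 (F x r p X)) :=
    hF (x, r, p, X) ⟨hxO, hX⟩
  have h2 : Tendsto (fun i => (xs i, rs i, ps i, Xs i)) f
      (𝓝[{q | q.1 ∈ O ∧ q.2.2.2.IsSymm}] (x, r, p, X)) :=
    tendsto_nhdsWithin_iff.2
      ⟨hx.prodMk_nhds (hr.prodMk_nhds (hp.prodMk_nhds hXs)), hO.and hsymm⟩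
  exact h1.comp h2

/-- Viscosity inequalities pass to closures of superjets. -/
lemma ClosureJet.operator_nonpos {O K : Set (Space N)} {F : Operator N} {u : Space N → ℝ}
    (hF : IsContinuousOperator O F) (hKO : K ⊆ O) (hK : IsCompact K)
    (hu : UpperSemicontinuousOn u K) {x p : Space N} {X : Mat N} (h : ClosureJet u K x p X)
    {c ρ : ℝ} (hc : c < u x) (hρ : 0 < ρ)
    (htest : ∀ ξ ∈ K, c < u ξ → dist ξ x < ρ → ∀ φ : Space N → ℝ, ContDiff ℝ 2 φ →
      IsMaxOn (fun y => u y - φ y) K ξ → F ξ (u ξ) (gradient φ ξ) (hessian φ ξ) ≤ 0) :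
    F x (u x) p X ≤ 0 := by
  obtain ⟨ξ, q, Z, hjet, hsymm, hξ, huξ, hq, hZ⟩ := h
  have hx : x ∈ K := hK.isClosed.mem_of_tendsto hξ (Eventually.of_forall fun n => (hjet n).1)
  have hX : X.IsSymm := isSymm_of_tendsto hZ hsymm
  -- Turning a jet into a global test function costs a multiple of the identity; the multiple is
  -- sent to zero along the sequence.
  have hZ' : Tendsto (fun n : ℕ => Z n + (1 / ((n : ℝ) + 1)) • (1 : Mat N)) atTop (𝓝 X) := by
    have := hZ.add ((tendsto_one_div_add_atTop_nhds_zero_nat (𝕜 := ℝ)).smul_const (1 : Mat N))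
    simpa using this
  have hZs : ∀ n : ℕ, (Z n + (1 / ((n : ℝ) + 1)) • (1 : Mat N)).IsSymm := fun n =>
    (hsymm n).add (Matrix.isSymm_one.smul _)
  have hlim : Tendsto (fun n : ℕ => F (ξ n) (u (ξ n)) (q n)
      (Z n + (1 / ((n : ℝ) + 1)) • (1 : Mat N))) atTop (𝓝 (F x (u x) p X)) :=
    hF.tendsto (hKO hx) hX hξ huξ hq hZ' (Eventually.of_forall fun n => hKO (hjet n).1)
      (Eventually.of_forall hZs)
  refine le_of_tendsto hlim ?_
  filter_upwards [huξ.eventually_const_lt hc, Metric.tendsto_nhds.1 hξ ρ hρ] with n h1 h2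
  obtain ⟨φ, hφ, hmax, hgrad, hhess⟩ := (hjet n).exists_testFunction hK hu (hsymm n)
    (Nat.one_div_pos_of_nat (α := ℝ) (n := n))
  have := htest (ξ n) (hjet n).1 h1 h2 φ hφ hmax
  rwa [hgrad, hhess] at this

/-- Positive multiples of positive supersolutions of the eigenvalue inequality are again
supersolutions. -/
lemma IsSupersolution.const_mul {O U : Set (Space N)} {F : Operator N} {α l t : ℝ}
    {φ : Space N → ℝ} (hF : IsPosHomogeneous O F α) (hUO : U ⊆ O) (hpos : ∀ x ∈ U, 0 < φ x)
    (h : IsSupersolution (fun x r p X => F x r p X - l * r ^ α) U φ) (ht : 0 < t) :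
    IsSupersolution (fun x r p X => F x r p X - l * r ^ α) U fun x => t * φ x := by
  intro ψ hψ ξ hξ hmin
  have hψ' : ContDiff ℝ 2 fun x => t⁻¹ * ψ x := contDiff_const.mul hψ
  have hmin' : IsLocalMin (fun x => φ x - t⁻¹ * ψ x) ξ := by
    filter_upwards [hmin] with x hx
    have e : ∀ y, φ y - t⁻¹ * ψ y = t⁻¹ * (t * φ y - ψ y) := by
      intro y; field_simp
    rw [e, e]
    gcongr
  have h1 := h _ hψ' ξ hξ hmin'
  rw [gradient_const_mul hψ, hessian_const_mul hψ] at h1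
  have h2 := hF ξ (hUO hξ) (φ ξ) (t⁻¹ • gradient ψ ξ) (t⁻¹ • hessian ψ ξ)
    ((hessian_isSymm hψ ξ).smul _) t ht.le
  rw [smul_inv_smul₀ ht.ne', smul_inv_smul₀ ht.ne'] at h2
  simp only [h2, Real.mul_rpow ht.le (hpos ξ hξ).le]
  have h3 : 0 ≤ t ^ α := Real.rpow_nonneg ht.le α
  have := mul_nonneg h3 h1
  linarith

/-- Dividing by a lower semicontinuous function preserves upper semicontinuity only for a
nonnegative numerator, hence the positive part. -/
lemma upperSemicontinuousOn_posPart_div {K : Set (Space N)} {u φ : Space N → ℝ}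
    (hu : UpperSemicontinuousOn u K) (hφ : LowerSemicontinuousOn φ K) (hpos : ∀ x ∈ K, 0 < φ x) :
    UpperSemicontinuousOn (fun x => max (u x) 0 / φ x) K := by
  intro x hx y hy
  have hc : ContinuousAt (fun s : ℝ => (max (u x) 0 + s) / (φ x - s)) 0 := by
    have : φ x - 0 ≠ 0 := by simpa using (hpos x hx).ne'
    fun_prop (disch := exact this)
  have h1 : ∀ᶠ s in 𝓝[>] (0 : ℝ), (max (u x) 0 + s) / (φ x - s) < y := by
    refine (hc.eventually_lt_const ?_).filter_mono nhdsWithin_le_nhds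
    simpa using hy
  have h2 : ∀ᶠ s in 𝓝[>] (0 : ℝ), s < φ x :=
    (eventually_lt_nhds (hpos x hx)).filter_mono nhdsWithin_le_nhds
  obtain ⟨s, ⟨hs1, hs2⟩, hs0⟩ := ((h1.and h2).and self_mem_nhdsWithin).exists
  have hs0' : 0 < s := hs0
  have a1 : u x < max (u x) 0 + s := by linarith [le_max_left (u x) 0]
  have a2 : φ x - s < φ x := by linarith
  filter_upwards [hu x hx _ a1, hφ x hx _ a2] with w b1 b2
  refine lt_of_le_of_lt ?_ hs1
  have b3 : max (u w) 0 ≤ max (u x) 0 + s :=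
    max_le b1.le (by linarith [le_max_right (u x) 0])
  exact div_le_div₀ (by linarith [le_max_right (u x) 0]) b3 (by linarith) b2.le

lemma UpperSemicontinuousOn.fst_add_snd {K₁ K₂ : Set (Space N)} {u v : Space N → ℝ}
    (hu : UpperSemicontinuousOn u K₁) (hv : UpperSemicontinuousOn v K₂) :
    UpperSemicontinuousOn (fun w : Space N × Space N => u w.1 + v w.2) (K₁ ×ˢ K₂) := by
  have h1 : UpperSemicontinuousOn (fun w : Space N × Space N => u w.1) (K₁ ×ˢ K₂) := by
    intro w hw y hy
    have : Tendsto Prod.fst (𝓝[K₁ ×ˢ K₂] w) (𝓝[K₁] w.1) :=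
      continuous_fst.continuousWithinAt.tendsto_nhdsWithin fun _ h => h.1
    exact this.eventually (hu w.1 hw.1 y hy)
  have h2 : UpperSemicontinuousOn (fun w : Space N × Space N => v w.2) (K₁ ×ˢ K₂) := by
    intro w hw y hy
    have : Tendsto Prod.snd (𝓝[K₁ ×ˢ K₂] w) (𝓝[K₂] w.2) :=
      continuous_snd.continuousWithinAt.tendsto_nhdsWithin fun _ h => h.2
    exact this.eventually (hv w.2 hw.2 y hy)
  exact h1.add h2

/-- Maximum points of the doubled function `u x + v y - σ/2 |x - y|²` for `σ → ∞` accumulate at a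
contact point when `u + v ≤ 0` with equality somewhere. -/
lemma exists_doubling_sequence {K₁ K₂ : Set (Space N)} {u v : Space N → ℝ} (hK₁ : IsCompact K₁)
    (hK₂ : IsCompact K₂) (hsub : K₁ ⊆ K₂) (hu : UpperSemicontinuousOn u K₁)
    (hv : UpperSemicontinuousOn v K₂) (hle : ∀ x ∈ K₁, u x + v x ≤ 0) {x₀ : Space N}
    (hx₀ : x₀ ∈ K₁) (heq : u x₀ + v x₀ = 0) :
    ∃ (a b : ℕ → Space N) (σ : ℕ → ℝ), ∃ z ∈ K₁, (∀ n, a n ∈ K₁) ∧ (∀ n, b n ∈ K₂) ∧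
      (∀ n, 0 < σ n) ∧ (∀ n, ∀ x ∈ K₁, ∀ y ∈ K₂, u x + v y - σ n / 2 * ‖x - y‖ ^ 2 ≤
        u (a n) + v (b n) - σ n / 2 * ‖a n - b n‖ ^ 2) ∧ u z + v z = 0 ∧
      Tendsto a atTop (𝓝 z) ∧ Tendsto b atTop (𝓝 z) ∧ Tendsto (fun n => u (a n)) atTop (𝓝 (u z)) ∧
      Tendsto (fun n => v (b n)) atTop (𝓝 (v z)) ∧
      Tendsto (fun n => σ n * ‖a n - b n‖ ^ 2 + ‖a n - b n‖) atTop (𝓝 0) := by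
  have hex : ∀ n : ℕ, ∃ w ∈ K₁ ×ˢ K₂, IsMaxOn (fun w : Space N × Space N =>
      u w.1 + v w.2 + -(((n : ℝ) + 1) / 2 * ‖w.1 - w.2‖ ^ 2)) (K₁ ×ˢ K₂) w := by
    intro n
    refine UpperSemicontinuousOn.exists_isMaxOn ⟨(x₀, x₀), hx₀, hsub hx₀⟩ (hK₁.prod hK₂)
      ((UpperSemicontinuousOn.fst_add_snd hu hv).add ?_)
    exact (by fun_prop : Continuous fun w : Space N × Space N =>
      -(((n : ℝ) + 1) / 2 * ‖w.1 - w.2‖ ^ 2)).continuousOn.upperSemicontinuousOn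
  choose w hw hmax using hex
  obtain ⟨M₁, hM₁⟩ := hu.bddAbove_of_isCompact hK₁
  obtain ⟨M₂, hM₂⟩ := hv.bddAbove_of_isCompact hK₂
  -- Comparison with the diagonal point `(x₀, x₀)`, where the doubled function vanishes.
  have hnn : ∀ n : ℕ, ((n : ℝ) + 1) / 2 * ‖(w n).1 - (w n).2‖ ^ 2 ≤ u (w n).1 + v (w n).2 := by
    intro n
    have := hmax n (⟨hx₀, hsub hx₀⟩ : (x₀, x₀) ∈ K₁ ×ˢ K₂)
    simp [heq] at this
    linarith
  obtain ⟨z, hz, s, hs, hlim⟩ := hK₁.tendsto_subseq (fun n => (hw n).1)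
  have hδ : Tendsto (fun n : ℕ => 1 / ((s n : ℝ) + 1)) atTop (𝓝 0) :=
    tendsto_one_div_add_atTop_nhds_zero_nat.comp hs.tendsto_atTop
  have hdist : Tendsto (fun n => ‖(w (s n)).1 - (w (s n)).2‖) atTop (𝓝 0) := by
    have h1 : Tendsto (fun n => ‖(w (s n)).1 - (w (s n)).2‖ ^ 2) atTop (𝓝 0) := by
      have h2 : Tendsto (fun n : ℕ => 1 / ((s n : ℝ) + 1) * (2 * (M₁ + M₂))) atTop (𝓝 0) := by
        simpa using hδ.mul_const (2 * (M₁ + M₂))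
      refine squeeze_zero (fun n => sq_nonneg _) (fun n => ?_) h2
      have h3 := hnn (s n)
      have h4 : u (w (s n)).1 ≤ M₁ := hM₁ (mem_image_of_mem _ (hw (s n)).1)
      have h5 : v (w (s n)).2 ≤ M₂ := hM₂ (mem_image_of_mem _ (hw (s n)).2)
      rw [div_mul_eq_mul_div, one_mul, le_div_iff₀ (by positivity)]
      linarith
    have h2 := h1.sqrt
    simpa using h2
  have hb : Tendsto (fun n => (w (s n)).2) atTop (𝓝 z) := by
    have h1 : Tendsto (fun n => (w (s n)).1 - (w (s n)).2) atTop (𝓝 0) :=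
      tendsto_zero_iff_norm_tendsto_zero.2 hdist
    have h2 := hlim.sub h1
    simpa [Function.comp_def] using h2
  have hua : ∀ ε > 0, ∀ᶠ n in atTop, u (w (s n)).1 < u z + ε := fun ε hε =>
    (tendsto_nhdsWithin_iff.2 ⟨hlim, Eventually.of_forall fun n => (hw (s n)).1⟩).eventually
      (hu z hz (u z + ε) (by linarith))
  have hvb : ∀ ε > 0, ∀ᶠ n in atTop, v (w (s n)).2 < v z + ε := fun ε hε =>
    (tendsto_nhdsWithin_iff.2 ⟨hb, Eventually.of_forall fun n => (hw (s n)).2⟩).eventually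
      (hv z (hsub hz) (v z + ε) (by linarith))
  have hnn' : ∀ n, 0 ≤ u (w n).1 + v (w n).2 := fun n => le_trans (by positivity) (hnn n)
  have hz0 : u z + v z = 0 := by
    refine le_antisymm (hle z hz) (le_of_forall_pos_lt_add fun ε hε => ?_)
    obtain ⟨n, h1, h2⟩ := ((hua (ε / 2) (by positivity)).and (hvb (ε / 2) (by positivity))).exists
    linarith [hnn' (s n)]
  -- Each term is asymptotically at most its limit by semicontinuity, while the sum is nonnegative
  -- and the limits add up to zero; so each term converges.
  have htu : Tendsto (fun n => u (w (s n)).1) atTop (𝓝 (u z)) := by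
    refine Metric.tendsto_nhds.2 fun ε hε => ?_
    filter_upwards [hua ε hε, hvb ε hε] with n h1 h2
    rw [Real.dist_eq, abs_lt]
    constructor <;> linarith [hnn' (s n)]
  have htv : Tendsto (fun n => v (w (s n)).2) atTop (𝓝 (v z)) := by
    refine Metric.tendsto_nhds.2 fun ε hε => ?_
    filter_upwards [hua ε hε, hvb ε hε] with n h1 h2
    rw [Real.dist_eq, abs_lt]
    constructor <;> linarith [hnn' (s n)]
  refine ⟨fun n => (w (s n)).1, fun n => (w (s n)).2, fun n => (s n : ℝ) + 1, z, hz,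
    fun n => (hw _).1, fun n => (hw _).2, fun n => by positivity, fun n x hx y hy => ?_, hz0,
    hlim, hb, htu, htv, ?_⟩
  · have := hmax (s n) (⟨hx, hy⟩ : (x, y) ∈ K₁ ×ˢ K₂)
    simp only [mem_ofPred_eq] at this
    linarith
  · have h1 : Tendsto (fun n => ((s n : ℝ) + 1) * ‖(w (s n)).1 - (w (s n)).2‖ ^ 2) atTop (𝓝 0) := by
      have h2 : Tendsto (fun n => 2 * (u (w (s n)).1 + v (w (s n)).2)) atTop (𝓝 0) := by
        have := (htu.add htv).const_mul 2
        rwa [hz0, mul_zero] at this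
      refine squeeze_zero (fun n => by positivity) (fun n => ?_) h2
      linarith [hnn (s n)]
    simpa using h1.add hdist

/-- A positive supersolution of `F[φ] ≥ l φ^α` with `l > 0` in a neighbourhood of `closure Ω`
forces the maximum principle. -/
theorem maximumPrinciple_of_supersolution {O Ω Ω' : Set (Space N)} {F : Operator N} {α l : ℝ}
    {φ : Space N → ℝ} (hΩ_bdd : Bornology.IsBounded Ω)
    (hα : 0 < α) (hF : IsContinuousOperator O F)
    (hF2 : IsPosHomogeneous O F α) (hF3 : IsContinuousInValueUniformly O F)
    (hF4 : StructureCondition O F) (hl : 0 < l) (hΩ' : IsOpen Ω') (hΩΩ' : closure Ω ⊆ Ω')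
    (hΩ'O : Ω' ⊆ O) (hφ : LowerSemicontinuousOn φ Ω') (hpos : ∀ x ∈ Ω', 0 < φ x)
    (hsuper : IsSupersolution (fun x r p X => F x r p X - l * r ^ α) Ω' φ) :
    MaximumPrinciple F Ω := by
  intro u hu hsub x₁ hx₁
  by_contra! hu₁
  set K := closure Ω with hKdef
  have hK : IsCompact K := hΩ_bdd.isCompact_closure
  -- The variable of the supersolution ranges over this compact neighbourhood. Near the limit point
  -- `z ∈ K` it is interior, so maxima over `K'` are genuine local extrema.
  obtain ⟨ρ, hρ, hρΩ'⟩ := hK.exists_cthickening_subset_open hΩ' hΩΩ'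
  set K' := Metric.cthickening ρ K with hK'def
  have hK' : IsCompact K' := hK.cthickening
  have hKK' : K ⊆ K' := Metric.self_subset_cthickening K
  obtain ⟨x₀, hx₀, hmax₀⟩ := UpperSemicontinuousOn.exists_isMaxOn ⟨x₁, hx₁⟩ hK
    (upperSemicontinuousOn_posPart_div hu (hφ.mono hΩΩ') fun x hx => hpos x (hΩΩ' hx))
  -- The largest value of `u⁺ / φ`, so that `t * φ` touches `u` from above on `K`, with contact at
  -- `x₀`.
  set t := max (u x₀) 0 / φ x₀ with ht
  have htpos : 0 < t := by
    have h1 : max (u x₁) 0 / φ x₁ ≤ t := hmax₀ hx₁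
    refine lt_of_lt_of_le (div_pos ?_ (hpos x₁ (hΩΩ' hx₁))) h1
    exact lt_max_of_lt_left hu₁
  have hsuper' := hsuper.const_mul hF2 hΩ'O hpos htpos
  set v : Space N → ℝ := fun x => -(t * φ x) with hv
  have hvusc : UpperSemicontinuousOn v K' := by
    intro x hx y hy
    have h1 : -y / t < φ x := by
      rw [div_lt_iff₀ htpos]
      have : -(t * φ x) < y := hy
      linarith
    filter_upwards [(hφ.mono hρΩ') x hx _ h1] with w hw
    have hw := (div_lt_iff₀ htpos).1 hw
    simp only [hv]
    linarith
  have hle : ∀ x ∈ K, u x + v x ≤ 0 := by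
    intro x hx
    have h1 : max (u x) 0 / φ x ≤ t := hmax₀ hx
    rw [div_le_iff₀ (hpos x (hΩΩ' hx))] at h1
    have := le_max_left (u x) 0
    simp only [hv]
    linarith
  have hux₀ : 0 < u x₀ := by
    by_contra! hcon
    rw [ht, max_eq_right hcon, zero_div] at htpos
    exact lt_irrefl _ htpos
  have heq : u x₀ + v x₀ = 0 := by
    have h1 : t * φ x₀ = u x₀ := by
      rw [ht, max_eq_left hux₀.le, div_mul_cancel₀ _ (hpos x₀ (hΩΩ' hx₀)).ne']
    simp only [hv]
    linarith
  obtain ⟨a, b, σ, z, hz, ha, hb, hσ, hmax, hz0, hta, htb, htu, htv, htσ⟩ :=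
    exists_doubling_sequence hK hK' hKK' hu hvusc hle hx₀ heq
  set r := u z with hr
  have hvz : v z = -r := by linarith
  have hr0 : 0 < r := by
    have : 0 < t * φ z := mul_pos htpos (hpos z (hΩΩ' hz))
    simp only [hv] at hvz
    linarith
  set c := l * r ^ α with hc
  have hc0 : 0 < c := mul_pos hl (Real.rpow_pos_of_pos hr0 α)
  obtain ⟨δ, hδ, hF3'⟩ := hF3 r (c / 4) (by positivity)
  obtain ⟨ω, hωc, hω0, hω⟩ := hF4 r hr0
  have hωlim : Tendsto (fun n => ω (σ n * ‖a n - b n‖ ^ 2 + ‖a n - b n‖)) atTop (𝓝 0) := by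
    have h1 := hωc 0 self_mem_Ici
    rw [ContinuousWithinAt, hω0] at h1
    refine h1.comp (tendsto_nhdsWithin_iff.2 ⟨htσ, Eventually.of_forall fun n => ?_⟩)
    have := hσ n
    rw [mem_Ici]
    positivity
  have hpow : Tendsto (fun n => l * (-v (b n)) ^ α) atTop (𝓝 c) := by
    have h1 : Tendsto (fun n => -v (b n)) atTop (𝓝 r) := by
      have := htv.neg
      rwa [hvz, neg_neg] at this
    exact (((Real.continuous_rpow_const hα.le).tendsto r).comp h1).const_mul l
  -- Each of the two changes of the value argument to `r` and the modulus `ω` costs less than `c /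
  -- 4`, while the zero order term exceeds `3 * c / 4`; this is the final contradiction.
  obtain ⟨n, ⟨⟨⟨⟨e1, e2⟩, e3⟩, e4⟩, e5⟩, e6⟩ :=
    ((((((Metric.tendsto_nhds.1 htu δ hδ).and (Metric.tendsto_nhds.1 htv δ hδ)).and
      (hωlim.eventually_lt_const (show (0 : ℝ) < c / 4 by positivity))).and
      (hpow.eventually_const_lt (show 3 * c / 4 < c by linarith))).and
      (htu.eventually_const_lt hr0)).and
      (Metric.tendsto_nhds.1 htb (ρ / 2) (by positivity))).exists
  obtain ⟨X, Y, hX, hY, hXY, hjX, hjY⟩ :=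
    exists_closureJets hK hK' hu hvusc (ha n) (hb n) (hσ n) (hmax n)
  set p := σ n • (a n - b n) with hp
  have hFa : F (a n) (u (a n)) p X ≤ 0 := by
    refine hjX.operator_nonpos hF (hΩΩ'.trans hΩ'O) hK hu e5 one_pos ?_
    intro ξ hξ huξ _ χ hχ hχmax
    obtain ⟨h1, h2⟩ := hsub χ hχ ξ hξ hχmax
    by_cases hξΩ : ξ ∈ Ω
    · exact h1 hξΩ
    · have hfr : ξ ∈ frontier Ω := ⟨hξ, fun hi => hξΩ (interior_subset hi)⟩
      have h3 := h2 hfr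
      rcases min_le_iff.1 h3 with h4 | h4
      · exact absurd h4 (not_le.2 huξ)
      · exact h4
  have hFb : l * (-v (b n)) ^ α ≤ F (b n) (-v (b n)) p Y := by
    -- Reflecting all arguments turns the supersolution `t * φ` into the subsolution `v` of `F'`, so
    -- the superjet lemma serves for both functions.
    set F' : Operator N := fun x s q Z => -(F x (-s) (-q) (-Z) - l * (-s) ^ α) with hF'
    have hF'c : IsContinuousOperator O F' := by
      rintro ⟨x, s, q, Z⟩ ⟨hx, hZ⟩
      have h1 : Tendsto (fun w : Space N × ℝ × Space N × Mat N => w)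
          (𝓝[{q | q.1 ∈ O ∧ q.2.2.2.IsSymm}] (x, s, q, Z)) (𝓝 (x, s, q, Z)) :=
        nhdsWithin_le_nhds
      have hmem := self_mem_nhdsWithin (a := (x, s, q, Z))
        (s := {q : Space N × ℝ × Space N × Mat N | q.1 ∈ O ∧ q.2.2.2.IsSymm})
      have h2 := hF.tendsto (X := -Z) hx hZ.neg h1.fst_nhds h1.snd_nhds.fst_nhds.neg
        h1.snd_nhds.snd_nhds.fst_nhds.neg h1.snd_nhds.snd_nhds.snd_nhds.neg
        (by filter_upwards [hmem] with w hw using hw.1)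
        (by filter_upwards [hmem] with w hw using hw.2.neg)
      have h3 := (((Real.continuous_rpow_const hα.le).tendsto (-s)).comp
        h1.snd_nhds.fst_nhds.neg).const_mul l
      exact (h2.sub h3).neg
    have h4 := hjY.operator_nonpos hF'c (hρΩ'.trans hΩ'O) hK' hvusc
      (c := v (b n) - 1) (by linarith) (ρ := ρ / 2) (by positivity) ?_
    · simp only [hF', neg_neg] at h4
      linarith
    intro ξ hξ _ hdist χ hχ hχmax
    have hnhds : K' ∈ 𝓝 ξ := by
      have hth : ξ ∈ Metric.thickening ρ K := by
        refine Metric.mem_thickening_iff.2 ⟨z, hz, ?_⟩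
        calc dist ξ z ≤ dist ξ (b n) + dist (b n) z := dist_triangle _ _ _
          _ < ρ := by linarith
      exact mem_of_superset (Metric.isOpen_thickening.mem_nhds hth)
        (Metric.thickening_subset_cthickening ρ K)
    have hlmin : IsLocalMin (fun x => t * φ x - (-1) * χ x) ξ := by
      filter_upwards [hnhds] with x hx
      have := hχmax hx
      simp only [mem_ofPred_eq, hv] at this
      linarith
    have h5 := hsuper' (fun x => (-1) * χ x) (contDiff_const.mul hχ) ξ (hρΩ' hξ) hlmin
    rw [gradient_const_mul hχ, hessian_const_mul hχ, neg_one_smul, neg_one_smul] at h5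
    simp only [hF', hv, neg_neg]
    linarith
  have hbO : b n ∈ O := hΩ'O (hρΩ' (hb n))
  have haO : a n ∈ O := hΩ'O (hΩΩ' (ha n))
  have g1 := hω X Y hX hY (σ n) (hσ n) hXY (a n) haO (b n) hbO r (by rw [abs_of_pos hr0])
  have g2 := hF3' (u (a n)) (by rwa [Real.dist_eq] at e1) (a n) haO p X hX
  have g3 := hF3' (-v (b n)) (by
    rw [Real.dist_eq, hvz, ← abs_neg] at e2
    convert e2 using 2
    ring) (b n) hbO p Y hY
  rw [abs_lt] at g2 g3
  linarith [g2.1, g2.2, g3.1, g3.2]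

/-! ### Stability of test points -/

/-- If the functions `w n` are asymptotically below `φ - φ ξ + L` near `ξ` and approach the value
`L` at `ξ`, then the perturbed test function `φ + |· - ξ|⁴` touches them at nearby points. -/
lemma exists_test_points {ξ : Space N} {φ : Space N → ℝ} (hφ : Continuous φ) {L r : ℝ}
    (hr : 0 < r) {K : ℕ → Set (Space N)} (hK : ∀ n, IsCompact (K n)) {w : ℕ → Space N → ℝ}
    (hw : ∀ n, UpperSemicontinuousOn (w n) (K n)) {x : ℕ → Space N} (hx : ∀ n, x n ∈ K n)
    (hxξ : Tendsto x atTop (𝓝 ξ)) (hwx : Tendsto (fun n => w n (x n)) atTop (𝓝 L))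
    (hup : ∀ ε > 0, ∀ᶠ n in atTop, ∀ y ∈ K n, dist y ξ ≤ r → w n y ≤ φ y - φ ξ + L + ε) :
    ∃ y : ℕ → Space N, (∀ᶠ n in atTop, y n ∈ K n ∧
      IsLocalMaxOn (fun z => w n z - (φ z + ‖z - ξ‖ ^ 4)) (K n) (y n)) ∧
      Tendsto y atTop (𝓝 ξ) ∧ Tendsto (fun n => w n (y n)) atTop (𝓝 L) := by
  set χ : Space N → ℝ := fun z => φ z + ‖z - ξ‖ ^ 4 with hχ
  have hχc : Continuous χ := by fun_prop
  have hex : ∀ n, ∃ y, dist (x n) ξ ≤ r → y ∈ K n ∩ Metric.closedBall ξ r ∧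
      IsMaxOn (fun z => w n z - χ z) (K n ∩ Metric.closedBall ξ r) y := by
    intro n
    by_cases h : dist (x n) ξ ≤ r
    · have husc : UpperSemicontinuousOn (fun z => w n z + -χ z) (K n ∩ Metric.closedBall ξ r) :=
        ((hw n).mono inter_subset_left).add hχc.neg.continuousOn.upperSemicontinuousOn
      have hne : (K n ∩ Metric.closedBall ξ r).Nonempty := ⟨x n, hx n, h⟩
      obtain ⟨y, hy, hmax⟩ := UpperSemicontinuousOn.exists_isMaxOn hne
        ((hK n).inter_right Metric.isClosed_closedBall) husc
      exact ⟨y, fun _ => ⟨hy, by simpa [sub_eq_add_neg] using hmax⟩⟩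
    · exact ⟨0, fun h' => absurd h' h⟩
  choose y hy using hex
  have hball : ∀ᶠ n in atTop, dist (x n) ξ ≤ r :=
    (Metric.tendsto_nhds.1 hxξ r hr).mono fun _ h => h.le
  have hχx : Tendsto (fun n => w n (x n) - χ (x n)) atTop (𝓝 (L - φ ξ)) := by
    have h1 : Tendsto (fun n => χ (x n)) atTop (𝓝 (χ ξ)) := (hχc.tendsto ξ).comp hxξ
    have h2 : χ ξ = φ ξ := by simp [hχ]
    rw [h2] at h1
    exact hwx.sub h1
  have hlow : ∀ ε > 0, ∀ᶠ n in atTop, L - φ ξ - ε < w n (y n) - χ (y n) := by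
    intro ε hε
    filter_upwards [hball, hχx.eventually_const_lt (show L - φ ξ - ε < L - φ ξ by linarith)]
      with n h1 h2
    have := (hy n h1).2 ⟨hx n, h1⟩
    simp only [mem_ofPred_eq] at this
    linarith
  have hupy : ∀ ε > 0, ∀ᶠ n in atTop, w n (y n) ≤ φ (y n) - φ ξ + L + ε := by
    intro ε hε
    filter_upwards [hball, hup ε hε] with n h1 h2
    exact h2 _ (hy n h1).1.1 (hy n h1).1.2
  -- The maximum is asymptotically at least `L - φ ξ`, whereas `hup` caps it by that value minus the
  -- quartic; hence the quartic tends to zero.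
  have hyξ : Tendsto y atTop (𝓝 ξ) := by
    refine Metric.tendsto_nhds.2 fun ε hε => ?_
    filter_upwards [hlow (ε ^ 4 / 2) (by positivity), hupy (ε ^ 4 / 2) (by positivity)]
      with n h1 h2
    simp only [hχ] at h1
    have h3 : ‖y n - ξ‖ ^ 4 < ε ^ 4 := by linarith
    rw [dist_eq_norm]
    exact lt_of_pow_lt_pow_left₀ 4 hε.le h3
  refine ⟨y, ?_, hyξ, ?_⟩
  · filter_upwards [hball, Metric.tendsto_nhds.1 hyξ r hr] with n h1 h2
    refine ⟨(hy n h1).1.1, ?_⟩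
    filter_upwards [self_mem_nhdsWithin, mem_nhdsWithin_of_mem_nhds
      (Metric.isOpen_ball.mem_nhds (show y n ∈ Metric.ball ξ r from h2))] with z hz1 hz2
    exact (hy n h1).2 ⟨hz1, Metric.ball_subset_closedBall hz2⟩
  · have hχy : Tendsto (fun n => χ (y n)) atTop (𝓝 (φ ξ)) := by
      have h1 : Tendsto (fun n => χ (y n)) atTop (𝓝 (χ ξ)) := (hχc.tendsto ξ).comp hyξ
      have h2 : χ ξ = φ ξ := by simp [hχ]
      rwa [h2] at h1
    have hφy : Tendsto (fun n => φ (y n)) atTop (𝓝 (φ ξ)) := (hφ.tendsto ξ).comp hyξ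
    refine Metric.tendsto_nhds.2 fun ε hε => ?_
    filter_upwards [hlow (ε / 2) (by positivity), hupy (ε / 2) (by positivity),
      Metric.tendsto_nhds.1 hχy (ε / 2) (by positivity),
      Metric.tendsto_nhds.1 hφy (ε / 2) (by positivity)] with n h1 h2 h3 h4
    rw [Real.dist_eq, abs_lt] at *
    constructor <;> linarith [h3.1, h3.2, h4.1, h4.2]

lemma contDiff_add_pow_four {φ : Space N → ℝ} (hφ : ContDiff ℝ 2 φ) (ξ : Space N) :
    ContDiff ℝ 2 fun z => φ z + ‖z - ξ‖ ^ 4 :=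
  hφ.add (contDiff_norm_sub_pow_four ξ)

/-- The operator evaluated at the perturbed test function converges. -/
lemma IsContinuousOperator.tendsto_test {O : Set (Space N)} {F : Operator N}
    (hF : IsContinuousOperator O F) {φ : Space N → ℝ} (hφ : ContDiff ℝ 2 φ) {ξ : Space N}
    (hξ : ξ ∈ O) {y : ℕ → Space N} {s : ℕ → ℝ} {L : ℝ} (hy : Tendsto y atTop (𝓝 ξ))
    (hs : Tendsto s atTop (𝓝 L)) (hyO : ∀ᶠ n in atTop, y n ∈ O) :
    Tendsto (fun n => F (y n) (s n) (gradient (fun z => φ z + ‖z - ξ‖ ^ 4) (y n))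
      (hessian (fun z => φ z + ‖z - ξ‖ ^ 4) (y n))) atTop
      (𝓝 (F ξ L (gradient φ ξ) (hessian φ ξ))) := by
  have hχ := contDiff_add_pow_four hφ ξ
  have e1 : gradient (fun z => φ z + ‖z - ξ‖ ^ 4) ξ = gradient φ ξ := by
    rw [gradient_add hφ (contDiff_norm_sub_pow_four ξ), gradient_norm_sub_pow_four, add_zero]
  have e2 : hessian (fun z => φ z + ‖z - ξ‖ ^ 4) ξ = hessian φ ξ := by
    rw [hessian_add hφ (contDiff_norm_sub_pow_four ξ), hessian_norm_sub_pow_four, add_zero]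
  have t1 := ((continuous_gradient hχ).tendsto ξ).comp hy
  have t2 := ((continuous_hessian hχ).tendsto ξ).comp hy
  rw [e1] at t1
  rw [e2] at t2
  exact hF.tendsto hξ (hessian_isSymm hφ ξ) hy hs t1 t2 hyO
    (Eventually.of_forall fun n => hessian_isSymm hχ _)

/-! ### Half-relaxed upper limits -/

/-- The filter of pairs `(n, y)` with `n → ∞`, `y → x` and `y ∈ K n`. -/
def relFilter (K : ℕ → Set (Space N)) (x : Space N) : Filter (ℕ × Space N) :=
  (atTop ×ˢ 𝓝 x) ⊓ 𝓟 {q | q.2 ∈ K q.1}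

/-- The half-relaxed upper limit of the functions `w n` on `K n`. -/
noncomputable def relLimsup (K : ℕ → Set (Space N)) (w : ℕ → Space N → ℝ) (x : Space N) : ℝ :=
  limsup (fun q : ℕ × Space N => w q.1 q.2) (relFilter K x)

lemma tendsto_relFilter {K : ℕ → Set (Space N)} {x : Space N} {m : ℕ → ℕ} {y : ℕ → Space N}
    (hm : Tendsto m atTop atTop) (hy : Tendsto y atTop (𝓝 x)) (hK : ∀ j, y j ∈ K (m j)) :
    Tendsto (fun j => (m j, y j)) atTop (relFilter K x) :=
  tendsto_inf.2 ⟨hm.prodMk hy, tendsto_principal.2 (Eventually.of_forall hK)⟩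

section RelLimsup

variable {K : ℕ → Set (Space N)} {w : ℕ → Space N → ℝ} {S : Set (Space N)} {m M : ℝ}

lemma relFilter_neBot {x : Space N} (hx : ∀ n, x ∈ K n) : (relFilter K x).NeBot :=
  (tendsto_relFilter tendsto_id tendsto_const_nhds hx).neBot

lemma eventually_relFilter_mem (K : ℕ → Set (Space N)) (x : Space N) :
    ∀ᶠ q in relFilter K x, q.2 ∈ K q.1 :=
  mem_inf_of_right (mem_principal_self _)

lemma relLimsup_isBoundedUnder (hM : ∀ n, ∀ y ∈ K n, w n y ≤ M) (x : Space N) :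
    IsBoundedUnder (· ≤ ·) (relFilter K x) fun q : ℕ × Space N => w q.1 q.2 :=
  isBoundedUnder_of_eventually_le ((eventually_relFilter_mem K x).mono fun _ hq => hM _ _ hq)

lemma relLimsup_isCoboundedUnder (hm : ∀ n, ∀ y ∈ K n, m ≤ w n y) {x : Space N}
    (hx : ∀ n, x ∈ K n) :
    IsCoboundedUnder (· ≤ ·) (relFilter K x) fun q : ℕ × Space N => w q.1 q.2 := by
  have := relFilter_neBot hx
  exact IsBoundedUnder.isCoboundedUnder_le
    (isBoundedUnder_of_eventually_ge ((eventually_relFilter_mem K x).mono fun q hq => hm _ _ hq))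

lemma le_relLimsup_of_seq (hM : ∀ n, ∀ y ∈ K n, w n y ≤ M) {x : Space N} {i : ℕ → ℕ}
    {y : ℕ → Space N} (hi : Tendsto i atTop atTop) (hy : Tendsto y atTop (𝓝 x))
    (hK : ∀ j, y j ∈ K (i j)) {c : ℝ} (hc : ∀ᶠ j in atTop, c ≤ w (i j) (y j)) :
    c ≤ relLimsup K w x := by
  by_contra! hlt
  have h1 := eventually_lt_of_limsup_lt hlt (relLimsup_isBoundedUnder hM x)
  have h2 := (tendsto_relFilter hi hy hK).eventually h1
  obtain ⟨j, h3, h4⟩ := (h2.and hc).exists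
  exact absurd h3 (not_lt.2 h4)

lemma le_relLimsup (hm : ∀ n, ∀ y ∈ K n, m ≤ w n y) (hM : ∀ n, ∀ y ∈ K n, w n y ≤ M)
    {x : Space N} (hx : ∀ n, x ∈ K n) : m ≤ relLimsup K w x :=
  le_relLimsup_of_seq hM tendsto_id tendsto_const_nhds hx
    (Eventually.of_forall fun n => hm n x (hx n))

lemma relLimsup_le (hm : ∀ n, ∀ y ∈ K n, m ≤ w n y) (hM : ∀ n, ∀ y ∈ K n, w n y ≤ M)
    {x : Space N} (hx : ∀ n, x ∈ K n) : relLimsup K w x ≤ M :=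
  limsup_le_of_le (relLimsup_isCoboundedUnder hm hx)
    ((eventually_relFilter_mem K x).mono fun _ hq => hM _ _ hq)

lemma upperSemicontinuousOn_relLimsup (hm : ∀ n, ∀ y ∈ K n, m ≤ w n y)
    (hM : ∀ n, ∀ y ∈ K n, w n y ≤ M) (hS : ∀ n, S ⊆ K n) :
    UpperSemicontinuousOn (relLimsup K w) S := by
  intro x hx a ha
  obtain ⟨b, hb1, hb2⟩ := exists_between ha
  have h1 := eventually_lt_of_limsup_lt hb1 (relLimsup_isBoundedUnder hM x)
  rw [relFilter, eventually_inf_principal] at h1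
  obtain ⟨A, hA, B, hB, hAB⟩ := mem_prod_iff.1 h1
  have hB' : ∀ᶠ y in 𝓝 x, ∀ᶠ z in 𝓝 y, z ∈ B := eventually_eventually_nhds.2 hB
  filter_upwards [mem_nhdsWithin_of_mem_nhds hB', self_mem_nhdsWithin] with y hy hyS
  refine lt_of_le_of_lt (limsup_le_of_le (relLimsup_isCoboundedUnder hm fun n => hS n hyS) ?_) hb2
  rw [relFilter, eventually_inf_principal]
  filter_upwards [prod_mem_prod hA hy] with q hq hqK
  exact (hAB hq hqK).le

lemma exists_seq_tendsto_relLimsup (hm : ∀ n, ∀ y ∈ K n, m ≤ w n y)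
    (hM : ∀ n, ∀ y ∈ K n, w n y ≤ M) {x : Space N} (hx : ∀ n, x ∈ K n) :
    ∃ (i : ℕ → ℕ) (y : ℕ → Space N), Tendsto i atTop atTop ∧ Tendsto y atTop (𝓝 x) ∧
      (∀ j, y j ∈ K (i j)) ∧ Tendsto (fun j => w (i j) (y j)) atTop (𝓝 (relLimsup K w x)) := by
  have hne := relFilter_neBot hx
  have : (relFilter K x).IsCountablyGenerated := by unfold relFilter; infer_instance
  obtain ⟨q, hq1, hq2⟩ := exists_seq_tendsto_limsup
    (relLimsup_isCoboundedUnder hm hx) (relLimsup_isBoundedUnder hM x)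
  have hq3 := tendsto_inf.1 hq2
  obtain ⟨n₀, hn₀⟩ := eventually_atTop.1 (tendsto_principal.1 hq3.2)
  have hs : Tendsto (fun j => j + n₀) atTop atTop := tendsto_add_atTop_nat n₀
  refine ⟨fun j => (q (j + n₀)).1, fun j => (q (j + n₀)).2, ?_, ?_, fun j => hn₀ _ (by omega),
    hq1.comp hs⟩
  · exact (tendsto_fst.comp hq3.1).comp hs
  · exact (tendsto_snd.comp hq3.1).comp hs

end RelLimsup

/-! ### Perron's method with an obstacle -/

/-- Upper semicontinuous functions `w : K → [m, M]` that are viscosity subsolutions of `G[w] = 0`,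
up to the boundary of `K`, at the points where they exceed `m`. -/
structure IsObstacleSubsolution (G : Operator N) (K : Set (Space N)) (m M : ℝ)
    (w : Space N → ℝ) : Prop where
  usc : UpperSemicontinuousOn w K
  ge : ∀ x ∈ K, m ≤ w x
  le : ∀ x ∈ K, w x ≤ M
  test : ∀ φ : Space N → ℝ, ContDiff ℝ 2 φ → ∀ ξ ∈ K, IsLocalMaxOn (fun x => w x - φ x) K ξ →
    m < w ξ → G ξ (w ξ) (gradient φ ξ) (hessian φ ξ) ≤ 0

lemma isObstacleSubsolution_const (G : Operator N) (K : Set (Space N)) {m M : ℝ} (h : m ≤ M) :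
    IsObstacleSubsolution G K m M fun _ => m where
  usc := continuousOn_const.upperSemicontinuousOn
  ge _ _ := le_rfl
  le _ _ := h
  test _ _ _ _ _ h := absurd h (lt_irrefl _)

/-- There is a greatest obstacle subsolution. -/
theorem exists_greatest_obstacleSubsolution {O K : Set (Space N)} {G : Operator N}
    (hG : IsContinuousOperator O G) (hK : IsCompact K) (hKO : K ⊆ O) {m M : ℝ} (hmM : m ≤ M) :
    ∃ v, IsObstacleSubsolution G K m M v ∧
      ∀ w, IsObstacleSubsolution G K m M w → ∀ x ∈ K, w x ≤ v x := by
  set v₀ : Space N → ℝ := fun x => sSup {s | ∃ w, IsObstacleSubsolution G K m M w ∧ s = w x}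
    with hv₀
  have hbdd : ∀ x ∈ K, BddAbove {s | ∃ w, IsObstacleSubsolution G K m M w ∧ s = w x} := by
    rintro x hx
    refine ⟨M, ?_⟩
    rintro _ ⟨w, hw, rfl⟩
    exact hw.le x hx
  have hne : ∀ x, {s | ∃ w, IsObstacleSubsolution G K m M w ∧ s = w x}.Nonempty := fun x =>
    ⟨m, _, isObstacleSubsolution_const G K hmM, rfl⟩
  have hle₀ : ∀ w, IsObstacleSubsolution G K m M w → ∀ x ∈ K, w x ≤ v₀ x := fun w hw x hx =>
    le_csSup (hbdd x hx) ⟨w, hw, rfl⟩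
  have hm₀ : ∀ x ∈ K, m ≤ v₀ x := hle₀ _ (isObstacleSubsolution_const G K hmM)
  have hM₀ : ∀ x ∈ K, v₀ x ≤ M := by
    intro x hx
    refine csSup_le (hne x) ?_
    rintro _ ⟨w, hw, rfl⟩
    exact hw.le x hx
  -- For a constant sequence the half-relaxed limit is the upper semicontinuous envelope on `K`. It
  -- is again a member of the family, so the supremum is attained.
  set v := relLimsup (fun _ => K) (fun _ => v₀) with hv
  have hle : ∀ x ∈ K, v₀ x ≤ v x := fun x hx =>
    le_relLimsup_of_seq (fun _ => hM₀) tendsto_id tendsto_const_nhds (fun _ => hx)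
      (Eventually.of_forall fun _ => le_rfl)
  refine ⟨v, ⟨?_, ?_, ?_, ?_⟩, fun w hw x hx => (hle₀ w hw x hx).trans (hle x hx)⟩
  · exact upperSemicontinuousOn_relLimsup (fun _ => hm₀) (fun _ => hM₀) fun _ => Subset.rfl
  · exact fun x hx => le_relLimsup (fun _ => hm₀) (fun _ => hM₀) fun _ => hx
  · exact fun x hx => relLimsup_le (fun _ => hm₀) (fun _ => hM₀) fun _ => hx
  intro φ hφ ξ hξ hloc hmξ
  obtain ⟨r, hr, hball⟩ := Metric.mem_nhdsWithin_iff.1 hloc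
  obtain ⟨i, x, -, hxξ, hxK, hlim⟩ := exists_seq_tendsto_relLimsup (K := fun _ => K)
    (w := fun _ => v₀) (fun _ => hm₀) (fun _ => hM₀) (x := ξ) fun _ => hξ
  have hw : ∀ n : ℕ, ∃ w, IsObstacleSubsolution G K m M w ∧ v₀ (x n) - 1 / ((n : ℝ) + 1) < w (x n) := by
    intro n
    obtain ⟨_, ⟨w, hw, rfl⟩, h⟩ := exists_lt_of_lt_csSup (hne (x n))
      (show v₀ (x n) - 1 / ((n : ℝ) + 1) < v₀ (x n) by
        have := Nat.one_div_pos_of_nat (α := ℝ) (n := n)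
        linarith)
    exact ⟨w, hw, h⟩
  choose w hwS hwx using hw
  have hwlim : Tendsto (fun n => w n (x n)) atTop (𝓝 (v ξ)) := by
    have h1 : Tendsto (fun n : ℕ => v₀ (x n) - 1 / ((n : ℝ) + 1)) atTop (𝓝 (v ξ)) := by
      have := hlim.sub (tendsto_one_div_add_atTop_nhds_zero_nat (𝕜 := ℝ))
      rwa [sub_zero] at this
    exact tendsto_of_tendsto_of_tendsto_of_le_of_le h1 hlim (fun n => (hwx n).le)
      fun n => hle₀ _ (hwS n) _ (hxK n)
  obtain ⟨y, hy, hyξ, hwy⟩ := exists_test_points hφ.continuous (half_pos hr)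
    (fun _ => hK) (fun n => (hwS n).usc) hxK hxξ hwlim (by
      intro ε hε
      refine Eventually.of_forall fun n y hy hd => ?_
      have h1 : v y - φ y ≤ v ξ - φ ξ := hball ⟨by rw [Metric.mem_ball]; linarith, hy⟩
      have h2 := (hle₀ _ (hwS n) y hy).trans (hle y hy)
      linarith)
  refine le_of_tendsto (hG.tendsto_test hφ (hKO hξ) hyξ hwy (hy.mono fun n h => hKO h.1)) ?_
  filter_upwards [hy, hwy.eventually_const_lt hmξ] with n h1 h2
  exact (hwS n).test _ (contDiff_add_pow_four hφ ξ) _ h1.1 h1.2 h2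

/-- The lower semicontinuous envelope. -/
noncomputable def lscEnvelope (v : Space N → ℝ) (x : Space N) : ℝ := liminf v (𝓝 x)

section LscEnvelope

variable {U : Set (Space N)} {v : Space N → ℝ} {m M : ℝ}

lemma eventually_of_lt_lscEnvelope (hU : IsOpen U) (hm : ∀ x ∈ U, m ≤ v x) {x : Space N}
    (hx : x ∈ U) {a : ℝ} (ha : a < lscEnvelope v x) : ∀ᶠ y in 𝓝 x, a < v y :=
  eventually_lt_of_lt_liminf ha (isBoundedUnder_of_eventually_ge
    (by filter_upwards [hU.mem_nhds hx] with y hy using hm y hy))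

lemma le_lscEnvelope (hU : IsOpen U) (hM : ∀ x ∈ U, v x ≤ M) {x : Space N} (hx : x ∈ U) {a : ℝ}
    (ha : ∀ᶠ y in 𝓝 x, a ≤ v y) : a ≤ lscEnvelope v x :=
  le_liminf_of_le (IsBoundedUnder.isCoboundedUnder_ge (isBoundedUnder_of_eventually_le
    (by filter_upwards [hU.mem_nhds hx] with y hy using hM y hy))) ha

lemma lscEnvelope_le (hU : IsOpen U) (hm : ∀ x ∈ U, m ≤ v x) {x : Space N} (hx : x ∈ U) :
    lscEnvelope v x ≤ v x := by
  by_contra! h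
  exact lt_irrefl _ (eventually_of_lt_lscEnvelope hU hm hx h).self_of_nhds

lemma lowerSemicontinuousOn_lscEnvelope (hU : IsOpen U) (hm : ∀ x ∈ U, m ≤ v x)
    (hM : ∀ x ∈ U, v x ≤ M) : LowerSemicontinuousOn (lscEnvelope v) U := by
  intro x hx a ha
  obtain ⟨b, hb1, hb2⟩ := exists_between ha
  have h1 := eventually_eventually_nhds.2 (eventually_of_lt_lscEnvelope hU hm hx hb2)
  filter_upwards [mem_nhdsWithin_of_mem_nhds h1, self_mem_nhdsWithin] with y hy hyU
  exact lt_of_lt_of_le hb1 (le_lscEnvelope hU hM hyU (hy.mono fun _ h => h.le))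

end LscEnvelope

/-- Gluing a smooth strict subsolution into an obstacle subsolution. -/
lemma IsObstacleSubsolution.bump {O K : Set (Space N)} {G : Operator N} {m M : ℝ}
    {v χ : Space N → ℝ} (hG : IsDegenerateElliptic O G) (hKO : K ⊆ O)
    (hv : IsObstacleSubsolution G K m M v) (hχ : ContDiff ℝ 2 χ) {ξ : Space N} {r : ℝ}
    (hr : 0 < r) (hball : Metric.ball ξ r ⊆ K) (hχM : ∀ x ∈ Metric.ball ξ r, χ x ≤ M)
    (hχG : ∀ x ∈ Metric.ball ξ r, G x (χ x) (gradient χ x) (hessian χ x) ≤ 0)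
    (hχv : ∀ x ∈ Metric.ball ξ r, r / 2 ≤ dist x ξ → χ x ≤ v x) :
    IsObstacleSubsolution G K m M fun x => if dist x ξ < r then max (v x) (χ x) else v x := by
  set w : Space N → ℝ := fun x => if dist x ξ < r then max (v x) (χ x) else v x with hw
  have hw1 : ∀ x, dist x ξ < r → w x = max (v x) (χ x) := fun x hx => if_pos hx
  have hw2 : ∀ x, ¬ dist x ξ < r → w x = v x := fun x hx => if_neg hx
  have hvw : ∀ x, v x ≤ w x := by
    intro x
    by_cases h : dist x ξ < r
    · rw [hw1 x h]; exact le_max_left _ _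
    · rw [hw2 x h]
  -- The overlap on the outer annulus makes `w` agree with `v` near the sphere of radius `r`, so
  -- gluing creates no jump.
  have hw3 : ∀ x, r / 2 ≤ dist x ξ → w x = v x := by
    intro x hx
    by_cases h : dist x ξ < r
    · rw [hw1 x h, max_eq_left (hχv x h hx)]
    · exact hw2 x h
  refine ⟨?_, fun x hx => (hv.ge x hx).trans (hvw x), ?_, ?_⟩
  · intro x hx y hy
    by_cases h : dist x ξ < r
    · rw [hw1 x h, max_lt_iff] at hy
      filter_upwards [hv.usc x hx y hy.1,
        (hχ.continuous.continuousAt.eventually_lt_const hy.2).filter_mono nhdsWithin_le_nhds,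
        mem_nhdsWithin_of_mem_nhds (Metric.isOpen_ball.mem_nhds
          (show x ∈ Metric.ball ξ r from h))] with z h1 h2 h3
      rw [hw1 z h3]
      exact max_lt h1 h2
    · rw [hw2 x h] at hy
      have hfar : ∀ᶠ z in 𝓝 x, r / 2 < dist z ξ :=
        (continuous_id.dist continuous_const).continuousAt.eventually_const_lt (by
          simp only [id]; linarith)
      filter_upwards [hv.usc x hx y hy, hfar.filter_mono nhdsWithin_le_nhds] with z h1 h2
      rw [hw3 z h2.le]
      exact h1
  · intro x hx
    by_cases h : dist x ξ < r
    · rw [hw1 x h]; exact max_le (hv.le x hx) (hχM x h)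
    · rw [hw2 x h]; exact hv.le x hx
  · intro φ hφ x hx hloc hmx
    -- Where `w = v`, a test function for `w` also touches `v`. Elsewhere `w` equals the smooth `χ`
    -- and exceeds it nearby, so ellipticity compares the Hessians.
    by_cases hvx : w x = v x
    · rw [hvx] at hmx ⊢
      refine hv.test φ hφ x hx ?_ hmx
      filter_upwards [hloc] with z hz
      have := hvw z
      rw [hvx] at hz
      linarith
    · have hxr : dist x ξ < r := by
        by_contra h
        exact hvx (hw2 x h)
      have hwχ : w x = χ x := by
        rw [hw1 x hxr] at hvx ⊢
        rcases max_choice (v x) (χ x) with h | h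
        · exact absurd h hvx
        · exact h
      have hnb : Metric.ball ξ r ∈ 𝓝 x := Metric.isOpen_ball.mem_nhds hxr
      have hmin : IsLocalMin (fun z => φ z - χ z) x := by
        rw [IsLocalMaxOn, IsMaxFilter, nhdsWithin_eq_nhds.2 (mem_of_superset hnb hball)] at hloc
        filter_upwards [hloc, hnb] with z h1 h2
        have h3 : χ z ≤ w z := by rw [hw1 z h2]; exact le_max_right _ _
        rw [hwχ] at h1
        linarith
      obtain ⟨h1, h2⟩ := gradient_eq_and_posSemidef_of_isLocalMin hφ hχ hmin
      have h3 := hG x (hKO hx) (χ x) (gradient χ x) (hessian χ x) (hessian φ x - hessian χ x)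
        (hessian_isSymm hχ x) h2
      rw [add_sub_cancel] at h3
      rw [hwχ, h1]
      linarith [hχG x hxr]

/-- The lower envelope of the greatest obstacle subsolution is a supersolution unless the
upper bound is attained. -/
theorem isSupersolution_lscEnvelope {O K U : Set (Space N)} {G : Operator N} {m M : ℝ}
    {v : Space N → ℝ} (hG : IsContinuousOperator O G) (hG1 : IsDegenerateElliptic O G)
    (hKO : K ⊆ O) (hU : IsOpen U) (hUK : U ⊆ K)
    (hv : IsObstacleSubsolution G K m M v)
    (hmax : ∀ w, IsObstacleSubsolution G K m M w → ∀ x ∈ K, w x ≤ v x)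
    (hlt : ∀ x ∈ U, v x < M) : IsSupersolution G U (lscEnvelope v) := by
  intro ψ hψ ξ hξ hmin
  by_contra! hneg
  have hmU : ∀ x ∈ U, m ≤ v x := fun x hx => hv.ge x (hUK hx)
  have hMU : ∀ x ∈ U, v x ≤ M := fun x hx => hv.le x (hUK hx)
  set s := lscEnvelope v ξ with hs
  have hsM : s < M := (lscEnvelope_le hU hmU hξ).trans_lt (hlt ξ hξ)
  have hq : ContDiff ℝ 2 fun x : Space N => (-1) * ‖x - ξ‖ ^ 4 :=
    contDiff_const.mul (contDiff_norm_sub_pow_four ξ)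
  -- The quartic makes contact strict: raised by a small `δ`, `χ` still lies below `v` away from `ξ`
  -- but above the envelope at `ξ`.
  set χ : Space N → ℝ := fun x => ψ x + (-1) * ‖x - ξ‖ ^ 4 with hχ
  have hχ2 : ContDiff ℝ 2 χ := hψ.add hq
  have hgξ : gradient χ ξ = gradient ψ ξ := by
    rw [hχ, gradient_add hψ hq, gradient_const_mul (contDiff_norm_sub_pow_four ξ),
      gradient_norm_sub_pow_four, smul_zero, add_zero]
  have hhξ : hessian χ ξ = hessian ψ ξ := by
    rw [hχ, hessian_add hψ hq, hessian_const_mul (contDiff_norm_sub_pow_four ξ),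
      hessian_norm_sub_pow_four, smul_zero, add_zero]
  have hχξ : χ ξ = ψ ξ := by simp [hχ]
  have hUO : U ⊆ O := hUK.trans hKO
  have tx : Tendsto (fun q : Space N × ℝ => q.1) (𝓝 (ξ, 0)) (𝓝 ξ) := continuous_fst.tendsto _
  -- The second coordinate is the height of the raise. Taking limits jointly provides one radius on
  -- which the strict inequalities survive both moving the point and raising the function.
  have tr : Tendsto (fun q : Space N × ℝ => χ q.1 + (s - ψ ξ + q.2)) (𝓝 (ξ, 0)) (𝓝 s) := by
    have hc : Continuous fun q : Space N × ℝ => χ q.1 + (s - ψ ξ + q.2) := by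
      have := hχ2.continuous
      fun_prop
    have := hc.tendsto (ξ, 0)
    simpa [hχξ] using this
  have tg : Tendsto (fun q : Space N × ℝ => gradient χ q.1) (𝓝 (ξ, 0)) (𝓝 (gradient ψ ξ)) := by
    rw [← hgξ]
    exact ((continuous_gradient hχ2).comp continuous_fst).tendsto _
  have th : Tendsto (fun q : Space N × ℝ => hessian χ q.1) (𝓝 (ξ, 0)) (𝓝 (hessian ψ ξ)) := by
    rw [← hhξ]
    exact ((continuous_hessian hχ2).comp continuous_fst).tendsto _
  have hxU : ∀ᶠ q : Space N × ℝ in 𝓝 (ξ, 0), q.1 ∈ U := tx.eventually (hU.mem_nhds hξ)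
  have tG := hG.tendsto (hUO hξ) (hessian_isSymm hψ ξ) tx tr tg th (hxU.mono fun q h => hUO h)
    (Eventually.of_forall fun q => hessian_isSymm hχ2 _)
  have hev := ((tG.eventually_lt_const hneg).and (tr.eventually_lt_const hsM)).and
    (hxU.and (tx.eventually hmin))
  obtain ⟨r, hr, hprop⟩ := Metric.eventually_nhds_iff_ball.1 hev
  set δ := min (r / 2) ((r / 2) ^ 4 / 2) with hδ
  have hδ0 : 0 < δ := by positivity
  have hδr : δ < r := (min_le_left _ _).trans_lt (by linarith)
  have hδ4 : δ < (r / 2) ^ 4 := by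
    have h1 : 0 < (r / 2) ^ 4 := by positivity
    exact (min_le_right _ _).trans_lt (by linarith)
  have hprop' : ∀ x ∈ Metric.ball ξ r, (x, δ) ∈ Metric.ball ((ξ, 0) : Space N × ℝ) r := by
    intro x hx
    rw [Metric.mem_ball, Prod.dist_eq, max_lt_iff]
    refine ⟨hx, ?_⟩
    rw [Real.dist_eq, sub_zero, abs_of_pos hδ0]
    exact hδr
  set θ : Space N → ℝ := fun x => χ x + (s - ψ ξ + δ) with hθ
  have hθ2 : ContDiff ℝ 2 θ := hχ2.add contDiff_const
  have hgθ : ∀ x, gradient θ x = gradient χ x := fun x => by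
    rw [hθ, gradient_add hχ2 contDiff_const, gradient_const, add_zero]
  have hhθ : ∀ x, hessian θ x = hessian χ x := fun x => by
    rw [hθ, hessian_add hχ2 contDiff_const, hessian_const, add_zero]
  have hbump := hv.bump hG1 hKO hθ2 hr (ξ := ξ)
    (fun x hx => hUK (hprop _ (hprop' x hx)).2.1)
    (fun x hx => (hprop _ (hprop' x hx)).1.2.le)
    (fun x hx => by rw [hgθ, hhθ]; exact (hprop _ (hprop' x hx)).1.1.le)
    (fun x hx hxr => by
      obtain ⟨-, h1, h2⟩ := hprop _ (hprop' x hx)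
      have h3 := lscEnvelope_le hU hmU h1
      have h4 : (r / 2) ^ 4 ≤ ‖x - ξ‖ ^ 4 := by
        rw [← dist_eq_norm]; gcongr
      simp only [hθ, hχ] at h2 h3 ⊢
      linarith)
  -- Maximality of `v` against the glued function forces `v` above its own lower limit `s`
  -- throughout a neighbourhood of `ξ`.
  have hle : ∀ᶠ x in 𝓝 ξ, s + δ / 2 ≤ v x := by
    have hc : ∀ᶠ x in 𝓝 ξ, s + δ / 2 < θ x :=
      hθ2.continuous.continuousAt.eventually_const_lt (by
        simp only [hθ, hχξ]; linarith)
    filter_upwards [hc, Metric.ball_mem_nhds ξ hr, hU.mem_nhds hξ] with x h1 h2 h3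
    have h4 := hmax _ hbump x (hUK h3)
    rw [if_pos (show dist x ξ < r from h2)] at h4
    exact h1.le.trans ((le_max_right _ _).trans h4)
  have := le_lscEnvelope hU hMU hξ hle
  linarith

/-! ### The maximum principle implies positivity of the principal eigenvalue -/

lemma mem_of_tendsto_cthickening {K : Set (Space N)} (hK : IsClosed K) {d : ℕ → ℝ}
    {y : ℕ → Space N} {x : Space N} (hd : Tendsto d atTop (𝓝 0)) (hy : Tendsto y atTop (𝓝 x))
    (h : ∀ n, y n ∈ Metric.cthickening (d n) K) : x ∈ K := by
  rw [← hK.closure_eq, Metric.closure_eq_iInter_cthickening, mem_iInter₂]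
  intro ε hε
  refine Metric.isClosed_cthickening.mem_of_tendsto hy ?_
  filter_upwards [hd.eventually_lt_const hε] with n hn
  exact Metric.cthickening_mono hn.le K (h n)

/-- The operator `F[·] - l (·)^α`. -/
noncomputable def shiftedOperator (F : Operator N) (l α : ℝ) : Operator N :=
  fun x r p X => F x r p X - l * r ^ α

lemma isContinuousOperator_shifted {O : Set (Space N)} {F : Operator N}
    (hF : IsContinuousOperator O F) (l : ℝ) {α : ℝ} (hα : 0 < α) :
    IsContinuousOperator O (shiftedOperator F l α) := by
  have h : Continuous fun q : Space N × ℝ × Space N × Mat N => l * q.2.1 ^ α :=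
    continuous_const.mul ((Real.continuous_rpow_const hα.le).comp (by fun_prop))
  exact ContinuousOn.sub hF h.continuousOn

lemma isDegenerateElliptic_shifted {O : Set (Space N)} {F : Operator N}
    (hF : IsDegenerateElliptic O F) (l α : ℝ) :
    IsDegenerateElliptic O (shiftedOperator F l α) := by
  intro x hx r p X Y hX hY
  have := hF x hx r p X Y hX hY
  simp only [shiftedOperator]
  linarith

lemma operator_zero {O : Set (Space N)} {F : Operator N} {α : ℝ} (hα : 0 < α)
    (hF : IsPosHomogeneous O F α) {x : Space N} (hx : x ∈ O) : F x 0 0 0 = 0 := by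
  have := hF x hx 0 0 0 Matrix.isSymm_zero 0 le_rfl
  simpa [Real.zero_rpow hα.ne'] using this

/-- Half-relaxed limits of obstacle subsolutions with vanishing obstacles and vanishing zero order
perturbations, on sets shrinking to `closure Ω`, are subsolutions of the Dirichlet problem. -/
theorem isDirichletSubsolution_relLimsup {O Ω : Set (Space N)} {F : Operator N} {α : ℝ}
    (hα : 0 < α) (hΩ_open : IsOpen Ω) (hF : IsContinuousOperator O F)
    (hF1 : IsDegenerateElliptic O F) (hF2 : IsPosHomogeneous O F α) {K : ℕ → Set (Space N)}
    {d l : ℕ → ℝ} (hd : Tendsto d atTop (𝓝 0)) (hKc : ∀ n, IsCompact (K n))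
    (hKd : ∀ n, K n ⊆ Metric.cthickening (d n) (closure Ω)) (hΩK : ∀ n, closure Ω ⊆ K n)
    (hK0 : ∀ n, K n ⊆ K 0) (hKO : ∀ n, K n ⊆ O) (hl : Tendsto l atTop (𝓝 0)) (hl0 : ∀ n, 0 ≤ l n)
    {v : ℕ → Space N → ℝ}
    (hv : ∀ n, IsObstacleSubsolution (shiftedOperator F (l n) α) (K n) (l n) 1 (v n)) :
    IsDirichletSubsolution F Ω (relLimsup K v) := by
  have hm : ∀ n, ∀ y ∈ K n, 0 ≤ v n y := fun n y hy => (hl0 n).trans ((hv n).ge y hy)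
  have hM : ∀ n, ∀ y ∈ K n, v n y ≤ 1 := fun n y hy => (hv n).le y hy
  set u := relLimsup K v with hu
  have hu0 : ∀ x ∈ closure Ω, 0 ≤ u x := fun x hx => le_relLimsup hm hM fun n => hΩK n hx
  intro φ hφ ξ hξ hmax
  have hξO : ξ ∈ O := hKO 0 (hΩK 0 hξ)
  have hpos : 0 < u ξ → F ξ (u ξ) (gradient φ ξ) (hessian φ ξ) ≤ 0 := by
    intro huξ
    obtain ⟨i, x, hi, hxξ, hxK, hlim⟩ :=
      exists_seq_tendsto_relLimsup hm hM (x := ξ) fun n => hΩK n hξ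
    -- Otherwise violating points accumulate in `closure Ω`, because the sets `K n` shrink to it.
    -- The upper limit there would then exceed what the maximum of `u - φ` at `ξ` allows.
    have hup : ∀ ε > 0, ∀ᶠ n in atTop, ∀ y ∈ K (i n), dist y ξ ≤ 1 →
        v (i n) y ≤ φ y - φ ξ + u ξ + ε := by
      intro ε hε
      by_contra hcon
      obtain ⟨e, he, hbad⟩ := extraction_of_frequently_atTop (not_eventually.1 hcon)
      push Not at hbad
      choose y hyK _ hy using hbad
      obtain ⟨z, -, s, hs, hlimz⟩ := (hKc 0).tendsto_subseq fun n => hK0 _ (hyK n)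
      have hidx : Tendsto (fun n => i (e (s n))) atTop atTop :=
        hi.comp (he.tendsto_atTop.comp hs.tendsto_atTop)
      have hz : z ∈ closure Ω := mem_of_tendsto_cthickening isClosed_closure (hd.comp hidx) hlimz
        fun n => hKd _ (hyK (s n))
      have hφz : Tendsto (fun n => φ (y (s n))) atTop (𝓝 (φ z)) :=
        (hφ.continuous.tendsto z).comp hlimz
      have h1 : φ z - φ ξ + u ξ + ε / 2 ≤ u z := by
        refine le_relLimsup_of_seq hM hidx hlimz (fun n => hyK (s n)) ?_
        filter_upwards [hφz.eventually_const_lt (show φ z - ε / 2 < φ z by linarith)] with n hn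
        have := hy (s n)
        simp only [Function.comp_apply]
        linarith
      have h2 : u z - φ z ≤ u ξ - φ ξ := hmax hz
      linarith
    obtain ⟨y, hy, hyξ, hwy⟩ := exists_test_points hφ.continuous one_pos (fun n => hKc (i n))
      (fun n => (hv (i n)).usc) hxK hxξ hlim hup
    have hli : Tendsto (fun n => l (i n)) atTop (𝓝 0) := hl.comp hi
    have hT := hF.tendsto_test hφ hξO hyξ hwy (hy.mono fun n h => hKO _ h.1)
    have hT2 : Tendsto (fun n => l (i n) * v (i n) (y n) ^ α) atTop (𝓝 0) := by
      have := hli.mul (((Real.continuous_rpow_const hα.le).tendsto (u ξ)).comp hwy)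
      rwa [zero_mul] at this
    refine le_of_tendsto_of_tendsto hT hT2 ?_
    have hgt : ∀ᶠ n in atTop, l (i n) < v (i n) (y n) := hli.eventually_lt hwy huξ
    filter_upwards [hy, hgt] with n h1 h2
    have := (hv (i n)).test _ (contDiff_add_pow_four hφ ξ) _ h1.1 h1.2 h2
    simp only [shiftedOperator] at this
    linarith
  -- Where `u` vanishes the obstacle may be active and the limit argument gives nothing. At an
  -- interior point `φ` then has a local minimum, and ellipticity with `F(ξ, 0, 0, 0) = 0` suffices;
  -- at a boundary point `u ≤ 0` already does.
  rcases (hu0 ξ hξ).eq_or_lt with h0 | h0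
  · refine ⟨fun hξΩ => ?_, fun _ => min_le_of_left_le h0.symm.le⟩
    have hmin : IsLocalMin (fun x => φ x - (fun _ : Space N => φ ξ) x) ξ := by
      filter_upwards [hΩ_open.mem_nhds hξΩ] with x hx
      have h1 : u x - φ x ≤ u ξ - φ ξ := hmax (subset_closure hx)
      have h2 := hu0 x (subset_closure hx)
      linarith
    obtain ⟨h1, h2⟩ := gradient_eq_and_posSemidef_of_isLocalMin hφ contDiff_const hmin
    rw [gradient_const] at h1
    rw [hessian_const, sub_zero] at h2
    have h3 := hF1 ξ hξO 0 0 0 (hessian φ ξ) Matrix.isSymm_zero h2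
    rw [zero_add, operator_zero hα hF2 hξO] at h3
    rw [← h0, h1]
    linarith
  · exact ⟨fun _ => hpos h0, fun _ => min_le_of_right_le (hpos h0)⟩

/-- A dichotomy for the greatest obstacle subsolutions: one staying below the cap `1` produces an
admissible positive supersolution, whereas a sequence always reaching the cap converges to a
counterexample to the maximum principle. -/
theorem mu1_pos_of_maximumPrinciple {O Ω : Set (Space N)} (hO : IsOpen O) (hΩ_open : IsOpen Ω)
    (hΩ_bdd : Bornology.IsBounded Ω) (hΩO : closure Ω ⊆ O)
    {F : Operator N} {α : ℝ} (hα : 0 < α) (hF : IsContinuousOperator O F)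
    (hF1 : IsDegenerateElliptic O F) (hF2 : IsPosHomogeneous O F α)
    (hMP : MaximumPrinciple F Ω) : 0 < mu1 O F α Ω := by
  by_contra hmu
  have hcpt : IsCompact (closure Ω) := hΩ_bdd.isCompact_closure
  obtain ⟨ρ, hρ, hρO⟩ := hcpt.exists_cthickening_subset_open hO hΩO
  set l : ℕ → ℝ := fun n => 1 / ((n : ℝ) + 1) with hl
  have hl0 : ∀ n, 0 < l n := fun n => Nat.one_div_pos_of_nat
  have hl1 : ∀ n, l n ≤ 1 := fun n => by
    simp only [hl]
    rw [div_le_one (by positivity)]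
    linarith [Nat.cast_nonneg (α := ℝ) n]
  have hlt : Tendsto l atTop (𝓝 0) := tendsto_one_div_add_atTop_nhds_zero_nat
  set d : ℕ → ℝ := fun n => ρ * l n with hd
  have hd0 : ∀ n, 0 < d n := fun n => mul_pos hρ (hl0 n)
  have hdρ : ∀ n, d n ≤ ρ := fun n => mul_le_of_le_one_right hρ.le (hl1 n)
  have hdt : Tendsto d atTop (𝓝 0) := by simpa using hlt.const_mul ρ
  set K : ℕ → Set (Space N) := fun n => Metric.cthickening (d n) (closure Ω) with hK
  have hKc : ∀ n, IsCompact (K n) := fun n => hcpt.cthickening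
  have hKO : ∀ n, K n ⊆ O := fun n => (Metric.cthickening_mono (hdρ n) _).trans hρO
  have hΩK : ∀ n, closure Ω ⊆ K n := fun n => Metric.self_subset_cthickening _
  have hK0 : ∀ n, K n ⊆ K 0 := fun n => Metric.cthickening_mono
    (by have h0 : d 0 = ρ := by simp [hd, hl]
        rw [h0]; exact hdρ n) _
  -- The same `l n` serves as eigenvalue parameter and as obstacle. The obstacle keeps the lower
  -- envelope positive, and both effects vanish in the limit.
  have hex := fun n => exists_greatest_obstacleSubsolution
    (isContinuousOperator_shifted hF (l n) hα) (hKc n) (hKO n) (hl1 n)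
  choose v hv hvmax using hex
  -- If the cap is never reached, the lower envelope on the open thickening witnesses `mu1 ≥ l n >
  -- 0`, contrary to `hmu`.
  have htouch : ∀ n, ∃ ξ ∈ K n, v n ξ = 1 := by
    intro n
    by_contra! hcon
    apply hmu
    set U := Metric.thickening (d n) (closure Ω) with hU
    have hUo : IsOpen U := Metric.isOpen_thickening
    have hUK : U ⊆ K n := Metric.thickening_subset_cthickening _ _
    have hlt1 : ∀ x ∈ U, v n x < 1 := fun x hx =>
      lt_of_le_of_ne ((hv n).le x (hUK hx)) (hcon x (hUK hx))
    have hmU : ∀ x ∈ U, l n ≤ v n x := fun x hx => (hv n).ge x (hUK hx)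
    have hMU : ∀ x ∈ U, v n x ≤ 1 := fun x hx => (hlt1 x hx).le
    refine lt_of_lt_of_le (EReal.coe_pos.2 (hl0 n)) (le_sSup ⟨l n, rfl, U, hUo,
      Metric.self_subset_thickening (hd0 n) _, hUK.trans (hKO n), lscEnvelope (v n),
      lowerSemicontinuousOn_lscEnvelope hUo hmU hMU, fun x hx => ?_, ?_⟩)
    · exact (hl0 n).trans_le (le_lscEnvelope hUo hMU hx
        (by filter_upwards [hUo.mem_nhds hx] with y hy using hmU y hy))
    · exact isSupersolution_lscEnvelope (isContinuousOperator_shifted hF (l n) hα)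
        (isDegenerateElliptic_shifted hF1 (l n) α) (hKO n) hUo hUK (hv n) (hvmax n) hlt1
  choose ξ hξK hξ using htouch
  have hm : ∀ n, ∀ y ∈ K n, 0 ≤ v n y := fun n y hy => (hl0 n).le.trans ((hv n).ge y hy)
  have hM : ∀ n, ∀ y ∈ K n, v n y ≤ 1 := fun n y hy => (hv n).le y hy
  obtain ⟨z, -, s, hs, hlim⟩ := (hKc 0).tendsto_subseq fun n => hK0 n (hξK n)
  have hz : z ∈ closure Ω := mem_of_tendsto_cthickening isClosed_closure
    (hdt.comp hs.tendsto_atTop) hlim fun n => hξK (s n)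
  have h1 : 1 ≤ relLimsup K v z := le_relLimsup_of_seq hM hs.tendsto_atTop hlim
    (fun n => hξK (s n)) (Eventually.of_forall fun n => (hξ (s n)).ge)
  have h2 := hMP (relLimsup K v) (upperSemicontinuousOn_relLimsup hm hM hΩK)
    (isDirichletSubsolution_relLimsup hα hΩ_open hF hF1 hF2 hdt hKc (fun _ => Subset.rfl) hΩK hK0
      hKO hlt (fun n => (hl0 n).le) hv) z hz
  linarith

end DegenerateMP

/-! ### The equivalence -/

theorem theorem1p1 {N : ℕ} (O Ω : Set (DegenerateMP.Space N))
    (hO : IsOpen O) (hΩ_open : IsOpen Ω) (hΩ_conn : IsConnected Ω)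
    (hΩ_bdd : Bornology.IsBounded Ω) (hΩO : closure Ω ⊆ O)
    (F : DegenerateMP.Operator N) (α : ℝ) (hα : 0 < α)
    (hF : DegenerateMP.IsContinuousOperator O F)
    (hF1 : DegenerateMP.IsDegenerateElliptic O F)
    (hF2 : DegenerateMP.IsPosHomogeneous O F α)
    (hF3 : DegenerateMP.IsContinuousInValueUniformly O F)
    (hF4 : DegenerateMP.StructureCondition O F) :
    DegenerateMP.MaximumPrinciple F Ω ↔ 0 < DegenerateMP.mu1 O F α Ω := by
  refine ⟨DegenerateMP.mu1_pos_of_maximumPrinciple hO hΩ_open hΩ_bdd hΩO hα hF hF1 hF2, ?_⟩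
  intro hmu
  obtain ⟨_, ⟨l, rfl, Ω', hΩ', hΩΩ', hΩ'O, φ, hφ, hpos, hsuper⟩, hl⟩ := lt_sSup_iff.1 hmu
  exact DegenerateMP.maximumPrinciple_of_supersolution hΩ_bdd hα hF hF2 hF3 hF4
    (EReal.coe_pos.1 hl) hΩ' hΩΩ' hΩ'O hφ hpos hsuper
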